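/- All graphs are finite; parallel edges (and loops) are allowed a priori. A perfect matching of a graph is a set of non-loop edges such that every vertex is incident with exactly one of them, and an edge is called lonely if it lies in exactly one perfect matching. Let $\mathcal{U}_4$ be the class of $3$-connected cubic graphs with exactly four lonely edges. Extended prisms are defined as follows. Let $G$ be a cubic graph with a triangle $T$ whose vertices are labelled $x_1,x_2,x_3$, and let $s\in\{1,2,3\}$. The $T$-extension of index $s$ of $G$ is the cubic graph obtained by replacing the vertex $x_s$ with a new triangle, each of whose three vertices is joined to a different one of the three neighbours of $x_s$. The vertices of the new triangle are again labelled $x_1,x_2,x_3$, in such a way that for each $j\neq s$ the new vertex $x_j$ is adjacent to the old vertex $x_j$ (so the new $x_s$ is adjacent to the neighbour of the old $x_s$ outside the old triangle). The prism consists of two disjoint triangles $T_u=u_1u_2u_3$ and $T_v=v_1v_2v_3$ together with the edges $u_1v_1,u_2v_2,u_3v_3$. For $m\ge 1$ and $s_1,\dots,s_m\in\{1,2,3\}$, the extended prism with extension pattern $(s_1,\dots,s_m)$ is the graph obtained from the prism, with the triangle $T_v$ labelled by $x_i=v_i$, by applying consecutively the extensions of indices $s_1,\dots,s_m$, each one to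 the labelled triangle created by the previous one. **Theorem.** A graph $G$ belongs to $\mathcal{U}_4$ if and only if $G$ is isomorphic to the extended prism with extension pattern $(3,1)$ or to the extended prism with extension pattern $(\underbrace{3,\dots,3}_{k\text{ times}})$ for some $k\ge 2$. -/

import Mathlib

namespace Graph

variable {α β : Type*}

/-- Every vertex has degree three; a loop at a vertex is counted twice. -/
def IsCubic (G : Graph α β) : Prop :=
  ∀ v ∈ G.vertexSet, (G.incidenceSet v).encard + (G.loopSet v).encard = 3

/-- `G` has at least four vertices, and deleting at most two vertices leaves a connected graph
(loops and parallel edges, which `toSimpleGraph` forgets, do not matter for connectedness). -/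
def IsThreeConnected (G : Graph α β) : Prop :=
  4 ≤ G.vertexSet.encard ∧
    ∀ X : Set G.vertexSet, X.encard ≤ 2 → (G.toSimpleGraph.induce Xᶜ).Connected

/-- A set of (non-loop) edges such that every vertex is incident with exactly one of them. -/
structure IsPerfectMatching (G : Graph α β) (M : Set β) : Prop where
  subset_edgeSet : M ⊆ G.edgeSet
  not_isLoopAt : ∀ e ∈ M, ∀ v, ¬ G.IsLoopAt e v
  existsUnique_inc : ∀ v ∈ G.vertexSet, ∃! e, e ∈ M ∧ G.Inc e v

/-- The set of lonely edges: the edges lying in exactly one perfect matching. -/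
def lonelyEdges (G : Graph α β) : Set β :=
  {e | e ∈ G.edgeSet ∧ ∃! M : Set β, G.IsPerfectMatching M ∧ e ∈ M}

/-- Membership in the class of (finite) 3-connected cubic graphs with exactly `k` lonely edges,
for `k ≥ 1`. -/
structure MemU (k : ℕ) (G : Graph α β) : Prop where
  finite : G.vertexSet.Finite
  cubic : G.IsCubic
  threeConnected : G.IsThreeConnected
  encard_lonelyEdges : G.lonelyEdges.encard = k

end Graph

/-- A simple graph with a distinguished triangle whose vertices are labelled `x 0`, `x 1`, `x 2`
(written $x_1, x_2, x_3$ on paper). -/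
structure TriangleGraph where
  V : Type
  graph : SimpleGraph V
  x : Fin 3 → V
  triangle : ∀ i j, i ≠ j → graph.Adj (x i) (x j)

namespace TriangleGraph

/-- Adjacency after the vertex `x s` has been replaced with a new triangle, whose vertices are
`Sum.inr 0`, `Sum.inr 1`, `Sum.inr 2`. The new vertices take over the edges formerly at `x s`:
for `j ≠ s`, the new vertex `j` is joined to the old vertex `x j`, and the new vertex `s` is
joined to the neighbour of `x s` outside the old triangle. -/
def extendAdj (T : TriangleGraph) (s : Fin 3) :
    {w : T.V // w ≠ T.x s} ⊕ Fin 3 → {w : T.V // w ≠ T.x s} ⊕ Fin 3 → Prop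
  | .inl a, .inl b => T.graph.Adj a b
  | .inr i, .inr j => i ≠ j
  | .inl a, .inr j =>
      (j ≠ s ∧ (a : T.V) = T.x j) ∨ (j = s ∧ T.graph.Adj a (T.x s) ∧ ∀ i, (a : T.V) ≠ T.x i)
  | .inr j, .inl a =>
      (j ≠ s ∧ (a : T.V) = T.x j) ∨ (j = s ∧ T.graph.Adj a (T.x s) ∧ ∀ i, (a : T.V) ≠ T.x i)

/-- The `T`-extension of index `s`, with the new triangle as distinguished triangle. -/
def extend (T : TriangleGraph) (s : Fin 3) : TriangleGraph where
  V := {w : T.V // w ≠ T.x s} ⊕ Fin 3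
  graph :=
    { Adj := T.extendAdj s
      symm := ⟨by
        rintro (a | i) (b | j) h
        · exact SimpleGraph.Adj.symm h
        · exact h
        · exact h
        · exact Ne.symm h⟩
      loopless := ⟨by
        rintro (a | i) h
        · exact T.graph.loopless.irrefl _ h
        · exact h rfl⟩ }
  x := Sum.inr
  triangle := fun _ _ h => h

/-- The prism: two disjoint triangles `(0, 0), (1, 0), (2, 0)` and `(0, 1), (1, 1), (2, 1)`
joined by the perfect matching of the edges `(i, 0) (i, 1)`; the second one is distinguished. -/
def prism : TriangleGraph where
  V := Fin 3 × Fin 2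
  graph := (⊤ : SimpleGraph (Fin 3)) □ (⊤ : SimpleGraph (Fin 2))
  x := fun i => (i, 1)
  triangle := fun i j h => by simp [SimpleGraph.boxProd_adj, h]

/-- The extended prism with the given extension pattern (whose entries 1, 2, 3 on paper are
`0`, `1`, `2` here): the extensions are applied to the prism from left to right, each one to the
triangle created by the previous one. -/
def extendedPrism (pattern : List (Fin 3)) : TriangleGraph :=
  pattern.foldl extend prism

end TriangleGraph

/-- `G` is (isomorphic to) the extended prism with the given extension pattern; in particular `G`
has no loops and no parallel edges. -/
def Graph.IsExtendedPrism {α β : Type*} (G : Graph α β) (pattern : List (Fin 3)) : Prop :=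
  G.Simple ∧ Nonempty (G.toSimpleGraph ≃g (TriangleGraph.extendedPrism pattern).graph)

/-! A 3-connected cubic graph is simple, because at least three neighbours must share at most three
incident edges. For cubic graphs, 3-connectedness amounts to every edge cut having at least three
edges (`CutsGeThree`). The argument runs on simple cubic graphs with this cut condition, and a
perfect matching is the involution exchanging partners.

Reduction. Suppose the matching `f` is determined by its edge at `u`. Among the vertex sets avoiding
`u`, bounded by three edges and left by exactly one matching edge, choose a smallest nontrivial one,
`A`. Deleting a matching edge inside `A` destroys every perfect matching of the rest of `A`. Tutte's
theorem then gives a barrier on which all edge counts are tight, and minimality makes its odd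
components singletons, so `A` is bipartite up to that one edge. If `A` had more than three vertices,
two such colourings, from different matching edges, would differ on a set bounded by at most two
edges. So `A` is a triangle crossed once by `f` (`exists_triangle`). Contracting it keeps an edge at
`u` lonely, unless the graph is already $K_4$ (`exists_iso_blow`). Hence every graph in question
grows from $K_4$ by replacing vertices with triangles, with a lonely edge at every stage.

Monotonicity. Let `G.blow x n` be `G` with `x` replaced by a triangle. Each of its lonely edges
comes from a different lonely edge of `G`; an edge at `x` corresponds to the opposite triangle edge.
A lonely edge of `G` away from `x` is lost if it lies in a spanning subgraph with degree three at
`x` and degree one elsewhere (`IsTri`), since that subgraph yields a further matching, using all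
three edges leaving the triangle. So the number of lonely edges never grows, and suitable `IsTri`
subgraphs make it drop (`ncard_lonelySet_blow_le`).

Growth. `ladder 1` is $K_4$, `ladder 2` is the prism, and replacing an end vertex of a ladder gives
the next ladder. $K_4$ and the prism are vertex-transitive. In the ladder with three rungs, a vertex
of an outer rung gives `prism31`. Every other replacement in a ladder, and every replacement in
`prism31`, leaves at most three lonely edges. Thus four or more lonely edges force a ladder or
`prism31` (`isLadderOrPrism31_of_four_le`). Ladders with at least four rungs have exactly four
lonely edges, shorter ones do not, and `prism31` has four. Finally, the pattern $(3,\dots,3)$ of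
length $k$ is the ladder with $k+2$ rungs, and $(3,1)$ is `prism31`. -/

namespace SimpleGraph

/-! ### Perfect matchings as involutions, and Tutte's theorem -/

/-- `f` maps every vertex to its partner in a perfect matching of `G`. -/
def IsPM {V : Type*} (G : SimpleGraph V) (f : V → V) : Prop :=
  ∀ v, G.Adj v (f v) ∧ f (f v) = v

/-- Tutte's theorem with the odd components as bare vertex sets; even order raises the surplus of
components from one to two. -/
theorem exists_oddFamily_of_not_exists_isPM {W : Type*} [Fintype W] [DecidableEq W]
    (K : SimpleGraph W) (hW : Even (Fintype.card W)) (h : ¬ ∃ f, K.IsPM f) :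
    ∃ (S : Finset W) (𝒟 : Finset (Finset W)), (𝒟 : Set (Finset W)).PairwiseDisjoint id ∧
      (∀ D ∈ 𝒟, Disjoint D S ∧ Odd D.card ∧ ∀ a ∈ D, ∀ b, K.Adj a b → b ∉ S → b ∈ D) ∧
      S.card + 2 ≤ 𝒟.card := by
  classical
  have hno : ¬ ∃ M : Subgraph K, M.IsPerfectMatching := by
    rintro ⟨M, hM⟩
    rw [Subgraph.isPerfectMatching_iff] at hM
    choose f hf hu using hM
    exact h ⟨f, fun v => ⟨(hf v).adj_sub, (hu _ _ (hf v).symm).symm⟩⟩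
  rw [tutte] at hno
  push Not at hno
  obtain ⟨u, hu⟩ := hno
  unfold IsTutteViolator at hu
  set H := ((⊤ : K.Subgraph).deleteVerts u).coe with hH
  have hpar := H.odd_ncard_oddComponents
  let F : H.ConnectedComponent → Finset W := fun c => (Subtype.val '' c.supp).toFinset
  have hF : ∀ c, ∀ a, a ∈ F c ↔ ∃ ha, H.connectedComponentMk ⟨a, ha⟩ = c := by
    intro c a
    simp [F]
  have hcard : ∀ c, (F c).card = c.supp.ncard := by
    intro c
    rw [← Set.ncard_eq_toFinset_card', Set.ncard_image_of_injective _ Subtype.val_injective]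
  have hinj : Function.Injective F := by
    intro c d hcd
    induction c using ConnectedComponent.ind with | _ v => 
    have : v.1 ∈ F d := by rw [← hcd, hF]; exact ⟨v.2, rfl⟩
    rw [hF] at this
    exact this.2
  refine ⟨u.toFinset, H.oddComponents.toFinset.image F, ?_, ?_, ?_⟩
  · intro D hD D' hD' hne
    simp only [Finset.coe_image, Set.mem_image] at hD hD'
    obtain ⟨c, -, rfl⟩ := hD
    obtain ⟨d, -, rfl⟩ := hD'
    simp only [Function.onFun, id]
    rw [Finset.disjoint_left]
    intro a ha hb
    rw [hF] at ha hb
    obtain ⟨h1, rfl⟩ := ha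
    obtain ⟨h2, rfl⟩ := hb
    exact hne rfl
  · intro D hD
    simp only [Finset.mem_image, Set.mem_toFinset] at hD
    obtain ⟨c, hc, rfl⟩ := hD
    refine ⟨?_, ?_, ?_⟩
    · rw [Finset.disjoint_left]
      intro a ha hb
      rw [hF] at ha
      obtain ⟨h1, -⟩ := ha
      simp at h1 hb
      exact h1 hb
    · rw [hcard]; exact hc
    · intro a ha b hab hb
      rw [hF] at ha ⊢
      obtain ⟨h1, h2⟩ := ha
      have hb' : b ∈ ((⊤ : K.Subgraph).deleteVerts u).verts := by simpa using hb
      refine ⟨hb', ?_⟩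
      rw [← h2]
      apply ConnectedComponent.sound
      apply Adj.reachable
      rw [hH, Subgraph.coe_adj, Subgraph.deleteVerts_adj]
      simp at h1 hb'
      simp [h1, hb', hab.symm]
  · rw [Finset.card_image_of_injective _ hinj, ← Set.ncard_eq_toFinset_card',
      ← Set.ncard_eq_toFinset_card']
    have h1 : Nat.card ((⊤ : K.Subgraph).deleteVerts u).verts + u.ncard = Fintype.card W := by
      rw [Nat.card_coe_set_eq, Subgraph.deleteVerts_verts, Subgraph.verts_top, 
        Set.ncard_sdiff (Set.subset_univ _), Set.ncard_univ, Nat.card_eq_fintype_card]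
      have := Set.ncard_le_card u
      rw [Nat.card_eq_fintype_card] at this
      omega
    -- The number of odd components has the parity of the number of remaining vertices, hence that
    -- of `u`, so a surplus of at least one is a surplus of at least two.
    rw [Nat.odd_iff, Nat.odd_iff] at hpar
    rw [Nat.even_iff] at hW
    omega

theorem exists_oddFamily {V : Type*} [DecidableEq V] (K : SimpleGraph V)
    (B : Finset V) (hB : Even B.card)
    (h : ¬ ∃ f : V → V, ∀ b ∈ B, f b ∈ B ∧ K.Adj b (f b) ∧ f (f b) = b) :
    ∃ (S : Finset V) (𝒟 : Finset (Finset V)), S ⊆ B ∧ (𝒟 : Set (Finset V)).PairwiseDisjoint id ∧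
      (∀ D ∈ 𝒟, D ⊆ B ∧ Disjoint D S ∧ Odd D.card ∧
        ∀ a ∈ D, ∀ b ∈ B, K.Adj a b → b ∉ S → b ∈ D) ∧
      S.card + 2 ≤ 𝒟.card := by
  classical
  obtain ⟨S, 𝒟, hdis, hD, hc⟩ := exists_oddFamily_of_not_exists_isPM
    (K.comap (Subtype.val : B → V)) (by simpa using hB) (by
      rintro ⟨f, hf⟩
      refine h ⟨fun v => if hv : v ∈ B then f ⟨v, hv⟩ else v, fun b hb => ?_⟩
      have := hf ⟨b, hb⟩
      simp only [comap_adj] at this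
      simp [hb, this.1, this.2])
  let φ := Function.Embedding.subtype (fun v => v ∈ B)
  refine ⟨S.map φ, 𝒟.map (Finset.mapEmbedding φ).toEmbedding, ?_, ?_, ?_, by simpa using hc⟩
  · intro a ha
    simp only [Finset.mem_map] at ha
    obtain ⟨b, -, rfl⟩ := ha
    exact b.2
  · intro D hD D' hD' hne
    simp only [Finset.coe_map, Set.mem_image] at hD hD'
    obtain ⟨c, h1, rfl⟩ := hD
    obtain ⟨d, h2, rfl⟩ := hD'
    have := hdis h1 h2 (fun h => hne (by rw [h]))
    simpa [Function.onFun] using this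
  · intro D hD'
    simp only [Finset.mem_map] at hD'
    obtain ⟨c, h1, rfl⟩ := hD'
    obtain ⟨h2, h3, h4⟩ := hD c h1
    refine ⟨?_, by simpa using h2, by simpa using h3, ?_⟩
    · intro a ha
      simp [φ] at ha
      exact ha.1
    · intro a ha b hb hab hbS
      simp [φ] at ha hbS ⊢
      obtain ⟨ha, ha'⟩ := ha
      exact ⟨hb, h4 _ ha' ⟨b, hb⟩ hab (hbS hb)⟩

/-! ### Edge counts and edge cuts in cubic graphs -/

open Classical in
/-- The number of pairs of adjacent vertices `(a, b)` with `a ∈ X` and `b ∈ Y`. -/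
noncomputable def edgeCount {V : Type*} (G : SimpleGraph V) (X Y : Finset V) : ℕ :=
  ∑ a ∈ X, ∑ b ∈ Y, if G.Adj a b then 1 else 0

section edgeCount

variable {V : Type*} {G : SimpleGraph V}

theorem edgeCount_comm (X Y : Finset V) : G.edgeCount X Y = G.edgeCount Y X := by
  unfold edgeCount
  rw [Finset.sum_comm]
  refine Finset.sum_congr rfl fun a _ => Finset.sum_congr rfl fun b _ => ?_
  congr 1
  exact propext (G.adj_comm _ _)

theorem edgeCount_union_left [DecidableEq V] {X Y : Finset V} (h : Disjoint X Y) (Z : Finset V) :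
    G.edgeCount (X ∪ Y) Z = G.edgeCount X Z + G.edgeCount Y Z :=
  Finset.sum_union h

theorem edgeCount_union_right [DecidableEq V] {X Y : Finset V} (h : Disjoint X Y) (Z : Finset V) :
    G.edgeCount Z (X ∪ Y) = G.edgeCount Z X + G.edgeCount Z Y := by
  rw [edgeCount_comm, edgeCount_union_left h, edgeCount_comm X, edgeCount_comm Y]

theorem edgeCount_mono {X X' Y Y' : Finset V} (hX : X ⊆ X') (hY : Y ⊆ Y') :
    G.edgeCount X Y ≤ G.edgeCount X' Y' := by
  unfold edgeCount
  refine (Finset.sum_le_sum_of_subset hX).trans (Finset.sum_le_sum fun a _ => ?_)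
  exact Finset.sum_le_sum_of_subset hY

theorem edgeCount_pos_iff {X Y : Finset V} :
    0 < G.edgeCount X Y ↔ ∃ a ∈ X, ∃ b ∈ Y, G.Adj a b := by
  unfold edgeCount
  simp [Nat.pos_iff_ne_zero, Finset.sum_eq_zero_iff]

theorem edgeCount_eq_zero_iff {X Y : Finset V} :
    G.edgeCount X Y = 0 ↔ ∀ a ∈ X, ∀ b ∈ Y, ¬ G.Adj a b := by
  unfold edgeCount
  simp [Finset.sum_eq_zero_iff]

theorem edgeCount_eq_card [DecidableEq V] (X Y : Finset V) [DecidableRel G.Adj] :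
    G.edgeCount X Y = ((X ×ˢ Y).filter fun p => G.Adj p.1 p.2).card := by
  unfold edgeCount
  rw [Finset.card_filter, Finset.sum_product]
  congr!

theorem edgeCount_biUnion_left [DecidableEq V] {𝒟 : Finset (Finset V)}
    (h : (𝒟 : Set (Finset V)).PairwiseDisjoint id) (Z : Finset V) :
    G.edgeCount (𝒟.biUnion id) Z = ∑ D ∈ 𝒟, G.edgeCount D Z :=
  Finset.sum_biUnion h

theorem edgeCount_eq_sum_left (X Y : Finset V) :
    G.edgeCount X Y = ∑ a ∈ X, G.edgeCount {a} Y := by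
  simp [edgeCount]

end edgeCount

/-- Every vertex has exactly three neighbours. -/
def Cubic {V : Type*} (G : SimpleGraph V) : Prop :=
  ∀ v, ∃ n : Fin 3 → V, Function.Injective n ∧ ∀ w, G.Adj v w ↔ ∃ i, w = n i

/-- Every edge cut has at least three edges. -/
def CutsGeThree {V : Type*} [Fintype V] [DecidableEq V] (G : SimpleGraph V) : Prop :=
  ∀ X : Finset V, X.Nonempty → X ≠ Finset.univ → 3 ≤ G.edgeCount X Xᶜ

theorem Cubic.edgeCount_singleton_le {V : Type*} {G : SimpleGraph V} (hG : G.Cubic) (v : V)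
    (Y : Finset V) : G.edgeCount {v} Y ≤ 3 := by
  classical
  obtain ⟨n, hn, h⟩ := hG v
  simp only [edgeCount, Finset.sum_singleton, ← Finset.card_filter]
  calc _ ≤ (Finset.univ.image n).card := Finset.card_le_card (by
        intro a ha
        simp only [Finset.mem_filter, h] at ha
        obtain ⟨-, i, rfl⟩ := ha
        simp)
    _ ≤ 3 := Finset.card_image_le.trans (by simp)

theorem Cubic.edgeCount_singleton_univ {V : Type*} [Fintype V] {G : SimpleGraph V} (hG : G.Cubic)
    (v : V) : G.edgeCount {v} Finset.univ = 3 := by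
  classical
  obtain ⟨n, hn, h⟩ := hG v
  simp only [edgeCount, Finset.sum_singleton, ← Finset.card_filter]
  have : Finset.univ.filter (fun b => G.Adj v b) = Finset.univ.image n := by
    ext a
    simp [h, eq_comm]
  rw [this, Finset.card_image_of_injective _ hn]
  simp

theorem Cubic.edgeCount_le {V : Type*} {G : SimpleGraph V} (hG : G.Cubic) (X Y : Finset V) :
    G.edgeCount X Y ≤ 3 * X.card := by
  rw [edgeCount_eq_sum_left, mul_comm, ← smul_eq_mul]
  exact Finset.sum_le_card_nsmul _ _ _ fun a _ => hG.edgeCount_singleton_le a Y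

theorem Cubic.edgeCount_univ {V : Type*} [Fintype V] {G : SimpleGraph V} (hG : G.Cubic)
    (X : Finset V) : G.edgeCount X Finset.univ = 3 * X.card := by
  rw [edgeCount_eq_sum_left, Finset.sum_congr rfl fun a _ => hG.edgeCount_singleton_univ a]
  simp [mul_comm]

theorem even_card_of_involution {V : Type*} {B : Finset V} {f : V → V} (hB : ∀ b ∈ B, f b ∈ B)
    (hne : ∀ b ∈ B, f b ≠ b) (hf : ∀ b ∈ B, f (f b) = b) : Even B.card := by
  rw [← ZMod.natCast_eq_zero_iff_even, Finset.cast_card]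
  exact Finset.sum_involution (fun a _ => f a) (fun _ _ => by decide) (fun a ha _ => hne a ha)
    hB hf

theorem IsPM.ne {V : Type*} {G : SimpleGraph V} {f : V → V} (hf : G.IsPM f) (v : V) : f v ≠ v := (hf v).1.ne'

theorem IsPM.apply_apply {V : Type*} {G : SimpleGraph V} {f : V → V} (hf : G.IsPM f) (v : V) : f (f v) = v := (hf v).2

theorem IsPM.injective {V : Type*} {G : SimpleGraph V} {f : V → V} (hf : G.IsPM f) :
    Function.Injective f :=
  Function.LeftInverse.injective hf.apply_apply

theorem IsPM.apply_eq_of_apply_eq {V : Type*} {G : SimpleGraph V} {f : V → V} (hf : G.IsPM f)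
    {a b : V} (h : f a = b) : f b = a :=
  h ▸ hf.apply_apply a

/-! ### Tight barriers and the triangle crossed once by a uniquely determined matching -/

section Barrier

variable {V : Type*} [Fintype V] [DecidableEq V] {G : SimpleGraph V} {f : V → V} {u : V}

/-- `A` is the shore of a 3-edge cut, avoids `u`, and exactly one edge of the perfect matching `f`
leaves `A`, namely the one at `w`. -/
structure IsShore (G : SimpleGraph V) (f : V → V) (u : V) (A : Finset V) (w : V) : Prop where
  notMem : u ∉ A
  edgeCount_compl : G.edgeCount A Aᶜ = 3
  root_mem : w ∈ A
  root_notMem : f w ∉ A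
  apply_mem : ∀ a ∈ A, a ≠ w → f a ∈ A

variable {A : Finset V} {w : V}

theorem IsShore.apply_mem_erase (hA : G.IsShore f u A w) (hf : G.IsPM f) {a : V}
    (ha : a ∈ A.erase w) : f a ∈ A.erase w := by
  rw [Finset.mem_erase] at ha ⊢
  refine ⟨fun h => hA.root_notMem ?_, hA.apply_mem a ha.2 ha.1⟩
  rw [← h, hf.apply_apply]
  exact ha.2

theorem IsShore.even_card_erase (hA : G.IsShore f u A w) (hf : G.IsPM f) :
    Even (A.erase w).card :=
  even_card_of_involution (f := f) (fun _ h => hA.apply_mem_erase hf h) (fun b _ => hf.ne b)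
    (fun b _ => hf.apply_apply b)

/-- Deleting a matching edge inside the shore of a 3-edge cut destroys all perfect matchings of
the shore, when the matching is determined by its edge at `u`. -/
theorem IsShore.not_exists_matching (hA : G.IsShore f u A w) (hf : G.IsPM f)
    (huniq : ∀ f', G.IsPM f' → f' u = f u → f' = f) {a : V} (ha : a ∈ A.erase w) :
    ¬ ∃ h : V → V, ∀ b ∈ A.erase w,
      h b ∈ A.erase w ∧ (G.deleteEdges {s(a, f a)}).Adj b (h b) ∧ h (h b) = b := by
  rintro ⟨h, hh⟩
  let f' : V → V := fun v => if v ∈ A.erase w then h v else f v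
  have h1 : ∀ v, v ∈ A.erase w → f' v = h v := fun v hv => if_pos hv
  have h2 : ∀ v, v ∉ A.erase w → f' v = f v := fun v hv => if_neg hv
  have hpm : G.IsPM f' := by
    intro v
    by_cases hv : v ∈ A.erase w
    · obtain ⟨h3, h4, h5⟩ := hh v hv
      rw [h1 v hv, h1 _ h3, deleteEdges_adj] at *
      exact ⟨h4.1, h5⟩
    · have h3 : f v ∉ A.erase w := fun h3 => hv (by
        have := hA.apply_mem_erase hf h3
        rwa [hf.apply_apply] at this)
      rw [h2 v hv, h2 _ h3]
      exact hf v
  have h3 := huniq f' hpm (h2 u fun h => hA.notMem (Finset.mem_of_mem_erase h))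
  obtain ⟨-, h4, -⟩ := hh a ha
  rw [← h1 a ha, h3, deleteEdges_adj] at h4
  simp at h4

/-- The tight barrier which Tutte's theorem yields for a matching edge `s(a, f a)` inside the
shore of a 3-edge cut. -/
structure IsBarrier (G : SimpleGraph V) (f : V → V) (A : Finset V) (w a : V)
    (S : Finset V) (𝒟 : Finset (Finset V)) : Prop where
  subset : S ⊆ A.erase w
  pairwiseDisjoint : (𝒟 : Set (Finset V)).PairwiseDisjoint id
  subset_erase : ∀ D ∈ 𝒟, D ⊆ A.erase w
  disjoint : ∀ D ∈ 𝒟, Disjoint D S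
  odd_card : ∀ D ∈ 𝒟, Odd D.card
  closed : ∀ D ∈ 𝒟, ∀ x ∈ D, ∀ y ∈ A.erase w, G.Adj x y → s(x, y) ≠ s(a, f a) → y ∉ S → y ∈ D
  card_eq : 𝒟.card = S.card + 2
  edgeCount_compl : ∀ D ∈ 𝒟, G.edgeCount D Dᶜ = 3
  edgeCount_barrier : G.edgeCount (𝒟.biUnion id) S = 3 * S.card
  edgeCount_root : G.edgeCount (𝒟.biUnion id) {w} = 2
  edgeCount_outer : G.edgeCount (𝒟.biUnion id) Aᶜ = 2
  edgeCount_root_outer : G.edgeCount {w} Aᶜ = 1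
  left_mem : a ∈ 𝒟.biUnion id
  right_mem : f a ∈ 𝒟.biUnion id

/-- Apply Tutte's theorem to `A.erase w` without the edge `s(a, f a)` and count the edges leaving
the odd components. There are at least $3(|S|+2)$ of them. At most $3|S|$ go to `S`, at most two to
`w` (whose third edge leaves `A`), at most two leave `A` (the third edge of that cut is at `w`), and
the deleted edge counts at most twice. The bounds agree, so each is an equality, and both `a` and `f
a` lie in odd components. -/
theorem IsShore.exists_isBarrier (hG : G.Cubic) (h3 : G.CutsGeThree)
    (hA : G.IsShore f u A w) (hf : G.IsPM f)
    (huniq : ∀ f', G.IsPM f' → f' u = f u → f' = f) {a : V} (ha : a ∈ A.erase w) :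
    ∃ S 𝒟, G.IsBarrier f A w a S 𝒟 := by
  obtain ⟨S, 𝒟, hS, hdis, hD, hcard⟩ := exists_oddFamily _ _ (hA.even_card_erase hf)
    (hA.not_exists_matching hf huniq ha)
  have hcl : ∀ D ∈ 𝒟, ∀ x ∈ D, ∀ y ∈ A.erase w, G.Adj x y → s(x, y) ≠ s(a, f a) → y ∉ S →
      y ∈ D := fun D hD' x hx y hy hxy hne hyS =>
    (hD D hD').2.2.2 x hx y hy (by rw [deleteEdges_adj]; exact ⟨hxy, by simpa using hne⟩) hyS
  set U := 𝒟.biUnion id with hU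
  have hUB : U ⊆ A.erase w := Finset.biUnion_subset.2 fun D h => (hD D h).1
  have hUS : Disjoint U S := by
    rw [hU, Finset.disjoint_biUnion_left]
    exact fun D h => (hD D h).2.1
  have hAc : Disjoint (A.erase w) Aᶜ :=
    disjoint_compl_right.mono_left (Finset.erase_subset _ _)
  have hwS : Disjoint S {w} := by
    rw [Finset.disjoint_singleton_right]
    exact fun h => by simpa using hS h
  have hSwA : Disjoint (S ∪ {w}) Aᶜ := by
    rw [Finset.disjoint_union_left]
    exact ⟨hAc.mono_left hS, by simpa using hA.root_mem⟩
  -- the contribution of the deleted matching edge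
  let γ : Finset V → Finset V := fun D => D.filter fun x => (x = a ∨ x = f a) ∧ f x ∉ D
  have hγ : ∀ D ∈ 𝒟, G.edgeCount D Dᶜ ≤ G.edgeCount D (S ∪ {w} ∪ Aᶜ) + (γ D).card := by
    intro D hD'
    have h1 : Dᶜ ⊆ (S ∪ {w} ∪ Aᶜ) ∪ (Dᶜ \ (S ∪ {w} ∪ Aᶜ)) := by
      intro x hx
      by_cases h : x ∈ S ∪ {w} ∪ Aᶜ
      · exact Finset.mem_union_left _ h
      · exact Finset.mem_union_right _ (Finset.mem_sdiff.2 ⟨hx, h⟩)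
    refine (edgeCount_mono subset_rfl h1).trans ?_
    rw [edgeCount_union_right Finset.disjoint_sdiff]
    gcongr
    classical
    rw [edgeCount_eq_card]
    have key : ∀ p ∈ (D ×ˢ (Dᶜ \ (S ∪ {w} ∪ Aᶜ))).filter (fun p => G.Adj p.1 p.2),
        p.1 ∈ γ D ∧ p.2 = f p.1 := by
      rintro ⟨x, y⟩ hp
      simp only [Finset.mem_filter, Finset.mem_product, Finset.mem_sdiff, Finset.mem_compl,
        Finset.mem_union, Finset.mem_singleton, not_or, not_not] at hp
      obtain ⟨⟨hx, hy, ⟨hyS, hyw⟩, hyA⟩, hxy⟩ := hp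
      have : s(x, y) = s(a, f a) := by
        by_contra hne
        exact hy (hcl D hD' x hx y (Finset.mem_erase.2 ⟨hyw, hyA⟩) hxy hne hyS)
      rw [Sym2.eq_iff] at this
      obtain ⟨rfl, rfl⟩ | ⟨rfl, rfl⟩ := this
      · simp [γ, hx, hy]
      · simp [γ, hx, hy, hf.apply_apply]
    refine Finset.card_le_card_of_injOn Prod.fst (fun p hp => (key p hp).1) ?_
    intro p hp q hq hpq
    exact Prod.ext hpq (by rw [(key p hp).2, (key q hq).2, hpq])
  have hγsub : 𝒟.biUnion γ ⊆ {a, f a} := by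
    intro x hx
    simp only [γ, Finset.mem_biUnion, Finset.mem_filter] at hx
    obtain ⟨D, -, -, h, -⟩ := hx
    simpa using h
  have hγcard : (𝒟.biUnion γ).card = ∑ D ∈ 𝒟, (γ D).card := by
    apply Finset.card_biUnion
    intro D h D' h' hne
    exact (hdis h h' hne).mono (Finset.filter_subset _ _) (Finset.filter_subset _ _)
  have hγle : ∑ D ∈ 𝒟, (γ D).card ≤ 2 := by
    rw [← hγcard]
    exact (Finset.card_le_card hγsub).trans Finset.card_le_two
  have hDne : ∀ D ∈ 𝒟, 3 ≤ G.edgeCount D Dᶜ := by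
    intro D h
    refine h3 D (Finset.card_pos.1 (hD D h).2.2.1.pos) ?_
    rintro rfl
    have := (hD _ h).1 (Finset.mem_univ w)
    simp at this
  have hsum1 : 3 * 𝒟.card ≤ ∑ D ∈ 𝒟, G.edgeCount D Dᶜ := by
    rw [mul_comm, ← smul_eq_mul]
    exact Finset.card_nsmul_le_sum _ _ _ hDne
  have hsum2 : ∑ D ∈ 𝒟, G.edgeCount D Dᶜ ≤
      G.edgeCount U S + G.edgeCount U {w} + G.edgeCount U Aᶜ + ∑ D ∈ 𝒟, (γ D).card := by
    refine (Finset.sum_le_sum hγ).trans ?_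
    rw [Finset.sum_add_distrib, ← edgeCount_biUnion_left hdis, edgeCount_union_right hSwA,
      edgeCount_union_right hwS]
  have e1 : G.edgeCount U S ≤ 3 * S.card := by
    rw [edgeCount_comm]
    exact hG.edgeCount_le _ _
  have e2 : G.edgeCount U {w} + G.edgeCount {w} Aᶜ ≤ 3 := by
    rw [edgeCount_comm U, ← edgeCount_union_right (hAc.mono_left hUB)]
    exact hG.edgeCount_singleton_le _ _
  have hwU : Disjoint U {w} := by
    rw [Finset.disjoint_singleton_right]
    exact fun h => by simpa using hUB h
  have e3 : G.edgeCount U Aᶜ + G.edgeCount {w} Aᶜ ≤ 3 := by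
    rw [← edgeCount_union_left hwU, ← hA.edgeCount_compl]
    refine edgeCount_mono (Finset.union_subset (hUB.trans (Finset.erase_subset _ _)) ?_) subset_rfl
    simpa using hA.root_mem
  have e4 : 1 ≤ G.edgeCount {w} Aᶜ :=
    edgeCount_pos_iff.2 ⟨w, by simp, f w, by simpa using hA.root_notMem, (hf w).1⟩
  have hγeq : 𝒟.biUnion γ = {a, f a} := by
    apply Finset.eq_of_subset_of_card_le hγsub
    rw [hγcard, Finset.card_pair (hf.ne a).symm]
    omega
  have hmem : ∀ x, x = a ∨ x = f a → x ∈ U := by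
    intro x hx
    have : x ∈ 𝒟.biUnion γ := by rw [hγeq]; simpa using hx
    exact Finset.biUnion_mono (fun D _ => Finset.filter_subset _ _) this
  have heq : ∀ D ∈ 𝒟, 3 = G.edgeCount D Dᶜ := by
    rw [← Finset.sum_eq_sum_iff_of_le hDne, Finset.sum_const, smul_eq_mul]
    omega
  exact ⟨S, 𝒟, hS, hdis, fun D h => (hD D h).1, fun D h => (hD D h).2.1,
    fun D h => (hD D h).2.2.1, hcl, by omega, fun D h => (heq D h).symm, by rw [← hU]; omega,
    by rw [← hU]; omega, by rw [← hU]; omega, by omega, hmem a (.inl rfl), hmem _ (.inr rfl)⟩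

/-- An odd set is left by at least one matching edge. The partners reached this way are distinct and
lie in `S ∪ {a, f a}`, which has at most as many elements as there are odd components. So exactly
one matching edge leaves each component. -/
theorem IsBarrier.exists_isShore {S : Finset V} {𝒟 : Finset (Finset V)} {a : V}
    (hA : G.IsShore f u A w) (hf : G.IsPM f) (hb : G.IsBarrier f A w a S 𝒟)
    {D : Finset V} (hD : D ∈ 𝒟) : ∃ d, G.IsShore f u D d := by
  let c : Finset V → Finset V := fun D => D.filter fun d => f d ∉ D
  have hpos : ∀ D ∈ 𝒟, 1 ≤ (c D).card := by
    intro D hD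
    by_contra h
    have h0 : c D = ∅ := by
      rw [← Finset.card_eq_zero]
      omega
    rw [Finset.filter_eq_empty_iff] at h0
    have := even_card_of_involution (B := D) (f := f) (fun b hb => not_not.1 (h0 hb))
      (fun b _ => hf.ne b) (fun b _ => hf.apply_apply b)
    exact (Nat.not_even_iff_odd.2 (hb.odd_card D hD)) this
  have hsum : ∑ D ∈ 𝒟, (c D).card ≤ S.card + 2 := by
    have hdis : ∀ D ∈ 𝒟, ∀ D' ∈ 𝒟, D ≠ D' → Disjoint (c D) (c D') := fun D h D' h' hne =>
      (hb.pairwiseDisjoint h h' hne).mono (Finset.filter_subset _ _) (Finset.filter_subset _ _)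
    rw [← Finset.card_biUnion hdis]
    refine (Finset.card_le_card_of_injOn (t := S ∪ {a, f a}) f ?_ hf.injective.injOn).trans ?_
    · intro d hd
      simp only [c, Finset.coe_biUnion, Set.mem_iUnion, Finset.coe_filter] at hd
      obtain ⟨D, hD, hd, hfd⟩ := hd
      by_contra hS
      simp only [Finset.coe_union, Set.mem_union, Finset.mem_coe, Finset.mem_insert,
        Finset.mem_singleton, not_or] at hS
      refine hfd (hb.closed D hD d hd _ (hA.apply_mem_erase hf (hb.subset_erase D hD hd))
        (hf d).1 (fun h => ?_) hS.1)
      rw [Sym2.eq_iff] at h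
      obtain ⟨-, h⟩ | ⟨-, h⟩ := h
      · exact hS.2.2 h
      · exact hS.2.1 h
    · exact (Finset.card_union_le _ _).trans (Nat.add_le_add_left Finset.card_le_two _)
  have heq : ∀ D ∈ 𝒟, 1 = (c D).card := by
    rw [← Finset.sum_eq_sum_iff_of_le hpos]
    have := Finset.sum_le_sum hpos
    simp only [Finset.sum_const, smul_eq_mul, mul_one] at this ⊢
    have := hb.card_eq
    omega
  obtain ⟨d, hd⟩ := Finset.card_eq_one.1 (heq D hD).symm
  have hmem : ∀ x, (x ∈ D ∧ f x ∉ D) ↔ x = d := by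
    intro x
    rw [← Finset.mem_singleton, ← hd, Finset.mem_filter]
  refine ⟨d, fun h => hA.notMem (Finset.mem_of_mem_erase (hb.subset_erase D hD h)),
    hb.edgeCount_compl D hD, ((hmem d).2 rfl).1, ((hmem d).2 rfl).2, fun x hx hne => ?_⟩
  by_contra h
  exact hne ((hmem x).1 ⟨hx, h⟩)

/-- When all odd components of the barrier are singletons, the shore is bipartite but for the
edge `s(a, f a)`. -/
theorem IsBarrier.exists_coloring (hG : G.Cubic) (h3 : G.CutsGeThree)
    {S : Finset V} {𝒟 : Finset (Finset V)} {a : V}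
    (hA : G.IsShore f u A w) (hb : G.IsBarrier f A w a S 𝒟)
    (hone : ∀ D ∈ 𝒟, D.card = 1) :
    ∃ I : Finset V, I ⊆ A ∧ w ∉ I ∧ a ∈ I ∧ f a ∈ I ∧
      (∀ x ∈ A, x ∉ I → x ≠ w → ∀ y, y ∉ A → ¬ G.Adj x y) ∧
      ∀ x ∈ A, ∀ y ∈ A, G.Adj x y → s(x, y) ≠ s(a, f a) → (x ∈ I ↔ y ∉ I) := by
  set U := 𝒟.biUnion id with hU
  have hUB : U ⊆ A.erase w := Finset.biUnion_subset.2 hb.subset_erase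
  have hUA : U ⊆ A := hUB.trans (Finset.erase_subset _ _)
  have hwU : w ∉ U := fun h => by simpa using hUB h
  have hUS : Disjoint U S := by
    rw [hU, Finset.disjoint_biUnion_left]
    exact hb.disjoint
  -- Tightness of the count: the $3|S|$ edges between `U` and `S` exhaust the degrees in `S`. The
  -- next two claims exhaust the degree of `w` and the cut of `A` in the same way.
  have hS : ∀ s ∈ S, ∀ y, G.Adj s y → y ∈ U := by
    have h1 : ∀ s ∈ S, G.edgeCount {s} U = 3 := by
      rw [← Finset.sum_eq_sum_iff_of_le fun s _ => hG.edgeCount_singleton_le s U,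
        ← edgeCount_eq_sum_left, edgeCount_comm, hb.edgeCount_barrier]
      simp [mul_comm]
    intro s hs y hsy
    by_contra hy
    have h2 := hG.edgeCount_singleton_le s (U ∪ {y})
    rw [edgeCount_union_right (by simpa using hy), h1 s hs] at h2
    have h3 : G.edgeCount {s} {y} = 0 := by omega
    rw [edgeCount_eq_zero_iff] at h3
    exact h3 s (by simp) y (by simp) hsy
  have hw : ∀ y ∈ A, G.Adj w y → y ∈ U := by
    intro y hyA hwy
    by_contra hy
    have h1 := hG.edgeCount_singleton_le w ((U ∪ Aᶜ) ∪ {y})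
    rw [edgeCount_union_right (by simp [hy, hyA]),
      edgeCount_union_right (disjoint_compl_right.mono_left hUA), edgeCount_comm _ U,
      hb.edgeCount_root, hb.edgeCount_root_outer] at h1
    have h3 : G.edgeCount {w} {y} = 0 := by omega
    rw [edgeCount_eq_zero_iff] at h3
    exact h3 w (by simp) y (by simp) hwy
  have houter : ∀ x ∈ A, x ∉ U → x ≠ w → ∀ y, y ∉ A → ¬ G.Adj x y := by
    intro x hxA hxU hxw y hy hxy
    have h1 : G.edgeCount ((U ∪ {w}) ∪ {x}) Aᶜ ≤ G.edgeCount A Aᶜ := by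
      refine edgeCount_mono ?_ subset_rfl
      intro z hz
      simp only [Finset.mem_union, Finset.mem_singleton] at hz
      obtain (hz | rfl) | rfl := hz
      · exact hUA hz
      · exact hA.root_mem
      · exact hxA
    rw [edgeCount_union_left (by simp [hxU, hxw]), edgeCount_union_left (by simpa using hwU),
      hb.edgeCount_outer, hb.edgeCount_root_outer, hA.edgeCount_compl] at h1
    have h3 : G.edgeCount {x} Aᶜ = 0 := by omega
    rw [edgeCount_eq_zero_iff] at h3
    exact h3 x (by simp) y (by simpa using hy) hxy
  have hUcl : ∀ x ∈ U, ∀ y ∈ A, G.Adj x y → s(x, y) ≠ s(a, f a) → y = w ∨ y ∈ S := by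
    intro x hx y hy hxy hne
    by_contra hc
    rw [not_or] at hc
    simp only [hU, Finset.mem_biUnion, id] at hx
    obtain ⟨D, hD, hx⟩ := hx
    have h1 := hb.closed D hD x hx y (Finset.mem_erase.2 ⟨hc.1, hy⟩) hxy hne hc.2
    exact hxy.ne (Finset.card_le_one.1 (hone D hD).le x hx y h1)
  have hcover : ∀ x ∈ A, x ∉ U → x = w ∨ x ∈ S := by
    by_contra! hc
    -- By the exhausted degrees and cut, no edge leaves the set of leftover vertices, so the cut
    -- condition makes it empty.
    let R := A.filter fun x => x ∉ U ∧ x ≠ w ∧ x ∉ S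
    have hR : R.Nonempty := by
      obtain ⟨x, h1, h2, h3, h4⟩ := hc
      exact ⟨x, Finset.mem_filter.2 ⟨h1, h2, h3, h4⟩⟩
    have h1 := h3 R hR (fun h => by
      have := Finset.mem_univ w
      rw [← h] at this
      simp [R] at this)
    obtain ⟨x, hx, y, hy, hxy⟩ := edgeCount_pos_iff.1 (by omega : 0 < G.edgeCount R Rᶜ)
    simp only [R, Finset.mem_filter, Finset.mem_compl, not_and, not_not] at hx hy
    obtain ⟨hxA, hxU, hxw, hxS⟩ := hx
    by_cases hyA : y ∈ A
    · by_cases hyU : y ∈ U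
      · by_cases he : s(y, x) = s(a, f a)
        · rw [Sym2.eq_iff] at he
          obtain ⟨-, rfl⟩ | ⟨-, rfl⟩ := he
          · exact hxU hb.right_mem
          · exact hxU hb.left_mem
        · obtain h | h := hUcl y hyU x hxA hxy.symm he
          · exact hxw h
          · exact hxS h
      · by_cases hyw : y = w
        · subst hyw
          exact hxU (hw x hxA hxy.symm)
        · exact hxU (hS y (hy hyA hyU hyw) x hxy.symm)
    · exact houter x hxA hxU hxw y hyA hxy
  refine ⟨U, hUA, hwU, hb.left_mem, hb.right_mem, houter, fun x hx y hy hxy hne => ⟨?_, ?_⟩⟩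
  · intro hxU hyU
    obtain rfl | h := hUcl x hxU y hy hxy hne
    · exact hwU hyU
    · exact Finset.disjoint_left.1 hUS hyU h
  · intro hyU
    by_contra hxU
    obtain rfl | h := hcover x hx hxU
    · exact hyU (hw y hy hxy)
    · exact hyU (hS x h y hxy)

theorem isShore_compl_singleton (hG : G.Cubic) (hf : G.IsPM f) (u : V) :
    G.IsShore f u {u}ᶜ (f u) := by
  refine ⟨by simp, ?_, by simpa using hf.ne u, by simp [hf.apply_apply], fun a _ ha => ?_⟩
  · have h1 := hG.edgeCount_singleton_univ u
    rw [← Finset.union_compl {u}, edgeCount_union_right disjoint_compl_right] at h1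
    have h2 : G.edgeCount {u} {u} = 0 := by
      rw [edgeCount_eq_zero_iff]
      simp
    rw [compl_compl, edgeCount_comm]
    omega
  · simp only [Finset.mem_compl, Finset.mem_singleton]
    rintro rfl
    exact ha (hf.apply_apply a).symm

/-- A shore with more than one vertex that is as small as possible has three vertices. -/
theorem IsShore.card_eq_three (hG : G.Cubic) (h3 : G.CutsGeThree)
    (hA : G.IsShore f u A w) (hf : G.IsPM f)
    (huniq : ∀ f', G.IsPM f' → f' u = f u → f' = f) (hcard : 1 < A.card)
    (hmin : ∀ D d, G.IsShore f u D d → 1 < D.card → A.card ≤ D.card) : A.card = 3 := by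
  have hcol : ∀ a ∈ A.erase w, ∃ I : Finset V, I ⊆ A ∧ w ∉ I ∧ a ∈ I ∧ f a ∈ I ∧
      (∀ x ∈ A, x ∉ I → x ≠ w → ∀ y, y ∉ A → ¬ G.Adj x y) ∧
      ∀ x ∈ A, ∀ y ∈ A, G.Adj x y → s(x, y) ≠ s(a, f a) → (x ∈ I ↔ y ∉ I) := by
    intro a ha
    obtain ⟨S, 𝒟, hb⟩ := hA.exists_isBarrier hG h3 hf huniq ha
    refine hb.exists_coloring hG h3 hA fun D hD => ?_
    obtain ⟨d, hd⟩ := hb.exists_isShore hA hf hD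
    by_contra hne
    have h1 : 1 < D.card := by
      have := (hb.odd_card D hD).pos
      omega
    have h2 := hmin D d hd h1
    -- An odd component with more than one vertex would be a shore inside `A.erase w`, smaller than
    -- `A`.
    have h3 := Finset.card_le_card (hb.subset_erase D hD)
    rw [Finset.card_erase_of_mem hA.root_mem] at h3
    omega
  have heven := hA.even_card_erase hf
  have hcard' := Finset.card_erase_of_mem hA.root_mem
  by_contra hne
  obtain ⟨a, ha⟩ : (A.erase w).Nonempty := Finset.card_pos.1 (by omega)
  obtain ⟨b, hb⟩ : (((A.erase w).erase a).erase (f a)).Nonempty := by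
    have h1 := Finset.card_erase_of_mem ha
    have h2 := Finset.card_erase_of_mem
      (Finset.mem_erase.2 ⟨hf.ne a, hA.apply_mem_erase hf ha⟩ : f a ∈ (A.erase w).erase a)
    rw [← Finset.card_pos]
    rw [Nat.even_iff] at heven
    omega
  simp only [Finset.mem_erase, ne_eq] at hb
  obtain ⟨hbfa, hba, hb⟩ := hb
  have hbA : b ∈ A.erase w := Finset.mem_erase.2 hb
  have hfb : f b ≠ a := fun h => hbfa (by rw [← h, hf.apply_apply])
  have hfb' : f b ≠ f a := fun h => hba (hf.injective h)
  obtain ⟨I, hIA, hwI, haI, hfaI, houter, hI⟩ := hcol a ha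
  obtain ⟨J, hJA, hwJ, hbJ, hfbJ, houter', hJ⟩ := hcol b hbA
  have haA := Finset.mem_of_mem_erase ha
  have hfaA := Finset.mem_of_mem_erase (hA.apply_mem_erase hf ha)
  have hfbA := Finset.mem_of_mem_erase (hA.apply_mem_erase hf hbA)
  have haJ : a ∈ J ↔ f a ∉ J := hJ a haA _ hfaA (hf a).1 (by
    rw [Ne, Sym2.eq_iff]
    rintro (⟨h, -⟩ | ⟨h, -⟩)
    · exact hba h.symm
    · exact hfb h.symm)
  have hbI : b ∈ I ↔ f b ∉ I := hI b hb.2 _ hfbA (hf b).1 (by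
    rw [Ne, Sym2.eq_iff]
    rintro (⟨h, -⟩ | ⟨h, -⟩)
    · exact hba h
    · exact hbfa h)
  -- An edge inside `A` other than `s(a, f a)` and `s(b, f b)` changes both colours, so it does not
  -- leave the set where the colourings differ. Edges leaving `A` start at `w` or in both `I` and
  -- `J`, where the colourings agree. Hence at most two edges bound `X`; it is nonempty because `a`
  -- and `f a` agree in `I` but not in `J`.
  let X := A.filter fun x => ¬ (x ∈ I ↔ x ∈ J)
  have hX : ∀ x, x ∈ X ↔ x ∈ A ∧ ¬ (x ∈ I ↔ x ∈ J) := fun x => Finset.mem_filter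
  have hXne : X.Nonempty := by
    by_cases h : a ∈ J
    · exact ⟨f a, (hX _).2 ⟨hfaA, by tauto⟩⟩
    · exact ⟨a, (hX _).2 ⟨haA, by tauto⟩⟩
  have hwX : w ∉ X := fun h => ((hX w).1 h).2 (by simp [hwI, hwJ])
  have hcut := h3 X hXne fun h => hwX (h ▸ Finset.mem_univ w)
  classical
  rw [edgeCount_eq_card] at hcut
  have hsub : (X ×ˢ Xᶜ).filter (fun p => G.Adj p.1 p.2) ⊆
      {if a ∈ X then (a, f a) else (f a, a), if b ∈ X then (b, f b) else (f b, b)} := by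
    rintro ⟨x, y⟩ hp
    simp only [Finset.mem_filter, Finset.mem_product, Finset.mem_compl] at hp
    obtain ⟨⟨hx, hy⟩, hxy⟩ := hp
    have hx' := (hX x).1 hx
    have hyA : y ∈ A := by
      by_contra hyA
      have hxw : x ≠ w := by
        rintro rfl
        exact hwX hx
      have h1 : x ∈ I := by
        by_contra h
        exact houter x hx'.1 h hxw y hyA hxy
      have h2 : x ∈ J := by
        by_contra h
        exact houter' x hx'.1 h hxw y hyA hxy
      exact hx'.2 (by simp [h1, h2])
    have hy' : y ∈ I ↔ y ∈ J := by
      by_contra h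
      exact hy ((hX y).2 ⟨hyA, h⟩)
    by_cases e1 : s(x, y) = s(a, f a)
    · rw [Sym2.eq_iff] at e1
      obtain ⟨rfl, rfl⟩ | ⟨rfl, rfl⟩ := e1
      · simp [hx]
      · simp [hy]
    · by_cases e2 : s(x, y) = s(b, f b)
      · rw [Sym2.eq_iff] at e2
        obtain ⟨rfl, rfl⟩ | ⟨rfl, rfl⟩ := e2
        · simp [hx]
        · simp [hy]
      · have h1 := hI x hx'.1 y hyA hxy e1
        have h2 := hJ x hx'.1 y hyA hxy e2
        exact absurd (h1.trans ((not_congr hy').trans h2.symm)) hx'.2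
  have := (Finset.card_le_card hsub).trans Finset.card_le_two
  omega

/-- A cubic graph without small edge cuts in which some edge lies in exactly one perfect matching
has a triangle away from any given end `u` of that edge, crossed once by the perfect matching. -/
theorem exists_triangle (hG : G.Cubic) (h3 : G.CutsGeThree) (hf : G.IsPM f)
    (huniq : ∀ f', G.IsPM f' → f' u = f u → f' = f) :
    ∃ t : Fin 3 → V, Function.Injective t ∧ (∀ i j, i ≠ j → G.Adj (t i) (t j)) ∧
      (∀ i, t i ≠ u) ∧ (∀ i, f (t 0) ≠ t i) ∧ f (t 1) = t 2 := by
  have hex : ∃ n, ∃ A w, G.IsShore f u A w ∧ 1 < A.card ∧ A.card = n := by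
    refine ⟨_, _, _, isShore_compl_singleton hG hf u, ?_, rfl⟩
    obtain ⟨n, hn, h⟩ := hG u
    have : Finset.univ.image n ⊆ {u}ᶜ := by
      intro x hx
      simp only [Finset.mem_image, Finset.mem_univ, true_and] at hx
      obtain ⟨i, rfl⟩ := hx
      simpa using ((h (n i)).2 ⟨i, rfl⟩).ne'
    have := Finset.card_le_card this
    rw [Finset.card_image_of_injective _ hn, Finset.card_univ, Fintype.card_fin] at this
    omega
  classical
  obtain ⟨A, w, hA, h1, hc⟩ := Nat.find_spec hex
  have hA3 : A.card = 3 := hA.card_eq_three hG h3 hf huniq h1 fun D d hD hD1 => by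
    rw [hc]
    exact Nat.find_min' hex ⟨D, d, hD, hD1, rfl⟩
  have hadj : ∀ x ∈ A, ∀ y ∈ A, x ≠ y → G.Adj x y := by
    -- Of the nine edge ends in `A`, three belong to the cut; the other six account for all ordered
    -- pairs of distinct vertices.
    have e1 := hG.edgeCount_univ A
    rw [← Finset.union_compl A, edgeCount_union_right disjoint_compl_right, hA.edgeCount_compl,
      hA3] at e1
    have e2 : G.edgeCount A A = 6 := by omega
    rw [edgeCount_eq_card] at e2
    have hsub : (A ×ˢ A).filter (fun p => G.Adj p.1 p.2) ⊆ A.offDiag := by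
      rintro ⟨x, y⟩ hp
      simp only [Finset.mem_filter, Finset.mem_product] at hp
      exact Finset.mem_offDiag.2 ⟨hp.1.1, hp.1.2, hp.2.ne⟩
    have e3 := Finset.eq_of_subset_of_card_le hsub (by rw [e2, Finset.offDiag_card, hA3])
    intro x hx y hy hne
    have : (x, y) ∈ A.offDiag := Finset.mem_offDiag.2 ⟨hx, hy, hne⟩
    rw [← e3] at this
    exact (Finset.mem_filter.1 this).2
  obtain ⟨b, hb⟩ : (A.erase w).Nonempty := by
    rw [← Finset.card_pos, Finset.card_erase_of_mem hA.root_mem]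
    omega
  have hfb := hA.apply_mem_erase hf hb
  have hmem : ∀ i, (![w, b, f b] : Fin 3 → V) i ∈ A := by
    intro i
    fin_cases i
    · exact hA.root_mem
    · exact Finset.mem_of_mem_erase hb
    · exact Finset.mem_of_mem_erase hfb
  have hinj : Function.Injective (![w, b, f b] : Fin 3 → V) := by
    have h1 := (Finset.ne_of_mem_erase hb).symm
    have h2 := (Finset.ne_of_mem_erase hfb).symm
    have h3 := (hf.ne b).symm
    intro i j hij
    fin_cases i <;> fin_cases j <;> simp_all
  refine ⟨![w, b, f b], hinj, fun i j hij => hadj _ (hmem i) _ (hmem j) (hinj.ne hij),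
    fun i h => hA.notMem (h ▸ hmem i), fun i h => hA.root_notMem ?_, rfl⟩
  have := hmem i
  rw [← h] at this
  exact this

end Barrier

/-! ### Replacing a vertex with a triangle: matchings and lonely edges -/

/-- `n` lists the three neighbours of `v`. -/
def IsNbrLabeling {V : Type*} (G : SimpleGraph V) (v : V) (n : Fin 3 → V) : Prop :=
  Function.Injective n ∧ ∀ w, G.Adj v w ↔ ∃ i, w = n i

/-- `f` maps every vertex other than `x` to its partner, for a spanning subgraph of `G` in which
all three edges at `x` are present and every other vertex has degree one. -/
def IsTri {V : Type*} (G : SimpleGraph V) (x : V) (f : V → V) : Prop :=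
  ∀ v, (G.Adj v x → f v = x) ∧ (v ≠ x → G.Adj v (f v) ∧ (f v = x ∨ f (f v) = v))

/-- The edges that lie in exactly one perfect matching. -/
def lonelySet {V : Type*} (G : SimpleGraph V) : Set (Sym2 V) :=
  {e | ∃! f, G.IsPM f ∧ ∃ u, e = s(u, f u)}

theorem mk_mem_lonelySet {V : Type*} {G : SimpleGraph V} {a b : V} :
    s(a, b) ∈ G.lonelySet ↔ ∃! f, G.IsPM f ∧ f a = b := by
  unfold lonelySet
  rw [Set.mem_ofPred_eq]
  refine existsUnique_congr fun f => and_congr_right fun hf => ?_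
  constructor
  · rintro ⟨u, hu⟩
    rw [Sym2.eq_iff] at hu
    obtain ⟨rfl, rfl⟩ | ⟨rfl, rfl⟩ := hu
    · rfl
    · exact hf.apply_apply _
  · rintro rfl
    exact ⟨a, rfl⟩

/-- The vertex `x`, whose neighbours are listed by `n`, is replaced with a triangle. -/
def blow {V : Type*} (G : SimpleGraph V) (x : V) (n : Fin 3 → V) :
    SimpleGraph ({a // a ≠ x} ⊕ Fin 3) where
  Adj
    | .inl a, .inl b => G.Adj a b
    | .inr i, .inr j => i ≠ j
    | .inl a, .inr j => (a : V) = n j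
    | .inr j, .inl a => (a : V) = n j
  symm := ⟨by
    rintro (a | i) (b | j) h
    · exact SimpleGraph.Adj.symm h
    · exact h
    · exact h
    · exact Ne.symm h⟩
  loopless := ⟨by
    rintro (a | i) h
    · exact G.loopless.irrefl _ h
    · exact h rfl⟩

section blow

variable {V : Type*} {G : SimpleGraph V} {x : V} {n : Fin 3 → V}

@[simp] theorem blow_adj_inl_inl {a b} : (G.blow x n).Adj (.inl a) (.inl b) ↔ G.Adj a b := Iff.rfl
@[simp] theorem blow_adj_inr_inr {i j} : (G.blow x n).Adj (.inr i) (.inr j) ↔ i ≠ j := Iff.rfl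
@[simp] theorem blow_adj_inl_inr {a j} : (G.blow x n).Adj (.inl a) (.inr j) ↔ (a : V) = n j :=
  Iff.rfl
@[simp] theorem blow_adj_inr_inl {a j} : (G.blow x n).Adj (.inr j) (.inl a) ↔ (a : V) = n j :=
  Iff.rfl

theorem IsNbrLabeling.adj (h : G.IsNbrLabeling x n) (i : Fin 3) : G.Adj x (n i) :=
  (h.2 _).2 ⟨i, rfl⟩

theorem IsNbrLabeling.ne (h : G.IsNbrLabeling x n) (i : Fin 3) : n i ≠ x := (h.adj i).ne'

/-- The element of `Fin 3` other than `i` and `j`, if these are different. -/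
def third (i j : Fin 3) : Fin 3 := -(i + j)

theorem third_ne_left : ∀ {i j : Fin 3}, j ≠ i → third i j ≠ i := by decide
theorem third_ne_right : ∀ {i j : Fin 3}, j ≠ i → third i j ≠ j := by decide
-- This makes the partner map on the two triangle vertices other than `i` an involution.
theorem third_third : ∀ i j : Fin 3, third i (third i j) = j := by decide

open Classical in
/-- The matching of `G.blow x n` obtained from a matching of `G` that contains the edge from `x`
to `n i`. -/
noncomputable def liftPM (h : G.IsNbrLabeling x n) (f : V → V) (i : Fin 3) :
    {a // a ≠ x} ⊕ Fin 3 → {a // a ≠ x} ⊕ Fin 3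
  | .inl a => if h : f a = x then .inr i else .inl ⟨f a, h⟩
  | .inr j => if j = i then .inl ⟨n i, h.ne i⟩ else .inr (third i j)

section liftPM

variable (h : G.IsNbrLabeling x n) (f : V → V) (i : Fin 3)

theorem liftPM_inl_of_eq {a : {a // a ≠ x}} (ha : f a = x) : liftPM h f i (.inl a) = .inr i := by
  simp [liftPM, ha]

theorem liftPM_inl_of_ne {a : {a // a ≠ x}} (ha : f a ≠ x) :
    liftPM h f i (.inl a) = .inl ⟨f a, ha⟩ := by
  simp [liftPM, ha]

theorem liftPM_inr_self : liftPM h f i (.inr i) = .inl ⟨n i, h.ne i⟩ := by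
  simp [liftPM]

theorem liftPM_inr_of_ne {j : Fin 3} (hj : j ≠ i) :
    liftPM h f i (.inr j) = .inr (third i j) := by
  simp [liftPM, hj]

end liftPM

theorem IsPM.liftPM {f : V → V} {i : Fin 3} (hf : G.IsPM f) (h : G.IsNbrLabeling x n)
    (hi : f x = n i) : (G.blow x n).IsPM (liftPM h f i) := by
  rintro (v | j)
  · by_cases hv : f v = x
    · have : v.1 = n i := (hf.apply_eq_of_apply_eq hv).symm.trans hi
      rw [liftPM_inl_of_eq h f i hv, liftPM_inr_self]
      exact ⟨this, congrArg Sum.inl (Subtype.ext this.symm)⟩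
    · rw [liftPM_inl_of_ne h f i hv,
        liftPM_inl_of_ne h f i (a := ⟨f v, hv⟩) (by rw [hf.apply_apply]; exact v.2)]
      exact ⟨(hf v).1, congrArg Sum.inl (Subtype.ext (hf.apply_apply _))⟩
  · by_cases hj : j = i
    · subst hj
      rw [liftPM_inr_self, liftPM_inl_of_eq h f j (by simp [← hi, hf.apply_apply])]
      exact ⟨rfl, rfl⟩
    · rw [liftPM_inr_of_ne h f i hj, liftPM_inr_of_ne h f i (third_ne_left hj), third_third]
      exact ⟨(third_ne_right hj).symm, rfl⟩

theorem liftPM_injective (h : G.IsNbrLabeling x n) {f f' : V → V} {i i' : Fin 3}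
    (hi : f x = n i) (hi' : f' x = n i') (he : liftPM h f i = liftPM h f' i') : f = f' := by
  have hii : i = i' := by
    by_contra hne
    have := congrFun he (.inr i)
    rw [liftPM_inr_self, liftPM_inr_of_ne h f' i' hne] at this
    cases this
  subst hii
  funext v
  by_cases hv : v = x
  · rw [hv, hi, hi']
  · have := congrFun he (.inl ⟨v, hv⟩)
    by_cases h1 : f v = x <;> by_cases h2 : f' v = x
    · rw [h1, h2]
    · rw [liftPM_inl_of_eq h f i (a := ⟨v, hv⟩) h1,
        liftPM_inl_of_ne h f' i (a := ⟨v, hv⟩) h2] at this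
      cases this
    · rw [liftPM_inl_of_eq h f' i (a := ⟨v, hv⟩) h2,
        liftPM_inl_of_ne h f i (a := ⟨v, hv⟩) h1] at this
      cases this
    · rw [liftPM_inl_of_ne h f i (a := ⟨v, hv⟩) h1,
        liftPM_inl_of_ne h f' i (a := ⟨v, hv⟩) h2] at this
      simpa using this

/-- As `a ≠ x`, the vertex `x` has degree one in the subgraph, so the construction for matchings
applies unchanged. -/
theorem IsTri.liftPM {a : V} (ha : a ≠ x) {f : V → V} {i : Fin 3} (hf : G.IsTri a f)
    (h : G.IsNbrLabeling x n) (hi : f x = n i) :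
    (G.blow x n).IsTri (.inl ⟨a, ha⟩) (liftPM h f i) := by
  rintro (v | j)
  · refine ⟨fun hv => ?_, fun hv => ?_⟩
    · have h1 := (hf v).1 hv
      rw [liftPM_inl_of_ne h f i (by rw [h1]; exact ha)]
      simp [h1]
    · have hva : v.1 ≠ a := fun e => hv (congrArg Sum.inl (Subtype.ext e))
      obtain ⟨h1, h2⟩ := (hf v).2 hva
      by_cases hv : f v = x
      · have h3 : v.1 = n i := by
          rw [hv] at h2
          rw [← hi, h2.resolve_left ha.symm]
        rw [liftPM_inl_of_eq h f i hv, liftPM_inr_self]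
        exact ⟨h3, .inr (congrArg Sum.inl (Subtype.ext h3.symm))⟩
      · rw [liftPM_inl_of_ne h f i hv]
        refine ⟨h1, h2.imp (fun h => by simp [h]) fun h2 => ?_⟩
        rw [liftPM_inl_of_ne h f i (a := ⟨f v, hv⟩) (by rw [h2]; exact v.2)]
        simp [h2]
  · refine ⟨fun hv => ?_, fun _ => ?_⟩
    · rw [blow_adj_inr_inl] at hv
      have h1 := (hf x).1 ((h.2 a).2 ⟨j, hv⟩)
      have : j = i := h.1 (by rw [← hi, h1]; exact hv.symm)
      subst this
      rw [liftPM_inr_self]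
      exact congrArg Sum.inl (Subtype.ext hv.symm)
    · by_cases hj : j = i
      · subst hj
        rw [liftPM_inr_self]
        refine ⟨rfl, ((hf x).2 ha.symm).2.imp (fun h => ?_) fun h2 => ?_⟩
        · simp [← hi, h]
        · rw [liftPM_inl_of_eq h f j (by rw [hi] at h2; exact h2)]
      · rw [liftPM_inr_of_ne h f i hj, liftPM_inr_of_ne h f i (third_ne_left hj), third_third]
        exact ⟨(third_ne_right hj).symm, .inr rfl⟩

open Classical in
/-- The spanning subgraph of `G.blow x n` with all three edges at the triangle vertex `i`,
obtained from a matching of `G` that contains the edge from `x` to `n i`. -/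
noncomputable def triOfPM (x : V) (f : V → V) (i : Fin 3) :
    {a // a ≠ x} ⊕ Fin 3 → {a // a ≠ x} ⊕ Fin 3
  | .inl a => if h : f a = x then .inr i else .inl ⟨f a, h⟩
  | .inr _ => .inr i

/-- The matching edge at `x` becomes the edge leaving the triangle at `i`; adding the two triangle
edges at `i` gives this vertex degree three and the other two degree one. -/
theorem IsPM.triOfPM {f : V → V} {i : Fin 3} (hf : G.IsPM f)
    (hi : f x = n i) : (G.blow x n).IsTri (.inr i) (triOfPM x f i) := by
  rintro (v | j)
  · have hiff : f v = x ↔ v.1 = n i := by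
      rw [← hi]
      exact ⟨fun h => (hf.apply_eq_of_apply_eq h).symm, fun h => hf.apply_eq_of_apply_eq h.symm⟩
    refine ⟨fun hv => by simp [SimpleGraph.triOfPM, hiff.2 hv], fun _ => ?_⟩
    by_cases hv : f v = x
    · simp [SimpleGraph.triOfPM, hiff.1 hv, ← hi, hf.apply_apply]
    · have h1 := (hf v).1
      simp [SimpleGraph.triOfPM, hv, hf.apply_apply, h1, v.2]
  · refine ⟨fun _ => rfl, fun hj => ⟨?_, .inl rfl⟩⟩
    rw [SimpleGraph.triOfPM, blow_adj_inr_inr]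
    exact fun h => hj (by rw [h])

open Classical in
/-- The matching of `G.blow x n` with all three edges leaving the new triangle. -/
noncomputable def pmOfTri (h : G.IsNbrLabeling x n) (f : V → V) :
    {a // a ≠ x} ⊕ Fin 3 → {a // a ≠ x} ⊕ Fin 3
  | .inl a => if h : ∃ j, (a : V) = n j then .inr h.choose else
      -- The value `.inr 0` is a dummy: for `IsTri x f`, `f a = x` makes `a` a neighbour of `x`,
      -- which the first branch has covered.
      if h : f a = x then .inr 0 else .inl ⟨f a, h⟩
  | .inr j => .inl ⟨n j, h.ne j⟩

theorem pmOfTri_inl (h : G.IsNbrLabeling x n) {f : V → V} (hf : G.IsTri x f) {a : {a // a ≠ x}}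
    (ha : f a ≠ x) : pmOfTri h f (.inl a) = .inl ⟨f a, ha⟩ := by
  have h1 : ¬ ∃ j, (a : V) = n j := fun h2 => ha ((hf a).1 ((h.2 a).2 h2).symm)
  simp [pmOfTri, h1, ha]

theorem pmOfTri_nbr (h : G.IsNbrLabeling x n) (f : V → V) (j : Fin 3) :
    pmOfTri h f (.inl ⟨n j, h.ne j⟩) = .inr j := by
  have h1 : ∃ k, n j = n k := ⟨j, rfl⟩
  have : h1.choose = j := h.1 h1.choose_spec.symm
  simp only [pmOfTri, h1, dite_true, this]

theorem IsTri.pmOfTri {f : V → V} (hf : G.IsTri x f) (h : G.IsNbrLabeling x n) :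
    (G.blow x n).IsPM (pmOfTri h f) := by
  rintro (v | j)
  · by_cases hv : ∃ j, v.1 = n j
    · obtain ⟨j, hj⟩ := hv
      obtain rfl : v = ⟨n j, h.ne j⟩ := Subtype.ext hj
      rw [pmOfTri_nbr]
      exact ⟨rfl, rfl⟩
    · obtain ⟨h1, h2⟩ := (hf v).2 v.2
      have h3 : f v ≠ x := fun h3 => hv ((h.2 v).1 (by rw [h3] at h1; exact h1.symm))
      have h4 := h2.resolve_left h3
      rw [pmOfTri_inl h hf h3, pmOfTri_inl h hf (a := ⟨f v, h3⟩) (by rw [h4]; exact v.2)]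
      exact ⟨h1, congrArg Sum.inl (Subtype.ext h4)⟩
  · exact ⟨rfl, pmOfTri_nbr h f j⟩

/-- Every edge lies in a perfect matching, and every vertex has a spanning subgraph as in
`IsTri`. -/
structure MatchingRich (G : SimpleGraph V) : Prop where
  exists_isPM : ∀ a b, G.Adj a b → ∃ f, G.IsPM f ∧ f a = b
  exists_isTri : ∀ a, ∃ f, G.IsTri a f

/-- Everything is lifted from `G`: a triangle edge lies in the lift of a matching through the
opposite edge at `x`, and a matching through the edge from `x` to `n i` provides the subgraph with
degree three at triangle vertex `i`. -/
theorem MatchingRich.blow (hG : G.MatchingRich) (h : G.IsNbrLabeling x n) :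
    (G.blow x n).MatchingRich := by
  have hinr : ∀ i, ∃ f, G.IsPM f ∧ f x = n i := fun i => hG.exists_isPM _ _ (h.adj i)
  refine ⟨?_, ?_⟩
  · rintro (a | i) (b | j) hab
    · obtain ⟨f, hf, hfa⟩ := hG.exists_isPM _ _ hab
      obtain ⟨i, hi⟩ := (h.2 _).1 (hf x).1
      refine ⟨_, hf.liftPM h hi, ?_⟩
      rw [liftPM_inl_of_ne h f i (by rw [hfa]; exact b.2)]
      simp [hfa]
    · obtain ⟨f, hf, hj⟩ := hinr j
      refine ⟨_, hf.liftPM h hj, ?_⟩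
      rw [liftPM_inl_of_eq h f j (by rw [blow_adj_inl_inr.1 hab, ← hj, hf.apply_apply])]
    · obtain ⟨f, hf, hj⟩ := hinr i
      refine ⟨_, hf.liftPM h hj, ?_⟩
      rw [liftPM_inr_self]
      exact congrArg Sum.inl (Subtype.ext (blow_adj_inr_inl.1 hab).symm)
    · obtain ⟨f, hf, hk⟩ := hinr (third i j)
      refine ⟨_, hf.liftPM h hk, ?_⟩
      have key : ∀ i j : Fin 3, i ≠ j → i ≠ third i j ∧ third (third i j) i = j := by decide
      rw [liftPM_inr_of_ne h f _ (key i j hab).1, (key i j hab).2]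
  · rintro (a | i)
    · obtain ⟨f, hf⟩ := hG.exists_isTri a
      obtain ⟨i, hi⟩ := (h.2 _).1 ((hf x).2 a.2.symm).1
      exact ⟨_, hf.liftPM a.2 h hi⟩
    · obtain ⟨f, hf, hi⟩ := hinr i
      exact ⟨_, hf.triOfPM hi⟩

/-- The edge `e'` of `G.blow x n` arises from the edge `e` of `G`; an edge at `x` gives rise to
the opposite edge of the new triangle. -/
def BlowRel (x : V) (n : Fin 3 → V) (e : Sym2 V) (e' : Sym2 ({a // a ≠ x} ⊕ Fin 3)) : Prop :=
  (∃ a b, e = s(a.1, b.1) ∧ e' = s(.inl a, .inl b)) ∨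
    ∃ i, e = s(x, n i) ∧ e' = s(.inr (i + 1), .inr (i + 2))

theorem BlowRel.unique (h : G.IsNbrLabeling x n) {e : Sym2 V} {e₁ e₂}
    (h₁ : BlowRel x n e e₁) (h₂ : BlowRel x n e e₂) : e₁ = e₂ := by
  obtain ⟨a, b, rfl, rfl⟩ | ⟨i, rfl, rfl⟩ := h₁ <;> obtain ⟨c, d, h3, rfl⟩ | ⟨j, h3, rfl⟩ := h₂
  · simp only [Sym2.eq_iff, Sum.inl.injEq, Subtype.ext_iff] at h3 ⊢
    exact h3
  · simp only [Sym2.eq_iff] at h3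
    obtain ⟨h3, -⟩ | ⟨-, h3⟩ := h3
    · exact absurd h3 a.2
    · exact absurd h3 b.2
  · simp only [Sym2.eq_iff] at h3
    obtain ⟨h3, -⟩ | ⟨h3, -⟩ := h3
    · exact absurd h3.symm c.2
    · exact absurd h3.symm d.2
  · simp only [Sym2.eq_iff, true_and] at h3
    obtain h3 | ⟨h3, -⟩ := h3
    · rw [h.1 h3]
    · exact absurd h3.symm (h.ne j)

/-- An edge leaving the triangle is never lonely: it is in the lift of a matching and in the
matching that uses all three such edges. For the others, two matchings of `G` through the original
edge would lift to two different ones. The last clause holds since an `IsTri` subgraph through the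
edge, away from `x`, gives a matching which, unlike any lift, has no triangle edge. -/
theorem exists_blowRel_of_mem_lonelySet (h : G.IsNbrLabeling x n) (hG : G.MatchingRich)
    {e' : Sym2 ({a // a ≠ x} ⊕ Fin 3)} (he : e' ∈ (G.blow x n).lonelySet) :
    ∃ e ∈ G.lonelySet, BlowRel x n e e' ∧
      ∀ f, G.IsTri x f → ∀ a, a ≠ x → f a ≠ x → e ≠ s(a, f a) := by
  have hspoke : ∀ (a : {a // a ≠ x}) j, a.1 = n j →
      s(.inl a, .inr j) ∉ (G.blow x n).lonelySet := by
    intro a j hj hmem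
    obtain ⟨f, hf, hfj⟩ := hG.exists_isPM _ _ (h.adj j)
    obtain ⟨τ, hτ⟩ := hG.exists_isTri x
    rw [mk_mem_lonelySet] at hmem
    obtain rfl : a = ⟨n j, h.ne j⟩ := Subtype.ext hj
    have h1 := hmem.unique ⟨hf.liftPM h hfj, liftPM_inl_of_eq h f j (by
      simp [← hfj, hf.apply_apply])⟩ ⟨hτ.pmOfTri h, pmOfTri_nbr h τ j⟩
    have h2 := congrFun h1 (.inr (j + 1))
    rw [liftPM_inr_of_ne h f j (by simp)] at h2
    cases h2
  have hpm : ∀ a b (f : V → V), G.IsPM f → f a = b → ∃ i, f x = n i := fun a b f hf _ =>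
    (h.2 _).1 (hf x).1
  induction e' using Sym2.ind with | _ p q =>
  have hadj : (G.blow x n).Adj p q := by
    obtain ⟨f, ⟨hf, rfl⟩, -⟩ := mk_mem_lonelySet.1 he
    exact (hf p).1
  rcases p with a | i <;> rcases q with b | j
  · obtain ⟨f, hf, hfa⟩ := hG.exists_isPM _ _ hadj
    have hl : ∀ f (i : Fin 3), f a.1 = b.1 → liftPM h f i (.inl a) = .inl b := by
      intro f i hfa
      rw [liftPM_inl_of_ne h f i (by rw [hfa]; exact b.2)]
      simp [hfa]
    obtain ⟨i, hi⟩ := (h.2 _).1 (hf x).1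
    rw [mk_mem_lonelySet] at he
    refine ⟨s(a.1, b.1), ?_, .inl ⟨a, b, rfl, rfl⟩, ?_⟩
    · rw [mk_mem_lonelySet]
      refine ⟨f, ⟨hf, hfa⟩, fun f' ⟨hf', hfa'⟩ => ?_⟩
      obtain ⟨i', hi'⟩ := (h.2 _).1 (hf' x).1
      exact liftPM_injective h hi' hi
        (he.unique ⟨hf'.liftPM h hi', hl _ _ hfa'⟩ ⟨hf.liftPM h hi, hl _ _ hfa⟩)
    · intro τ hτ c hc hτc hne
      have hτab : τ a = b := by
        rw [Sym2.eq_iff] at hne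
        obtain ⟨h1, h2⟩ | ⟨h1, h2⟩ := hne
        · rw [h1, h2]
        · rw [h1, h2]
          exact ((hτ c).2 hc).2.resolve_left hτc
      have h1 := he.unique ⟨hf.liftPM h hi, hl _ _ hfa⟩ ⟨hτ.pmOfTri h, by
        rw [pmOfTri_inl h hτ (by rw [hτab]; exact b.2)]
        simp [hτab]⟩
      have h2 := congrFun h1 (.inr (i + 1))
      rw [liftPM_inr_of_ne h f i (by simp)] at h2
      cases h2
  · exact absurd he (hspoke a j hadj)
  · rw [Sym2.eq_swap] at he
    exact absurd he (hspoke b i hadj)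
  · rw [blow_adj_inr_inr] at hadj
    have key : ∀ i j : Fin 3, i ≠ j → i ≠ third i j ∧ third (third i j) i = j ∧
      (third i j + 1 = i ∧ third i j + 2 = j ∨ third i j + 1 = j ∧ third i j + 2 = i) := by decide
    obtain ⟨k1, k2, k3⟩ := key i j hadj
    obtain ⟨f, hf, hk⟩ := hG.exists_isPM _ _ (h.adj (third i j))
    rw [mk_mem_lonelySet] at he
    have hl : ∀ f : V → V, liftPM h f (third i j) (.inr i) = .inr j := by
      intro f
      rw [liftPM_inr_of_ne h f _ k1, k2]
    refine ⟨s(x, n (third i j)), ?_, .inr ⟨third i j, rfl, ?_⟩, ?_⟩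
    · rw [mk_mem_lonelySet]
      exact ⟨f, ⟨hf, hk⟩, fun f' ⟨hf', hk'⟩ => liftPM_injective h hk' hk
        (he.unique ⟨hf'.liftPM h hk', hl _⟩ ⟨hf.liftPM h hk, hl _⟩)⟩
    · obtain ⟨h1, h2⟩ | ⟨h1, h2⟩ := k3
      · rw [h1, h2]
      · rw [h1, h2, Sym2.eq_swap]
    · intro τ hτ c hc hτc hne
      rw [Sym2.eq_iff] at hne
      obtain ⟨h1, -⟩ | ⟨h1, -⟩ := hne
      · exact hc h1.symm
      · exact hτc h1.symm

/-- `B` collects lonely edges known to be lost; with `B = ∅` this is monotonicity. By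
`BlowRel.unique`, an edge of `G` gives rise to at most one edge of the new graph. -/
theorem ncard_lonelySet_blow_le [Finite V] (h : G.IsNbrLabeling x n) (hG : G.MatchingRich)
    (B : Set (Sym2 V)) (hB : ∀ e ∈ B, ∃ f, G.IsTri x f ∧ ∃ a, a ≠ x ∧ f a ≠ x ∧ e = s(a, f a)) :
    (G.blow x n).lonelySet.ncard ≤ (G.lonelySet \ B).ncard := by
  have key := fun e' he => exists_blowRel_of_mem_lonelySet h hG (e' := e') he
  choose g hg using key
  classical
  refine Set.ncard_le_ncard_of_injOn (fun e' => if he : e' ∈ (G.blow x n).lonelySet then g e' he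
    else s(x, x)) ?_ ?_ (Set.toFinite _)
  · intro e' he
    obtain ⟨h1, h2, h3⟩ := hg e' he
    simp only [he, dite_true]
    refine ⟨h1, fun hb => ?_⟩
    obtain ⟨f, hf, a, ha, hfa, hne⟩ := hB _ hb
    exact h3 f hf a ha hfa hne
  · intro e₁ h₁ e₂ h₂ heq
    simp only [h₁, h₂, dite_true] at heq
    exact (hg e₁ h₁).2.1.unique h (heq ▸ (hg e₂ h₂).2.1)

end blow

/-! ### Transport along isomorphisms -/

section Iso

variable {V W : Type*} {G : SimpleGraph V} {H : SimpleGraph W}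

theorem IsPM.map_iso {f : V → V} (hf : G.IsPM f) (φ : G ≃g H) : H.IsPM (φ ∘ f ∘ φ.symm) := by
  intro v
  refine ⟨?_, by simp [hf.apply_apply]⟩
  have := φ.map_adj_iff.2 (hf (φ.symm v)).1
  simpa using this

theorem IsTri.map_iso {f : V → V} {x : V} (hf : G.IsTri x f) (φ : G ≃g H) :
    H.IsTri (φ x) (φ ∘ f ∘ φ.symm) := by
  intro v
  obtain ⟨w, rfl⟩ := φ.surjective v
  obtain ⟨h1, h2⟩ := hf w
  simp only [Function.comp_apply, RelIso.symm_apply_apply, φ.injective.eq_iff, φ.injective.ne_iff,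
    φ.map_adj_iff]
  exact ⟨h1, h2⟩

theorem IsNbrLabeling.map_iso {x : V} {n : Fin 3 → V} (h : G.IsNbrLabeling x n) (φ : G ≃g H) :
    H.IsNbrLabeling (φ x) (φ ∘ n) := by
  refine ⟨φ.injective.comp h.1, fun w => ?_⟩
  obtain ⟨w, rfl⟩ := φ.surjective w
  simp [φ.map_adj_iff, h.2, φ.injective.eq_iff]

theorem Cubic.map_iso (hG : G.Cubic) (φ : G ≃g H) : H.Cubic := by
  intro v
  obtain ⟨n, hn⟩ := hG (φ.symm v)
  have := IsNbrLabeling.map_iso hn φ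
  rw [RelIso.apply_symm_apply] at this
  exact ⟨_, this⟩

theorem MatchingRich.map_iso (hG : G.MatchingRich) (φ : G ≃g H) : H.MatchingRich := by
  refine ⟨fun a b hab => ?_, fun a => ?_⟩
  · obtain ⟨f, hf, hfa⟩ := hG.exists_isPM _ _ (φ.symm.map_adj_iff.2 hab)
    exact ⟨_, hf.map_iso φ, by simp [hfa]⟩
  · obtain ⟨f, hf⟩ := hG.exists_isTri (φ.symm a)
    have := hf.map_iso φ
    rw [RelIso.apply_symm_apply] at this
    exact ⟨_, this⟩

theorem mem_lonelySet_map_iso (φ : G ≃g H) {a b : V} (h : s(a, b) ∈ G.lonelySet) :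
    s(φ a, φ b) ∈ H.lonelySet := by
  rw [mk_mem_lonelySet] at h ⊢
  obtain ⟨f, ⟨hf, hfa⟩, hu⟩ := h
  refine ⟨_, ⟨hf.map_iso φ, by simp [hfa]⟩, fun g ⟨hg, hga⟩ => ?_⟩
  have := hu _ ⟨hg.map_iso φ.symm, by
    simpa using (φ.symm_apply_eq).2 hga⟩
  rw [← this]
  funext v
  simp

theorem lonelySet_eq_image (φ : G ≃g H) : H.lonelySet = Sym2.map φ '' G.lonelySet := by
  ext e
  constructor
  · intro he
    induction e using Sym2.ind with | _ a b =>
    exact ⟨_, mem_lonelySet_map_iso φ.symm he, by simp⟩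
  · rintro ⟨e, he, rfl⟩
    induction e using Sym2.ind with | _ a b =>
    exact mem_lonelySet_map_iso φ he

theorem ncard_lonelySet_eq (φ : G ≃g H) : G.lonelySet.ncard = H.lonelySet.ncard := by
  rw [lonelySet_eq_image φ, Set.ncard_image_of_injective _ (Sym2.map.injective φ.injective)]

theorem encard_lonelySet_eq (φ : G ≃g H) : G.lonelySet.encard = H.lonelySet.encard := by
  rw [lonelySet_eq_image φ, (Sym2.map.injective φ.injective).encard_image]

theorem edgeCount_map_iso (φ : G ≃g H) (X Y : Finset V) :
    H.edgeCount (X.map φ.toEquiv.toEmbedding) (Y.map φ.toEquiv.toEmbedding) =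
      G.edgeCount X Y := by
  unfold edgeCount
  simp only [Finset.sum_map]
  refine Finset.sum_congr rfl fun a _ => Finset.sum_congr rfl fun b _ => ?_
  congr 1
  exact propext φ.map_adj_iff

theorem CutsGeThree.map_iso [Fintype V] [DecidableEq V] [Fintype W] [DecidableEq W]
    (hG : G.CutsGeThree) (φ : G ≃g H) : H.CutsGeThree := by
  intro X hX hX'
  let Y : Finset V := Finset.univ.filter fun v => φ v ∈ X
  have hY : ∀ Z : Finset V, ∀ v, φ v ∈ Z.map φ.toEquiv.toEmbedding ↔ v ∈ Z := fun Z v =>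
    Finset.mem_map' φ.toEquiv.toEmbedding
  have h := hG Y ?_ ?_
  · rw [← edgeCount_map_iso φ] at h
    convert h using 2 <;> ext v <;> obtain ⟨v, rfl⟩ := φ.surjective v <;> rw [hY] <;> simp [Y]
  · obtain ⟨v, hv⟩ := hX
    obtain ⟨v, rfl⟩ := φ.surjective v
    exact ⟨v, by simpa [Y] using hv⟩
  · intro he
    refine hX' (Finset.eq_univ_iff_forall.2 fun v => ?_)
    obtain ⟨v, rfl⟩ := φ.surjective v
    have := Finset.mem_univ v
    rw [← he] at this
    simpa [Y] using this

/-- Replacing corresponding vertices with triangles gives isomorphic graphs. -/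
theorem nonempty_blow_iso (φ : G ≃g H) {x : V} {n : Fin 3 → V} {m : Fin 3 → W}
    (hn : G.IsNbrLabeling x n) (hm : H.IsNbrLabeling (φ x) m) :
    Nonempty (G.blow x n ≃g H.blow (φ x) m) := by
  have hex : ∀ i, ∃ j, φ (n i) = m j := fun i => (hm.2 _).1 (φ.map_adj_iff.2 (hn.adj i))
  choose σ hσ using hex
  have hinj : Function.Injective σ := fun i j hij =>
    hn.1 (φ.injective (by rw [hσ, hσ, hij]))
  let e : Fin 3 ≃ Fin 3 := Equiv.ofBijective σ (Finite.injective_iff_bijective.1 hinj)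
  refine ⟨⟨Equiv.sumCongr (φ.toEquiv.subtypeEquiv fun a => by simp) e, ?_⟩⟩
  rintro (a | i) (b | j)
  · exact φ.map_adj_iff
  · have : φ a = m (σ j) ↔ (a : V) = n j := by rw [← hσ, φ.injective.eq_iff]
    exact this
  · have : φ b = m (σ i) ↔ (b : V) = n i := by rw [← hσ, φ.injective.eq_iff]
    exact this
  · exact e.injective.ne_iff

end Iso

/-! ### Cubicity and edge cuts under replacement with a triangle -/

section blow

variable {V : Type*} {G : SimpleGraph V} {x : V} {n : Fin 3 → V}

/-- The contraction of the new triangle. -/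
def unblow (x : V) : {a // a ≠ x} ⊕ Fin 3 → V := Sum.elim Subtype.val fun _ => x

theorem unblow_adj (h : G.IsNbrLabeling x n) {p q} (hpq : (G.blow x n).Adj p q)
    (hne : unblow x p ≠ unblow x q) : G.Adj (unblow x p) (unblow x q) := by
  rcases p with a | i <;> rcases q with b | j
  · exact hpq
  · rw [blow_adj_inl_inr] at hpq
    exact ((h.2 _).2 ⟨j, hpq⟩).symm
  · rw [blow_adj_inr_inl] at hpq
    exact (h.2 _).2 ⟨i, hpq⟩
  · exact absurd rfl hne

/-- Distinct triangle vertices have distinct outer neighbours, so edges outside the triangle can be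
recovered from their images in `G`. This makes boundaries of sets that do not split the triangle
comparable. -/
theorem unblow_injective (h : G.IsNbrLabeling x n) {p q p' q'} (hpq : (G.blow x n).Adj p q)
    (hne : unblow x p ≠ unblow x q) (hpq' : (G.blow x n).Adj p' q')
    (hp : unblow x p = unblow x p') (hq : unblow x q = unblow x q') : p = p' ∧ q = q' := by
  rcases p with a | i <;> rcases q with b | j <;> rcases p' with c | k <;> rcases q' with d | l <;>
    simp only [unblow, Sum.elim_inl, Sum.elim_inr, ← Subtype.ext_iff] at hp hq hne <;>
    first
    | exact absurd rfl hne
    | exact absurd hp a.2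
    | exact absurd hp.symm c.2
    | exact absurd hq b.2
    | exact absurd hq.symm d.2
    | skip
  · exact ⟨by rw [hp], by rw [hq]⟩
  · rw [blow_adj_inl_inr] at hpq hpq'
    subst hp
    exact ⟨rfl, by rw [h.1 (hpq.symm.trans hpq')]⟩
  · rw [blow_adj_inr_inl] at hpq hpq'
    subst hq
    exact ⟨by rw [h.1 (hpq.symm.trans hpq')], rfl⟩

theorem exists_blow_adj (h : G.IsNbrLabeling x n) {a b : V} (hab : G.Adj a b) :
    ∃ p q, (G.blow x n).Adj p q ∧ unblow x p = a ∧ unblow x q = b := by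
  by_cases ha : a = x
  · subst ha
    obtain ⟨i, rfl⟩ := (h.2 b).1 hab
    exact ⟨.inr i, .inl ⟨n i, h.ne i⟩, rfl, rfl, rfl⟩
  · by_cases hb : b = x
    · subst hb
      obtain ⟨i, rfl⟩ := (h.2 a).1 hab.symm
      exact ⟨.inl ⟨n i, h.ne i⟩, .inr i, rfl, rfl, rfl⟩
    · exact ⟨.inl ⟨a, ha⟩, .inl ⟨b, hb⟩, hab, rfl, rfl⟩

theorem Cubic.of_blow (h : G.IsNbrLabeling x n) (hG : (G.blow x n).Cubic) : G.Cubic := by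
  intro v
  by_cases hv : v = x
  · subst hv
    exact ⟨n, h⟩
  · obtain ⟨m, hm, hadj⟩ := hG (.inl ⟨v, hv⟩)
    have h1 : ∀ i, (G.blow x n).Adj (.inl ⟨v, hv⟩) (m i) := fun i => (hadj _).2 ⟨i, rfl⟩
    have hne : ∀ i, unblow x (.inl ⟨v, hv⟩) ≠ unblow x (m i) := by
      intro i hi
      have h2 := h1 i
      rcases hmi : m i with b | j
      · rw [hmi] at hi h2
        exact (blow_adj_inl_inl.1 h2).ne hi
      · rw [hmi] at hi
        exact hv hi
    refine ⟨fun i => unblow x (m i), fun i j hij =>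
      hm (unblow_injective h (h1 i) (hne i) (h1 j) rfl hij).2, fun w => ⟨fun hw => ?_, ?_⟩⟩
    · obtain ⟨p, q, hpq, hp, rfl⟩ := exists_blow_adj h hw
      have : p = .inl ⟨v, hv⟩ := by
        rcases p with a | i
        · exact congrArg Sum.inl (Subtype.ext hp)
        · exact absurd hp.symm hv
      subst this
      obtain ⟨i, rfl⟩ := (hadj q).1 hpq
      exact ⟨i, rfl⟩
    · rintro ⟨i, rfl⟩
      exact unblow_adj h (h1 i) (hne i)

theorem Cubic.blow (hG : G.Cubic) (h : G.IsNbrLabeling x n) : (G.blow x n).Cubic := by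
  rintro (v | i)
  · obtain ⟨m, hm, hadj⟩ := hG v
    have hex : ∀ i, ∃ q, (G.blow x n).Adj (.inl v) q ∧ unblow x q = m i := by
      intro i
      obtain ⟨p, q, hpq, hp, hq⟩ := exists_blow_adj h ((hadj (m i)).2 ⟨i, rfl⟩)
      rcases p with a | j
      · obtain rfl : a = v := Subtype.ext hp
        exact ⟨q, hpq, hq⟩
      · exact absurd hp.symm v.2
    choose q hq hqm using hex
    have hne : ∀ i, unblow x (.inl v) ≠ unblow x (q i) := fun i => by
      rw [hqm]
      exact ((hadj (m i)).2 ⟨i, rfl⟩).ne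
    refine ⟨q, fun i j hij => hm (by rw [← hqm, ← hqm, hij]), fun w => ⟨fun hw => ?_, ?_⟩⟩
    · have hvw : unblow x (.inl v) ≠ unblow x w := by
        rcases w with b | j
        · exact (blow_adj_inl_inl.1 hw).ne
        · exact v.2
      obtain ⟨i, hi⟩ := (hadj _).1 (unblow_adj h hw hvw)
      exact ⟨i, (unblow_injective h hw hvw (hq i) rfl (by rw [hi, hqm])).2⟩
    · rintro ⟨i, rfl⟩
      exact hq i
  · refine ⟨![.inl ⟨n i, h.ne i⟩, .inr (i + 1), .inr (i + 2)], ?_, ?_⟩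
    · have : i + 1 ≠ i + 2 := by
        revert i
        decide
      intro j k hjk
      fin_cases j <;> fin_cases k <;> simp_all
    · have key : ∀ i j : Fin 3, i ≠ j ↔ j = i + 1 ∨ j = i + 2 := by decide
      rintro (b | j)
      · simp [Fin.exists_fin_succ, Subtype.ext_iff]
      · simp [Fin.exists_fin_succ, key]

theorem le_edgeCount_singleton {v : V} {N X : Finset V} (hNX : N ⊆ X)
    (hN : ∀ w ∈ N, G.Adj v w) : N.card ≤ G.edgeCount {v} X := by
  classical
  simp only [edgeCount, Finset.sum_singleton, ← Finset.card_filter]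
  exact Finset.card_le_card fun w hw => Finset.mem_filter.2 ⟨hNX hw, hN w hw⟩

variable [Fintype V] [DecidableEq V]

/-- A set of vertices that does not split the new triangle has the same boundary before and after
the replacement. -/
theorem edgeCount_blow_unblow (h : G.IsNbrLabeling x n) (X : Finset V)
    (X' : Finset ({a // a ≠ x} ⊕ Fin 3)) (hX : ∀ p, p ∈ X' ↔ unblow x p ∈ X) :
    (G.blow x n).edgeCount X' X'ᶜ = G.edgeCount X Xᶜ := by
  classical
  rw [edgeCount_eq_card, edgeCount_eq_card]
  refine Finset.card_bij (fun p _ => (unblow x p.1, unblow x p.2)) ?_ ?_ ?_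
  · rintro ⟨p, q⟩ hp
    simp only [Finset.mem_filter, Finset.mem_product, Finset.mem_compl, hX] at hp ⊢
    exact ⟨hp.1, unblow_adj h hp.2 fun h => hp.1.2 (h ▸ hp.1.1)⟩
  · rintro ⟨p, q⟩ hp ⟨p', q'⟩ hp' heq
    simp only [Finset.mem_filter, Finset.mem_product, Finset.mem_compl, hX, Prod.mk.injEq]
      at hp hp' heq ⊢
    exact unblow_injective h hp.2 (fun h => hp.1.2 (h ▸ hp.1.1)) hp'.2 heq.1 heq.2
  · rintro ⟨a, b⟩ hab
    simp only [Finset.mem_filter, Finset.mem_product, Finset.mem_compl] at hab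
    obtain ⟨p, q, hpq, rfl, rfl⟩ := exists_blow_adj h hab.2
    refine ⟨(p, q), ?_, rfl⟩
    simp only [Finset.mem_filter, Finset.mem_product, Finset.mem_compl, hX]
    exact ⟨hab.1, hpq⟩

theorem CutsGeThree.of_blow (h : G.IsNbrLabeling x n) (hG : (G.blow x n).CutsGeThree) :
    G.CutsGeThree := by
  intro X hX hX'
  let X' := Finset.univ.filter fun p => unblow x p ∈ X
  have hmem : ∀ p, p ∈ X' ↔ unblow x p ∈ X := fun p => by simp [X']
  have hsurj : ∀ v, ∃ p, unblow x p = v := by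
    intro v
    by_cases hv : v = x
    · exact ⟨.inr 0, hv.symm⟩
    · exact ⟨.inl ⟨v, hv⟩, rfl⟩
  rw [← edgeCount_blow_unblow h X X' hmem]
  refine hG X' ?_ fun he => hX' ?_
  · obtain ⟨v, hv⟩ := hX
    obtain ⟨p, rfl⟩ := hsurj v
    exact ⟨p, (hmem p).2 hv⟩
  · rw [Finset.eq_univ_iff_forall] at he ⊢
    intro v
    obtain ⟨p, rfl⟩ := hsurj v
    exact (hmem p).1 (he p)

/-- A set not splitting the triangle has the boundary of its image in `G`. Otherwise, up to
complement, it contains a single triangle vertex `i`. At least two edges at `i` then leave the set,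
so at most one joins `i` to the rest; if that rest is nonempty, removing `i` loses nothing in the
boundary bound and leads back to the first case. -/
theorem CutsGeThree.blow (hG : G.CutsGeThree) (hc : G.Cubic) (h : G.IsNbrLabeling x n) :
    (G.blow x n).CutsGeThree := by
  have hcb := hc.blow h
  have uniform : ∀ X' : Finset ({a // a ≠ x} ⊕ Fin 3), X'.Nonempty → X' ≠ Finset.univ →
      (∀ i j, Sum.inr i ∈ X' ↔ Sum.inr j ∈ X') → 3 ≤ (G.blow x n).edgeCount X' X'ᶜ := by
    intro X' hX hX' hu
    let X := X'.image (unblow x)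
    have hmem : ∀ p, p ∈ X' ↔ unblow x p ∈ X := by
      intro p
      constructor
      · exact fun hp => Finset.mem_image_of_mem _ hp
      · intro hp
        obtain ⟨q, hq, hqp⟩ := Finset.mem_image.1 hp
        rcases p with a | i <;> rcases q with b | j
        · rwa [← show b = a from Subtype.ext hqp]
        · exact absurd hqp.symm a.2
        · exact absurd hqp b.2
        · exact (hu i j).2 hq
    rw [edgeCount_blow_unblow h X X' hmem]
    refine hG X (hX.image _) fun he => hX' ?_
    rw [Finset.eq_univ_iff_forall] at he ⊢
    exact fun p => (hmem p).2 (he _)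
  have single : ∀ (X' : Finset ({a // a ≠ x} ⊕ Fin 3)) (i : Fin 3),
      (∀ j, Sum.inr j ∈ X' ↔ j = i) → 3 ≤ (G.blow x n).edgeCount X' X'ᶜ := by
    intro X' i hi
    have hiX : Sum.inr i ∈ X' := (hi i).2 rfl
    have htri : 2 ≤ (G.blow x n).edgeCount {.inr i} X'ᶜ := by
      have := le_edgeCount_singleton (G := G.blow x n) (v := .inr i)
        (N := {.inr (i + 1), .inr (i + 2)}) (X := X'ᶜ) (by
          intro p hp
          simp only [Finset.mem_insert, Finset.mem_singleton] at hp
          obtain rfl | rfl := hp <;> simp [hi]) (by simp)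
      rwa [Finset.card_pair (by simp)] at this
    have hY : ∀ p, p ∈ X'.erase (.inr i) ↔ p ∈ X' ∧ p ≠ .inr i := fun p => by
      rw [Finset.mem_erase, and_comm]
    have hsplit : X' = X'.erase (.inr i) ∪ {.inr i} := by
      rw [Finset.union_comm, ← Finset.insert_eq, Finset.insert_erase hiX]
    have hXsum : (G.blow x n).edgeCount X' X'ᶜ =
        (G.blow x n).edgeCount (X'.erase (.inr i)) X'ᶜ + (G.blow x n).edgeCount {.inr i} X'ᶜ := by
      rw [← edgeCount_union_left (by simp), ← hsplit]
    obtain hY0 | hY0 := (X'.erase (.inr i)).eq_empty_or_nonempty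
    · have hX1 : X' = {.inr i} := by rw [hsplit, hY0, Finset.empty_union]
      have h1 := hcb.edgeCount_singleton_univ (.inr i)
      rw [← Finset.union_compl {.inr i}, edgeCount_union_right disjoint_compl_right] at h1
      have h2 : (G.blow x n).edgeCount {.inr i} {.inr i} = 0 := by
        rw [edgeCount_eq_zero_iff]
        simp
      rw [hX1]
      omega
    · have h1 := uniform _ hY0 (fun he => by
        have := Finset.mem_univ (Sum.inr i : {a // a ≠ x} ⊕ Fin 3)
        rw [← he] at this
        simp at this) (by simp [hi])
      have hcompl : (X'.erase (.inr i))ᶜ = X'ᶜ ∪ {.inr i} := by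
        ext p
        by_cases hp : p = .inr i <;> simp [hp]
      rw [hcompl, edgeCount_union_right (by simpa using hiX)] at h1
      have h2 : (G.blow x n).edgeCount (X'.erase (.inr i)) {.inr i} +
          (G.blow x n).edgeCount {.inr i} X'ᶜ ≤ 3 := by
        rw [edgeCount_comm, ← edgeCount_union_right
          (disjoint_compl_right.mono_left (Finset.erase_subset _ _))]
        exact hcb.edgeCount_singleton_le _ _
      omega
  intro X' hX hX'
  have key : ∀ P : Fin 3 → Prop, (∀ i j, P i ↔ P j) ∨ (∃ i, ∀ j, P j ↔ j = i) ∨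
      ∃ i, ∀ j, ¬ P j ↔ j = i := by
    intro P
    by_cases h0 : P 0 <;> by_cases h1 : P 1 <;> by_cases h2 : P 2
    · left; intro i j; fin_cases i <;> fin_cases j <;> simp [h0, h1, h2]
    · right; right; refine ⟨2, fun j => ?_⟩; fin_cases j <;> simp [h0, h1, h2]
    · right; right; refine ⟨1, fun j => ?_⟩; fin_cases j <;> simp [h0, h1, h2]
    · right; left; refine ⟨0, fun j => ?_⟩; fin_cases j <;> simp [h0, h1, h2]
    · right; right; refine ⟨0, fun j => ?_⟩; fin_cases j <;> simp [h0, h1, h2]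
    · right; left; refine ⟨1, fun j => ?_⟩; fin_cases j <;> simp [h0, h1, h2]
    · right; left; refine ⟨2, fun j => ?_⟩; fin_cases j <;> simp [h0, h1, h2]
    · left; intro i j; fin_cases i <;> fin_cases j <;> simp [h0, h1, h2]
  obtain hu | ⟨i, hi⟩ | ⟨i, hi⟩ := key fun i => Sum.inr i ∈ X'
  · exact uniform X' hX hX' hu
  · exact single X' i hi
  · have := single X'ᶜ i (by simpa using hi)
    rwa [compl_compl, edgeCount_comm] at this

end blow

/-! ### Contracting a triangle -/

section contract

variable {V : Type*} {G : SimpleGraph V} {x : V} {n : Fin 3 → V}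

/-- A matching of `G.blow x n` that crosses the new triangle once comes from a matching of `G`. -/
theorem exists_eq_liftPM (h : G.IsNbrLabeling x n) {g : _ → _} (hg : (G.blow x n).IsPM g)
    {i : Fin 3} (hi : g (.inr i) = .inl ⟨n i, h.ne i⟩)
    (hj : ∀ j, j ≠ i → g (.inr j) = .inr (third i j)) :
    ∃ f, G.IsPM f ∧ f x = n i ∧ liftPM h f i = g := by
  classical
  let f : V → V := fun v => if hv : v = x then n i else unblow x (g (.inl ⟨v, hv⟩))
  have hfx : f x = n i := by simp [f]
  have hf : ∀ v : {a // a ≠ x}, f v = unblow x (g (.inl v)) := fun v => by simp [f, v.2]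
  have hg1 : ∀ v : {a // a ≠ x}, v.1 ≠ n i → ∃ b, g (.inl v) = .inl b := by
    intro v hv
    rcases hgv : g (.inl v) with b | j
    · exact ⟨b, rfl⟩
    · have h1 := hg.apply_eq_of_apply_eq hgv
      by_cases hji : j = i
      · rw [hji, hi] at h1
        exact absurd (congrArg Subtype.val (Sum.inl_injective h1)).symm hv
      · rw [hj j hji] at h1
        cases h1
  have hg2 : g (.inl ⟨n i, h.ne i⟩) = .inr i := hg.apply_eq_of_apply_eq hi
  refine ⟨f, fun v => ?_, hfx, ?_⟩
  · by_cases hv : v = x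
    · rw [hv, hfx]
      refine ⟨h.adj i, ?_⟩
      rw [hf ⟨n i, h.ne i⟩, hg2]
      rfl
    · by_cases hvn : v = n i
      · have : f v = x := by
          rw [hf ⟨v, hv⟩]
          subst hvn
          rw [hg2]
          rfl
        rw [this, hfx, hvn]
        exact ⟨(h.adj i).symm, rfl⟩
      · obtain ⟨b, hb⟩ := hg1 ⟨v, hv⟩ hvn
        have h1 := (hg (.inl ⟨v, hv⟩)).1
        rw [hb] at h1
        have h2 : f v = b := by rw [hf ⟨v, hv⟩, hb]; rfl
        rw [h2]
        refine ⟨h1, ?_⟩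
        rw [hf b, hg.apply_eq_of_apply_eq hb]
        rfl
  · funext p
    rcases p with v | j
    · by_cases hvn : v.1 = n i
      · obtain rfl : v = ⟨n i, h.ne i⟩ := Subtype.ext hvn
        rw [liftPM_inl_of_eq h f i (by rw [hf, hg2]; rfl), hg2]
      · obtain ⟨b, hb⟩ := hg1 v hvn
        have h2 : f v = b := by rw [hf v, hb]; rfl
        rw [liftPM_inl_of_ne h f i (by rw [h2]; exact b.2), hb]
        simp [h2]
    · by_cases hji : j = i
      · rw [hji, liftPM_inr_self, hi]
      · rw [liftPM_inr_of_ne h f i hji, hj j hji]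

/-- Since `g` crosses the triangle once, it is a lift. A second matching of `G` with the same edge
at `u` would lift to a second one with the same edge at `u`. -/
theorem lonelySet_nonempty_of_blow (h : G.IsNbrLabeling x n) {g : _ → _}
    (hg : (G.blow x n).IsPM g) {u : {a // a ≠ x}}
    (huniq : ∀ g', (G.blow x n).IsPM g' → g' (.inl u) = g (.inl u) → g' = g) {i : Fin 3}
    (hi : g (.inr i) = .inl ⟨n i, h.ne i⟩)
    (hj : ∀ j, j ≠ i → g (.inr j) = .inr (third i j)) : G.lonelySet.Nonempty := by
  obtain ⟨f, hf, hfi, rfl⟩ := exists_eq_liftPM h hg hi hj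
  refine ⟨s(u.1, f u), mk_mem_lonelySet.2 ⟨f, ⟨hf, rfl⟩, fun f' ⟨hf', hu⟩ => ?_⟩⟩
  obtain ⟨i', hi'⟩ := (h.2 _).1 (hf' x).1
  refine liftPM_injective h hi' hfi (huniq _ (hf'.liftPM h hi') ?_)
  by_cases hux : f u = x
  · have h1 : n i = n i' := by
      rw [← hfi, ← hi', hf.apply_eq_of_apply_eq hux, hf'.apply_eq_of_apply_eq (hu.trans hux)]
    rw [h.1 h1, liftPM_inl_of_eq h f' i' (hu.trans hux), liftPM_inl_of_eq h f i' hux]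
  · rw [liftPM_inl_of_ne h f i hux, liftPM_inl_of_ne h f' i' (by rwa [hu])]
    simp [hu]

/-- The graph obtained from `G` by contracting the triangle `t`, whose vertex `t i` has the
neighbour `m i` outside the triangle. -/
def contract {V : Type*} (G : SimpleGraph V) (t m : Fin 3 → V) :
    SimpleGraph (Option {v // ∀ i, v ≠ t i}) where
  Adj
    | some a, some b => G.Adj a b
    | some a, none => ∃ i, (a : V) = m i
    | none, some a => ∃ i, (a : V) = m i
    | none, none => False
  symm := ⟨by
    rintro (_ | a) (_ | b) h
    · exact h
    · exact h
    · exact h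
    · exact SimpleGraph.Adj.symm h⟩
  loopless := ⟨by
    rintro (_ | a) h
    · exact h
    · exact G.loopless.irrefl _ h⟩

variable {t m : Fin 3 → V}

theorem isNbrLabeling_contract (hm : Function.Injective m) (hmt : ∀ i j, m i ≠ t j) :
    (G.contract t m).IsNbrLabeling none fun i => some ⟨m i, hmt i⟩ := by
  refine ⟨fun i j hij => hm (by simpa using hij), ?_⟩
  rintro (_ | a)
  · simp
  · simp only [Option.some.injEq, Subtype.ext_iff]
    exact Iff.rfl

/-- Contracting a triangle and replacing the resulting vertex with a triangle is the identity. -/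
noncomputable def contractBlowIso (ht : Function.Injective t)
    (hadj : ∀ i j, i ≠ j → G.Adj (t i) (t j)) (hmt : ∀ i j, m i ≠ t j)
    (htm : ∀ i w, (∀ j, w ≠ t j) → (G.Adj (t i) w ↔ w = m i)) :
    (G.contract t m).blow none (fun i => some ⟨m i, hmt i⟩) ≃g G := by
  let F : {a : Option {v // ∀ i, v ≠ t i} // a ≠ none} ⊕ Fin 3 → V :=
    Sum.elim (fun a => (a.1.get (Option.isSome_iff_ne_none.2 a.2)).1) t
  have hF : ∀ v h, F (.inl ⟨some v, h⟩) = v := fun v h => rfl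
  have hF' : ∀ i, F (.inr i) = t i := fun i => rfl
  refine ⟨Equiv.ofBijective F ⟨?_, ?_⟩, ?_⟩
  · rintro (⟨_ | a, ha⟩ | i) (⟨_ | b, hb⟩ | j) hab
    · exact absurd rfl ha
    · exact absurd rfl ha
    · exact absurd rfl ha
    · exact absurd rfl hb
    · rw [hF, hF] at hab
      simp [Subtype.ext_iff, hab]
    · exact absurd hab (a.2 j)
    · exact absurd rfl hb
    · exact absurd hab.symm (b.2 i)
    · rw [ht hab]
  · intro v
    by_cases hv : ∀ i, v ≠ t i
    · exact ⟨.inl ⟨some ⟨v, hv⟩, by simp⟩, rfl⟩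
    · push Not at hv
      obtain ⟨i, rfl⟩ := hv
      exact ⟨.inr i, rfl⟩
  · rintro (⟨_ | a, ha⟩ | i) (⟨_ | b, hb⟩ | j)
    · exact absurd rfl ha
    · exact absurd rfl ha
    · exact absurd rfl ha
    · exact absurd rfl hb
    · exact Iff.rfl
    · change G.Adj a (t j) ↔ some a = some ⟨m j, hmt j⟩
      rw [G.adj_comm, htm j a a.2, Option.some.injEq, Subtype.ext_iff]
    · exact absurd rfl hb
    · change G.Adj (t i) b ↔ some b = some ⟨m i, hmt i⟩
      rw [htm i b b.2, Option.some.injEq, Subtype.ext_iff]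
    · change G.Adj (t i) (t j) ↔ i ≠ j
      exact ⟨fun h hij => h.ne (by rw [hij]), hadj i j⟩

theorem Cubic.exists_outer_nbr (hG : G.Cubic) (ht : Function.Injective t)
    (hadj : ∀ i j, i ≠ j → G.Adj (t i) (t j)) (i : Fin 3) :
    ∃ m, (∀ j, m ≠ t j) ∧ ∀ w, (∀ j, w ≠ t j) → (G.Adj (t i) w ↔ w = m) := by
  obtain ⟨ν, hν, h⟩ := hG (t i)
  have h1 : i ≠ i + 1 ∧ i ≠ i + 2 ∧ i + 1 ≠ i + 2 ∧ ∀ j, j = i ∨ j = i + 1 ∨ j = i + 2 := by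
    clear h ν hν
    revert i
    decide
  obtain ⟨h1, h2, h12, hcases⟩ := h1
  obtain ⟨a, ha⟩ := (h _).1 (hadj i (i + 1) h1)
  obtain ⟨b, hb⟩ := (h _).1 (hadj i (i + 2) h2)
  have hab : a ≠ b := fun hab => h12 (ht (by rw [ha, hb, hab]))
  have key : ∀ a b : Fin 3, a ≠ b → third a b ≠ a ∧ third a b ≠ b ∧
      ∀ d, d = a ∨ d = b ∨ d = third a b := by decide
  obtain ⟨k1, k2, k3⟩ := key a b hab
  refine ⟨ν (third a b), fun j hj => ?_, fun w hw => ⟨fun hw' => ?_, ?_⟩⟩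
  · obtain rfl | rfl | rfl := hcases j
    · exact ((h (ν (third a b))).2 ⟨_, rfl⟩).ne hj.symm
    · rw [ha] at hj
      exact k1 (hν hj)
    · rw [hb] at hj
      exact k2 (hν hj)
  · obtain ⟨d, rfl⟩ := (h w).1 hw'
    obtain rfl | rfl | rfl := k3 d
    · exact absurd ha.symm (hw _)
    · exact absurd hb.symm (hw _)
    · rfl
  · rintro rfl
    exact (h _).2 ⟨_, rfl⟩

/-- If two triangle vertices had a common outer neighbour, the triangle together with it would be
bounded by at most two edges: one at the third triangle vertex and one at that neighbour. More than
four vertices make this set proper. -/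
theorem outer_nbr_injective [Fintype V] [DecidableEq V] (hG : G.Cubic) (h3 : G.CutsGeThree)
    (hcard : 4 < Fintype.card V) (ht : Function.Injective t)
    (hadj : ∀ i j, i ≠ j → G.Adj (t i) (t j)) (hmt : ∀ i j, m i ≠ t j)
    (htm : ∀ i, G.Adj (t i) (m i)) : Function.Injective m := by
  intro i j hij
  by_contra hne
  have hk : ∀ i j : Fin 3, i ≠ j → i ≠ third i j ∧ j ≠ third i j := by decide
  obtain ⟨h1, h2⟩ := hk i j hne
  set k := third i j
  have hti : t i ≠ t j := ht.ne hne
  have htik : t i ≠ t k := ht.ne h1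
  have htjk : t j ≠ t k := ht.ne h2
  let y := m i
  have hjy : G.Adj (t j) y := by rw [show y = m j from hij]; exact htm j
  let X : Finset V := {t i, t j, t k, y}
  have hX : 3 ≤ G.edgeCount X Xᶜ := by
    refine h3 X ⟨t i, by simp [X]⟩ fun h => ?_
    have : X.card ≤ 4 := Finset.card_le_four
    rw [h, Finset.card_univ] at this
    omega
  have hbound : ∀ v (N : Finset V), N ⊆ X → (∀ w ∈ N, G.Adj v w) →
      G.edgeCount {v} Xᶜ ≤ 3 - N.card := by
    intro v N hN hv
    have h1 := hG.edgeCount_singleton_univ v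
    rw [← Finset.union_compl X, edgeCount_union_right disjoint_compl_right] at h1
    have h2 := le_edgeCount_singleton hN hv
    omega
  have hsum : G.edgeCount X Xᶜ = G.edgeCount {t i} Xᶜ + (G.edgeCount {t j} Xᶜ +
      (G.edgeCount {t k} Xᶜ + G.edgeCount {y} Xᶜ)) := by
    rw [← edgeCount_union_left, ← edgeCount_union_left, ← edgeCount_union_left]
    · rfl
    · simp [hti, htik, (hmt i i).symm, y]
    · simp [htjk, (hmt i j).symm, y]
    · simp [(hmt i k).symm, y]
  have b1 := hbound (t i) {t j, t k, y} (by simp [X, Finset.subset_iff])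
    (by simp [hadj i j hne, hadj i k h1, y, htm])
  have b2 := hbound (t j) {t i, t k, y} (by simp [X, Finset.subset_iff])
    (by simp [hadj j i (Ne.symm hne), hadj j k h2, hjy])
  have b3 := hbound (t k) {t i, t j} (by simp [X, Finset.subset_iff])
    (by simp [hadj k i h1.symm, hadj k j h2.symm])
  have b4 := hbound y {t i, t j} (by simp [X, Finset.subset_iff])
    (by simp [hjy.symm, (htm i).symm, y])
  rw [Finset.card_eq_three.2 ⟨_, _, _, htjk, (hmt i j).symm, (hmt i k).symm, rfl⟩] at b1
  rw [Finset.card_eq_three.2 ⟨_, _, _, htik, (hmt i i).symm, (hmt i k).symm, rfl⟩] at b2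
  rw [Finset.card_pair hti] at b3 b4
  omega

/-- A cubic graph without small edge cuts, with an edge in exactly one perfect matching and with
more than four vertices, arises from a smaller such graph by replacing a vertex with a
triangle. -/
theorem exists_iso_blow {V : Type*} [Fintype V] [DecidableEq V] {G : SimpleGraph V}
    (hG : G.Cubic) (h3 : G.CutsGeThree) (hcard : 4 < Fintype.card V) (hl : G.lonelySet.Nonempty) :
    ∃ (t m : Fin 3 → V) (n : Fin 3 → Option {v // ∀ i, v ≠ t i}),
      (G.contract t m).IsNbrLabeling none n ∧ (G.contract t m).Cubic ∧
      (G.contract t m).CutsGeThree ∧ (G.contract t m).lonelySet.Nonempty ∧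
      Nonempty ((G.contract t m).blow none n ≃g G) ∧
      Fintype.card (Option {v // ∀ i, v ≠ t i}) < Fintype.card V := by
  obtain ⟨e, he⟩ := hl
  induction e using Sym2.ind with | _ u w =>
  obtain ⟨f, ⟨hf, rfl⟩, huniq⟩ := mk_mem_lonelySet.1 he
  obtain ⟨t, ht, hadj, htu, hft0, hft1⟩ := exists_triangle hG h3 hf
    (fun f' h1 h2 => huniq f' ⟨h1, h2⟩)
  choose m hmt htm using hG.exists_outer_nbr ht hadj
  have hm := outer_nbr_injective hG h3 hcard ht hadj hmt fun i => (htm i _ (hmt i)).2 rfl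
  have hlab := isNbrLabeling_contract (G := G) hm hmt
  let φ := contractBlowIso ht hadj hmt htm
  have hφ0 : ∀ i, φ (.inr i) = t i := fun i => rfl
  have hφ1 : ∀ v h, φ (.inl ⟨some v, h⟩) = v := fun v h => rfl
  have hcb := hG.map_iso φ.symm
  have hgb := hf.map_iso φ.symm
  refine ⟨t, m, _, hlab, .of_blow hlab hcb, .of_blow hlab (h3.map_iso φ.symm), ?_, ⟨φ⟩, ?_⟩
  · have hss : ∀ p, φ.symm.symm p = φ p := fun _ => rfl
    refine lonelySet_nonempty_of_blow hlab hgb (u := ⟨some ⟨u, fun i => (htu i).symm⟩, by simp⟩)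
      (i := 0) ?_ ?_ ?_
    · intro g' hg' hu
      have h1 := huniq _ ⟨hg'.map_iso φ, by
        have h2 : φ.symm u = .inl ⟨some ⟨u, fun i => (htu i).symm⟩, by simp⟩ := by
          rw [RelIso.symm_apply_eq]
          rfl
        simp only [Function.comp_apply, h2, hu]
        simp [hφ1]⟩
      rw [← h1]
      funext p
      simp
    · have h1 : f (t 0) = m 0 := (htm 0 _ hft0).1 (hf _).1
      simp only [Function.comp_apply, hss, hφ0, h1]
      rw [RelIso.symm_apply_eq]
      rfl
    · have hft2 := hf.apply_eq_of_apply_eq hft1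
      intro j hj
      simp only [Function.comp_apply, hss, hφ0]
      rw [RelIso.symm_apply_eq, hφ0]
      fin_cases j
      · exact absurd rfl hj
      · exact hft1
      · exact hft2
  · rw [Fintype.card_option]
    have h1 : (Finset.univ.filter fun v => ∀ i, v ≠ t i) ⊆ {t 0, t 1}ᶜ := by
      intro v
      simp +contextual
    have h2 := Finset.card_le_card h1
    rw [Finset.card_compl, Finset.card_pair (ht.ne (by decide))] at h2
    rw [Fintype.card_subtype]
    omega

end contract

/-! ### Ladders, their matchings and their lonely edges -/

/-- The ladder with `n` rungs, whose two ends are closed by two adjacent vertices `Sum.inr false`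
(joined to the first rung) and `Sum.inr true` (joined to the last rung). -/
def ladder (n : ℕ) : SimpleGraph ((Fin n × Bool) ⊕ Bool) where
  Adj
    | .inl p, .inl q => (p.1 = q.1 ∧ p.2 ≠ q.2) ∨
        (p.2 = q.2 ∧ ((p.1 : ℕ) + 1 = q.1 ∨ (q.1 : ℕ) + 1 = p.1))
    | .inl p, .inr b => (b = false ∧ (p.1 : ℕ) = 0) ∨ (b = true ∧ (p.1 : ℕ) + 1 = n)
    | .inr b, .inl p => (b = false ∧ (p.1 : ℕ) = 0) ∨ (b = true ∧ (p.1 : ℕ) + 1 = n)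
    | .inr b, .inr c => b ≠ c
  symm := ⟨by
    rintro (p | b) (q | c) h
    · exact h.imp (fun h => ⟨h.1.symm, h.2.symm⟩) fun h => ⟨h.1.symm, h.2.symm⟩
    · exact h
    · exact h
    · exact Ne.symm h⟩
  loopless := ⟨by
    rintro (p | b) h
    · obtain h | h := h
      · exact h.2 rfl
      · omega
    · exact h rfl⟩

section ladder

variable {n : ℕ}

theorem ladder_adj_inl_inl {p q : Fin n × Bool} : (ladder n).Adj (.inl p) (.inl q) ↔
    (p.1 = q.1 ∧ p.2 ≠ q.2) ∨ (p.2 = q.2 ∧ ((p.1 : ℕ) + 1 = q.1 ∨ (q.1 : ℕ) + 1 = p.1)) := Iff.rfl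

theorem ladder_adj_inl_inr {p : Fin n × Bool} {b} : (ladder n).Adj (.inl p) (.inr b) ↔
    (b = false ∧ (p.1 : ℕ) = 0) ∨ (b = true ∧ (p.1 : ℕ) + 1 = n) := Iff.rfl

theorem ladder_adj_inr_inl {p : Fin n × Bool} {b} : (ladder n).Adj (.inr b) (.inl p) ↔
    (b = false ∧ (p.1 : ℕ) = 0) ∨ (b = true ∧ (p.1 : ℕ) + 1 = n) := Iff.rfl

theorem ladder_adj_inr_inr {b c} : (ladder n).Adj (.inr b) (.inr c) ↔ b ≠ c := Iff.rfl

instance : DecidableRel (ladder n).Adj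
  | .inl _, .inl _ => decidable_of_iff' _ ladder_adj_inl_inl
  | .inl _, .inr _ => decidable_of_iff' _ ladder_adj_inl_inr
  | .inr _, .inl _ => decidable_of_iff' _ ladder_adj_inr_inl
  | .inr _, .inr _ => decidable_of_iff' _ ladder_adj_inr_inr

/-- The upside-down symmetry of the ladder. -/
def ladderRev (n : ℕ) : ladder n ≃g ladder n where
  toFun := Sum.map (Prod.map Fin.rev id) not
  invFun := Sum.map (Prod.map Fin.rev id) not
  left_inv := by rintro (⟨i, s⟩ | b) <;> simp
  right_inv := by rintro (⟨i, s⟩ | b) <;> simp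
  map_rel_iff' := by
    rintro (⟨i, s⟩ | b) (⟨j, t⟩ | c)
    · have := i.2
      have := j.2
      by_cases hst : s = t
      · simp [ladder_adj_inl_inl, hst]
        omega
      · simp [ladder_adj_inl_inl, hst]
    · cases c <;> simp [ladder_adj_inl_inr] <;> omega
    · cases b <;> simp [ladder_adj_inr_inl] <;> omega
    · simp [ladder_adj_inr_inr]

/-- The left-right symmetry of the ladder. -/
def ladderFlip (n : ℕ) : ladder n ≃g ladder n where
  toFun := Sum.map (Prod.map id not) id
  invFun := Sum.map (Prod.map id not) id
  left_inv := by rintro (⟨i, s⟩ | b) <;> simp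
  right_inv := by rintro (⟨i, s⟩ | b) <;> simp
  map_rel_iff' := by
    rintro (⟨i, s⟩ | b) (⟨j, t⟩ | c)
    · simp [ladder_adj_inl_inl]
    · simp [ladder_adj_inl_inr]
    · simp [ladder_adj_inr_inl]
    · simp [ladder_adj_inr_inr]

/-- The vertex above `(i, s)` on the same side. -/
def ladderUp (i : Fin n) (s : Bool) : (Fin n × Bool) ⊕ Bool :=
  if h : (i : ℕ) + 1 < n then .inl (⟨i + 1, h⟩, s) else .inr true

/-- The vertex below `(i, s)` on the same side. -/
def ladderDown (i : Fin n) (s : Bool) : (Fin n × Bool) ⊕ Bool :=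
  if (i : ℕ) = 0 then .inr false else .inl (⟨i - 1, by omega⟩, s)

theorem inl_eq_ladderUp_iff {i j : Fin n} {s t : Bool} :
    .inl (j, t) = ladderUp i s ↔ (j : ℕ) = i + 1 ∧ t = s := by
  have := j.2
  unfold ladderUp
  split_ifs with h
  · rw [Sum.inl.injEq, Prod.mk.injEq, Fin.ext_iff]
  · simp
    omega

theorem inl_eq_ladderDown_iff {i j : Fin n} {s t : Bool} :
    .inl (j, t) = ladderDown i s ↔ (j : ℕ) + 1 = i ∧ t = s := by
  unfold ladderDown
  split_ifs with h
  · simp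
    omega
  · rw [Sum.inl.injEq, Prod.mk.injEq, Fin.ext_iff]
    refine and_congr_left' ?_
    simp only
    omega

theorem inr_eq_ladderUp_iff {i : Fin n} {s b : Bool} :
    .inr b = ladderUp i s ↔ b = true ∧ (i : ℕ) + 1 = n := by
  have := i.2
  unfold ladderUp
  split_ifs with h
  · simp
    omega
  · simp
    omega

theorem inr_eq_ladderDown_iff {i : Fin n} {s b : Bool} :
    .inr b = ladderDown i s ↔ b = false ∧ (i : ℕ) = 0 := by
  unfold ladderDown
  split_ifs with h
  · simp [h]
  · simp [h]

theorem ladder_adj_inl_iff {i : Fin n} {s : Bool} {w} : (ladder n).Adj (.inl (i, s)) w ↔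
    w = .inl (i, !s) ∨ w = ladderUp i s ∨ w = ladderDown i s := by
  rcases w with ⟨j, t⟩ | b
  · rw [ladder_adj_inl_inl, inl_eq_ladderUp_iff, inl_eq_ladderDown_iff, Sum.inl.injEq,
      Prod.mk.injEq, Fin.ext_iff, Fin.ext_iff]
    cases s <;> cases t <;> simp <;> omega
  · rw [ladder_adj_inl_inr, inr_eq_ladderUp_iff, inr_eq_ladderDown_iff]
    cases b <;> simp

theorem isNbrLabeling_ladder_inl (i : Fin n) (s : Bool) :
    (ladder n).IsNbrLabeling (.inl (i, s)) ![.inl (i, !s), ladderUp i s, ladderDown i s] := by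
  refine ⟨?_, fun w => ?_⟩
  · have h1 : (.inl (i, !s) : (Fin n × Bool) ⊕ Bool) ≠ ladderUp i s := by
      unfold ladderUp; split_ifs <;> simp
    have h2 : (.inl (i, !s) : (Fin n × Bool) ⊕ Bool) ≠ ladderDown i s := by
      unfold ladderDown; split_ifs <;> simp
    have h3 : ladderUp i s ≠ ladderDown i s := by
      unfold ladderDown ladderUp; split_ifs <;> simp [Fin.ext_iff]; omega
    intro j k hjk
    fin_cases j <;> fin_cases k <;> simp_all
  · rw [ladder_adj_inl_iff]
    simp [Fin.exists_fin_succ]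

/-- The rung next to `Sum.inr b`. -/
def capRow (n : ℕ) (b : Bool) : Fin (n + 1) := if b then Fin.last n else 0

theorem ladder_adj_inr_iff {b : Bool} {w} : (ladder (n + 1)).Adj (.inr b) w ↔
    w = .inl (capRow n b, false) ∨ w = .inl (capRow n b, true) ∨ w = .inr (!b) := by
  rcases w with ⟨i, s⟩ | c
  · rw [ladder_adj_inr_inl]
    have hl : i = Fin.last n ↔ (i : ℕ) = n := Fin.ext_iff
    cases s <;> cases b <;> simp [capRow, hl]
  · rw [ladder_adj_inr_inr]
    cases b <;> cases c <;> simp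

theorem isNbrLabeling_ladder_inr (b : Bool) : (ladder (n + 1)).IsNbrLabeling (.inr b)
    ![.inl (capRow n b, false), .inl (capRow n b, true), .inr (!b)] := by
  refine ⟨?_, fun w => ?_⟩
  · intro j k hjk
    fin_cases j <;> fin_cases k <;> simp_all
  · rw [ladder_adj_inr_iff]
    simp [Fin.exists_fin_succ]

theorem cubic_ladder (n : ℕ) : (ladder (n + 1)).Cubic
  | .inl (i, s) => ⟨_, isNbrLabeling_ladder_inl i s⟩
  | .inr b => ⟨_, isNbrLabeling_ladder_inr b⟩

/-- Replacing the last vertex of a ladder with a triangle gives the next ladder. -/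
def blowLadderIso (n : ℕ) : (ladder (n + 1)).blow (.inr true)
    ![.inl (Fin.last n, false), .inl (Fin.last n, true), .inr false] ≃g ladder (n + 2) where
  toFun
    | .inl ⟨.inl (i, s), _⟩ => .inl (i.castSucc, s)
    | .inl ⟨.inr _, _⟩ => .inr false
    | .inr 0 => .inl (Fin.last _, false)
    | .inr 1 => .inl (Fin.last _, true)
    | .inr 2 => .inr true
  invFun
    | .inl (i, s) => Fin.lastCases (if s then .inr 1 else .inr 0)
        (fun i => .inl ⟨.inl (i, s), by simp⟩) i
    | .inr false => .inl ⟨.inr false, by simp⟩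
    | .inr true => .inr 2
  left_inv := by
    rintro (⟨⟨i, s⟩ | b, h⟩ | j)
    · simp
    · cases b
      · rfl
      · exact absurd rfl h
    · fin_cases j <;> simp
  right_inv := by
    rintro (⟨i, s⟩ | b)
    · induction i using Fin.lastCases <;> cases s <;> simp
    · cases b <;> rfl
  map_rel_iff' := by
    rintro (⟨⟨i, s⟩ | b, h⟩ | j) (⟨⟨i', s'⟩ | b', h'⟩ | j')
    · simp [ladder_adj_inl_inl]
    · cases b'
      · simp [ladder_adj_inl_inr]
      · exact absurd rfl h'
    · have := i.2
      have hi : i = Fin.last n ↔ (i : ℕ) = n := Fin.ext_iff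
      fin_cases j' <;> cases s <;> simp [ladder_adj_inl_inl, ladder_adj_inl_inr, hi] <;> omega
    · cases b
      · simp [ladder_adj_inr_inl]
      · exact absurd rfl h
    · cases b
      · cases b'
        · simp
        · exact absurd rfl h'
      · exact absurd rfl h
    · cases b
      · fin_cases j' <;> simp [ladder_adj_inr_inl, ladder_adj_inr_inr]
      · exact absurd rfl h
    · have := i'.2
      have hi : i' = Fin.last n ↔ (i' : ℕ) = n := Fin.ext_iff
      have hl : Fin.last (n + 1) ≠ i'.castSucc := (Fin.castSucc_lt_last i').ne'
      fin_cases j <;> cases s' <;> simp [ladder_adj_inl_inl, ladder_adj_inr_inl, hi, hl] <;>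
        omega
    · cases b'
      · fin_cases j <;> simp [ladder_adj_inl_inr, ladder_adj_inr_inr]
      · exact absurd rfl h'
    · fin_cases j <;> fin_cases j' <;>
        simp [ladder_adj_inl_inr, ladder_adj_inr_inl, ladder_adj_inl_inl]

end ladder

section ladder

variable {n : ℕ}

@[simp] theorem ladderDown_zero {h : 0 < n} {t : Bool} :
    ladderDown (⟨0, h⟩ : Fin n) t = .inr false := by
  simp [ladderDown]

@[simp] theorem ladderDown_succ {i : ℕ} {h : i + 1 < n} {t : Bool} :
    ladderDown (⟨i + 1, h⟩ : Fin n) t = .inl (⟨i, by omega⟩, t) := by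
  simp [ladderDown]

theorem ladderUp_of_lt {i : ℕ} {hi : i < n} {t : Bool} (h : i + 1 < n) :
    ladderUp (⟨i, hi⟩ : Fin n) t = .inl (⟨i + 1, h⟩, t) := by
  simp [ladderUp, h]

@[simp] theorem ladderUp_last {h : n < n + 1} {t : Bool} :
    ladderUp (⟨n, h⟩ : Fin (n + 1)) t = .inr true := by
  simp [ladderUp]

theorem ladder_adj_up (i : Fin n) (t : Bool) : (ladder n).Adj (.inl (i, t)) (ladderUp i t) :=
  ladder_adj_inl_iff.2 (.inr (.inl rfl))

theorem ladder_adj_down (i : Fin n) (t : Bool) : (ladder n).Adj (.inl (i, t)) (ladderDown i t) :=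
  ladder_adj_inl_iff.2 (.inr (.inr rfl))

/-- The perfect matching of the ladder that contains the edge from `Sum.inr false` to `(0, s)`. -/
def zigzag (n : ℕ) (s : Bool) : (Fin (n + 1) × Bool) ⊕ Bool → (Fin (n + 1) × Bool) ⊕ Bool
  -- The side matched downwards alternates with the row: in each row one vertex is taken from below,
  -- and the other must go up.
  | .inl (i, t) => if t = (s ^^ (i : ℕ).bodd) then ladderDown i t else ladderUp i t
  | .inr false => .inl (0, s)
  | .inr true => .inl (Fin.last n, !(s ^^ n.bodd))

theorem bool_ne_iff : ∀ {a b : Bool}, a ≠ b ↔ a = !b := by decide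

theorem isPM_zigzag (n : ℕ) (s : Bool) : (ladder (n + 1)).IsPM (zigzag n s) := by
  rintro (⟨⟨i, hi⟩, t⟩ | b)
  · by_cases ht : t = (s ^^ i.bodd)
    · have h1 : zigzag n s (.inl (⟨i, hi⟩, t)) = ladderDown ⟨i, hi⟩ t := by simp [zigzag, ht]
      refine ⟨h1 ▸ ladder_adj_down _ _, ?_⟩
      rw [h1]
      rcases i with _ | i
      · rw [ladderDown_zero]
        simp at ht
        simp [zigzag, ht]
      · rw [ladderDown_succ]
        simp [zigzag, ht, ladderUp_of_lt hi]
    · have h1 : zigzag n s (.inl (⟨i, hi⟩, t)) = ladderUp ⟨i, hi⟩ t := by simp [zigzag, ht]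
      refine ⟨h1 ▸ ladder_adj_up _ _, ?_⟩
      rw [h1]
      rw [← ne_eq, bool_ne_iff] at ht
      by_cases h : i + 1 < n + 1
      · rw [ladderUp_of_lt h]
        simp [zigzag, ht]
      · obtain rfl : i = n := by omega
        rw [ladderUp_last]
        simp [zigzag, ht, Fin.last]
  · cases b
    · simp [zigzag, ladder_adj_inr_inl, ladderDown]
    · simp [zigzag, ladder_adj_inr_inl, ladderUp]

/-- The matching of the ladder by its rungs and the edge between the two ends, but with rungs
`j` and `j + 1` replaced with the edges between their ends. -/
def flipPM (n j : ℕ) : (Fin (n + 1) × Bool) ⊕ Bool → (Fin (n + 1) × Bool) ⊕ Bool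
  | .inl (i, t) => if (i : ℕ) = j then ladderUp i t else
      if (i : ℕ) = j + 1 then ladderDown i t else .inl (i, !t)
  | .inr b => .inr !b

/-- Only `j = n` fails, where the last row would be sent to the end vertex. For `j > n` no row is
affected; the value `n + 1` is used later for the matching by all rungs. -/
theorem isPM_flipPM {j : ℕ} (hj : j ≠ n) : (ladder (n + 1)).IsPM (flipPM n j) := by
  rintro (⟨⟨i, hi⟩, t⟩ | b)
  · by_cases h1 : i = j
    · have h : i + 1 < n + 1 := by omega
      have h2 : flipPM n j (.inl (⟨i, hi⟩, t)) = ladderUp ⟨i, hi⟩ t := by simp [flipPM, h1]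
      refine ⟨h2 ▸ ladder_adj_up _ _, ?_⟩
      rw [h2, ladderUp_of_lt h]
      simp [flipPM, h1]
    · by_cases h2 : i = j + 1
      · have h3 : flipPM n j (.inl (⟨i, hi⟩, t)) = ladderDown ⟨i, hi⟩ t := by
          simp [flipPM, h2]
        refine ⟨h3 ▸ ladder_adj_down _ _, ?_⟩
        subst h2
        rw [h3, ladderDown_succ]
        simp [flipPM, ladderUp_of_lt hi]
      · simp [flipPM, h1, h2, ladder_adj_inl_inl]
  · simp [flipPM, ladder_adj_inr_inr]

/-- The spanning subgraph of the ladder with all edges at `(k, s)` and with all other degrees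
equal to one. -/
def ladderTri (n : ℕ) (k : Fin (n + 1)) (s : Bool) :
    (Fin (n + 1) × Bool) ⊕ Bool → (Fin (n + 1) × Bool) ⊕ Bool
  | .inl (i, t) => if i = k then .inl (k, s) else
      if t = (s ^^ ((i : ℕ) + k).bodd) ↔ (i : ℕ) < k then ladderDown i t else ladderUp i t
  | .inr false => .inl (0, s ^^ (k : ℕ).bodd)
  | .inr true => .inl (Fin.last n, s ^^ (n + k).bodd)

/-- Two zigzags, one from each end of the ladder, meet at `(k, s)`, and the rung of row `k` supplies
its third edge. The parity `i + k` makes the neighbours of `(k, s)` on its own side point to it. -/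
theorem isTri_ladderTri (n : ℕ) (k : Fin (n + 1)) (s : Bool) :
    (ladder (n + 1)).IsTri (.inl (k, s)) (ladderTri n k s) := by
  obtain ⟨k, hk⟩ := k
  have hself : ∀ h t, ladderTri n ⟨k, hk⟩ s (.inl (⟨k, h⟩, t)) = .inl (⟨k, hk⟩, s) := by
    simp [ladderTri]
  have hdown : ∀ i hi t, i ≠ k → (t = (s ^^ (i + k).bodd) ↔ i < k) →
      ladderTri n ⟨k, hk⟩ s (.inl (⟨i, hi⟩, t)) = ladderDown ⟨i, hi⟩ t := by
    intro i hi t h1 h2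
    simp only [ladderTri, Fin.mk.injEq, h1, if_false]
    exact if_pos h2
  have hup : ∀ i hi t, i ≠ k → ¬ (t = (s ^^ (i + k).bodd) ↔ i < k) →
      ladderTri n ⟨k, hk⟩ s (.inl (⟨i, hi⟩, t)) = ladderUp ⟨i, hi⟩ t := by
    intro i hi t h1 h2
    simp only [ladderTri, Fin.mk.injEq, h1, if_false]
    exact if_neg h2
  have hparity : ∀ i, (i + 1 + k).bodd = !(i + k).bodd := fun i => by
    rw [show i + 1 + k = i + k + 1 by omega, Nat.bodd_succ]
  rintro (⟨⟨i, hi⟩, t⟩ | b)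
  · refine ⟨fun hadj => ?_, fun hne => ?_⟩
    · by_cases hik : i = k
      · subst hik
        rw [hself]
      · rw [ladder_adj_inl_inl] at hadj
        simp only [Fin.mk.injEq, hik, false_and, false_or] at hadj
        obtain ⟨rfl, h | h⟩ := hadj
        · subst h
          rw [hup i hi t hik, ladderUp_of_lt hk]
          have h2 : (i + (i + 1)).bodd = true := by
            rw [show i + (i + 1) = i + i + 1 by omega]
            simp
          simp [h2]
        · subst h
          have h2 : (k + 1 + k).bodd = true := by
            rw [hparity]
            simp
          rw [hdown _ hi t hik (by simp [h2]), ladderDown_succ]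
    · by_cases hik : i = k
      · subst hik
        rw [hself]
        refine ⟨?_, .inl rfl⟩
        rw [ladder_adj_inl_inl]
        exact .inl ⟨rfl, fun h => hne (by simp at h; rw [h])⟩
      · by_cases hd : t = (s ^^ (i + k).bodd) ↔ i < k
        · rw [hdown i hi t hik hd]
          refine ⟨ladder_adj_down _ _, ?_⟩
          rcases i with _ | i
          · right
            have : t = (s ^^ k.bodd) := by simpa using hd.2 (by omega)
            rw [ladderDown_zero]
            simp [ladderTri, this]
          · rw [ladderDown_succ]
            by_cases hik' : i = k
            · subst hik'
              left
              have h2 : (i + 1 + i).bodd = true := by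
                rw [hparity]
                simp
              have h3 : t = s := by
                rw [h2] at hd
                have : ¬ t = (s ^^ true) := fun h => by
                  have := hd.1 h
                  omega
                revert this
                cases t <;> cases s <;> decide
              rw [h3]
            · right
              rw [hup i _ t hik', ladderUp_of_lt hi]
              rw [hparity] at hd
              have h4 : i + 1 < k ↔ i < k := by omega
              rw [← h4, ← hd]
              cases t <;> cases s <;> cases (i + k).bodd <;> decide
        · rw [hup i hi t hik hd]
          refine ⟨ladder_adj_up _ _, ?_⟩
          by_cases h : i + 1 < n + 1
          · rw [ladderUp_of_lt h]
            by_cases hik' : i + 1 = k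
            · subst hik'
              left
              have h2 : (i + (i + 1)).bodd = true := by
                rw [show i + (i + 1) = i + i + 1 by omega]
                simp
              have h3 : t = s := by
                rw [h2] at hd
                have : ¬ t = (s ^^ true) := fun h => hd (by simp [h])
                revert this
                cases t <;> cases s <;> decide
              rw [h3]
            · right
              rw [hdown (i + 1) _ t hik', ladderDown_succ]
              rw [hparity]
              have h4 : i + 1 < k ↔ i < k := by omega
              rw [h4]
              revert hd
              by_cases hlt : i < k <;> simp only [hlt] <;>
                cases t <;> cases s <;> cases (i + k).bodd <;> decide
          · right
            obtain rfl : i = n := by omega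
            have h4 : ¬ i < k := by omega
            have : t = (s ^^ (i + k).bodd) := by
              by_contra h5
              exact hd (by simp only [h4, iff_false]; exact h5)
            rw [ladderUp_last, ladderTri]
            simp [this, Fin.last]
  · cases b
    · refine ⟨fun hadj => ?_, fun _ => ⟨?_, ?_⟩⟩
      · rw [ladder_adj_inr_inl] at hadj
        simp at hadj
        subst hadj
        simp [ladderTri]
      · simp [ladderTri, ladder_adj_inr_inl]
      · rw [ladderTri]
        by_cases h0 : k = 0
        · subst h0
          left
          simp
        · right
          refine (hdown 0 (by omega) _ (Ne.symm h0) ?_).trans ladderDown_zero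
          simp
          omega
    · refine ⟨fun hadj => ?_, fun _ => ⟨?_, ?_⟩⟩
      · rw [ladder_adj_inr_inl] at hadj
        simp at hadj
        subst hadj
        simp [ladderTri, Fin.last]
      · simp [ladderTri, ladder_adj_inr_inl]
      · rw [ladderTri]
        by_cases h0 : n = k
        · subst h0
          left
          simp [Fin.last]
        · right
          refine (hup n (by omega) _ h0 ?_).trans ladderUp_last
          simp
          omega

/-- The edges joining the end `Sum.inr p.1` of the ladder to the nearest rung. -/
def capEdge (n : ℕ) (p : Bool × Bool) : Sym2 ((Fin (n + 1) × Bool) ⊕ Bool) :=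
  s(.inr p.1, .inl (capRow n p.1, p.2))

theorem capEdge_injective (n : ℕ) : Function.Injective (capEdge n) := by
  rintro ⟨b, s⟩ ⟨c, t⟩ h
  simp only [capEdge, Sym2.eq_iff] at h
  obtain ⟨h1, h2⟩ | ⟨h1, h2⟩ := h
  · simp at h1 h2
    simp [h1, h2]
  · simp at h1

theorem eq_of_mem_lonelySet {V : Type*} {G : SimpleGraph V} {a b : V} (h : s(a, b) ∈ G.lonelySet)
    {f g : V → V} (hf : G.IsPM f) (hg : G.IsPM g) (hfa : f a = b) (hga : g a = b) : f = g :=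
  (mk_mem_lonelySet.1 h).unique ⟨hf, hfa⟩ ⟨hg, hga⟩

theorem adj_of_mem_lonelySet {V : Type*} {G : SimpleGraph V} {a b : V}
    (h : s(a, b) ∈ G.lonelySet) : G.Adj a b := by
  obtain ⟨f, ⟨hf, rfl⟩, -⟩ := mk_mem_lonelySet.1 h
  exact (hf a).1

/-- All other edges lie in two matchings: an edge along a side in a flip and a zigzag, the edge
between the ends in several flips, a rung in the all-rungs matching and a flip that avoids it. No
such flip exists only for the middle one of three rungs. -/
theorem mem_lonelySet_ladder (hn : 2 ≤ n) {e} (he : e ∈ (ladder (n + 1)).lonelySet) :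
    e ∈ Set.range (capEdge n) ∨ n = 2 ∧ e = s(.inl (1, false), .inl (1, true)) := by
  induction e using Sym2.ind with | _ a b =>
  have hne : ∀ j, j + 1 < n + 1 → flipPM n j ≠ flipPM n (n + 1) := by
    intro j hj h
    have := congrFun h (.inl (⟨j, by omega⟩, false))
    simp [flipPM, ladderUp_of_lt hj, show j ≠ n + 1 by omega, show j ≠ n + 2 by omega] at this
  have hne' : ∀ j s, flipPM n j ≠ zigzag n s := by
    intro j s h
    have := congrFun h (.inr false)
    simp [flipPM, zigzag] at this
  have hadj := adj_of_mem_lonelySet he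
  rcases a with ⟨⟨i, hi⟩, t⟩ | c
  · rw [ladder_adj_inl_iff] at hadj
    obtain rfl | rfl | rfl := hadj
    · by_cases h : n = 2 ∧ i = 1
      · obtain ⟨rfl, rfl⟩ := h
        right
        refine ⟨rfl, ?_⟩
        cases t
        · rfl
        · exact Sym2.eq_swap
      · exfalso
        obtain ⟨j, hj, h1, h2⟩ : ∃ j, j + 1 < n + 1 ∧ i ≠ j ∧ i ≠ j + 1 := by
          by_cases h2 : 2 ≤ i
          · exact ⟨0, by omega, by omega, by omega⟩
          · exact ⟨i + 1, by omega, by omega, by omega⟩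
        refine hne j hj (eq_of_mem_lonelySet he (isPM_flipPM (by omega)) (isPM_flipPM (by omega))
          ?_ ?_)
        · simp [flipPM, h1, h2]
        · simp [flipPM, show i ≠ n + 1 by omega, show i ≠ n + 2 by omega]
    · by_cases h : i + 1 < n + 1
      · exfalso
        refine hne' i (!(t ^^ i.bodd)) (eq_of_mem_lonelySet he (isPM_flipPM (by omega))
          (isPM_zigzag _ _) ?_ ?_)
        · simp [flipPM]
        · simp [zigzag]
      · obtain rfl : i = n := by omega
        left
        rw [ladderUp_last, Sym2.eq_swap]
        exact ⟨(true, t), rfl⟩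
    · rcases i with _ | i
      · left
        rw [ladderDown_zero, Sym2.eq_swap]
        exact ⟨(false, t), rfl⟩
      · exfalso
        refine hne' i (t ^^ (i + 1).bodd) (eq_of_mem_lonelySet he (isPM_flipPM (by omega))
          (isPM_zigzag _ _) ?_ ?_)
        · simp [flipPM]
        · simp [zigzag]
  · rw [ladder_adj_inr_iff] at hadj
    obtain rfl | rfl | rfl := hadj
    · exact .inl ⟨(c, false), rfl⟩
    · exact .inl ⟨(c, true), rfl⟩
    · exfalso
      exact hne 0 (by omega) (eq_of_mem_lonelySet he (isPM_flipPM (by omega))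
        (isPM_flipPM (by omega)) rfl rfl)

/-- The matching is forced row by row: once one vertex of a row is matched downwards, the other has
only its upward edge left, which settles a vertex of the next row. -/
theorem eq_zigzag {f} (hf : (ladder (n + 1)).IsPM f) {s : Bool} (h0 : f (.inr false) = .inl (0, s)) :
    f = zigzag n s := by
  have hz := isPM_zigzag n s
  have key : ∀ i (hi : i < n + 1) t,
      f (.inl (⟨i, hi⟩, t)) = zigzag n s (.inl (⟨i, hi⟩, t)) := by
    intro i
    induction i with
    | zero =>
      intro hi t
      by_cases ht : t = s
      · subst ht
        exact (hf.apply_eq_of_apply_eq h0).trans (hz.apply_eq_of_apply_eq rfl).symm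
      · have h1 := ladder_adj_inl_iff.1 (hf (.inl (⟨0, hi⟩, t))).1
        obtain h1 | h1 | h1 := h1
        · have h2 := hf.apply_eq_of_apply_eq h1
          rw [show (!t) = s from (bool_ne_iff.1 (Ne.symm ht)).symm] at h2
          rw [show (⟨0, hi⟩ : Fin (n + 1)) = 0 from rfl, hf.apply_eq_of_apply_eq h0] at h2
          cases h2
        · rw [h1]
          simp [zigzag, ht]
        · have h2 := hf.apply_eq_of_apply_eq h1
          rw [ladderDown_zero, h0] at h2
          simp at h2
          exact absurd h2.symm ht
    | succ i ih =>
      intro hi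
      have hup : f (.inl (⟨i + 1, hi⟩, s ^^ (i + 1).bodd)) =
          .inl (⟨i, by omega⟩, s ^^ (i + 1).bodd) := by
        apply hf.apply_eq_of_apply_eq
        rw [ih]
        simp [zigzag, ladderUp_of_lt hi]
      intro t
      by_cases ht : t = (s ^^ (i + 1).bodd)
      · subst ht
        rw [hup]
        simp [zigzag]
      · have h1 := ladder_adj_inl_iff.1 (hf (.inl (⟨i + 1, hi⟩, t))).1
        obtain h1 | h1 | h1 := h1
        · have h2 := hf.apply_eq_of_apply_eq h1
          rw [← bool_ne_iff.1 (Ne.symm ht), hup] at h2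
          simp at h2
        · simp only [zigzag, h1, ht, if_false]
        · rw [ladderDown_succ] at h1
          have h2 := hf.apply_eq_of_apply_eq h1
          rw [ih] at h2
          have h3 := hz.apply_eq_of_apply_eq h2
          rw [h1, h3]
  funext v
  rcases v with ⟨⟨i, hi⟩, t⟩ | b
  · exact key i hi t
  · cases b
    · exact h0
    · refine hf.apply_eq_of_apply_eq ((key n (by omega) _).trans ?_)
      exact hz.apply_eq_of_apply_eq rfl

theorem capEdge_mem_lonelySet (n : ℕ) (p : Bool × Bool) :
    capEdge n p ∈ (ladder (n + 1)).lonelySet := by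
  have h0 : ∀ s, capEdge n (false, s) ∈ (ladder (n + 1)).lonelySet := fun s =>
    mk_mem_lonelySet.2 ⟨zigzag n s, ⟨isPM_zigzag n s, rfl⟩, fun f hf => eq_zigzag hf.1 hf.2⟩
  obtain ⟨_ | _, s⟩ := p
  · exact h0 s
  · have := mem_lonelySet_map_iso (ladderRev (n + 1)) (h0 s)
    simpa [capEdge, ladderRev, capRow] using this

theorem ncard_range_capEdge (n : ℕ) : (Set.range (capEdge n)).ncard = 4 := by
  rw [← Set.image_univ, Set.ncard_image_of_injective _ (capEdge_injective n), Set.ncard_univ,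
    Nat.card_eq_fintype_card]
  rfl

theorem lonelySet_ladder (hn : 3 ≤ n) : (ladder (n + 1)).lonelySet = Set.range (capEdge n) := by
  ext e
  constructor
  · intro he
    refine (mem_lonelySet_ladder (by omega) he).resolve_right fun h => ?_
    omega
  · rintro ⟨p, rfl⟩
    exact capEdge_mem_lonelySet n p

/-- A ladder with at most three rungs has a rung in exactly one perfect matching. -/
theorem ncard_lonelySet_ladder_ne (hn : n ≤ 2) : (ladder (n + 1)).lonelySet.ncard ≠ 4 := by
  intro h4
  have heq : Set.range (capEdge n) = (ladder (n + 1)).lonelySet := by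
    refine Set.eq_of_subset_of_ncard_le ?_ (by rw [h4, ncard_range_capEdge]) (Set.toFinite _)
    rintro _ ⟨p, rfl⟩
    exact capEdge_mem_lonelySet n p
  -- With at most three rungs, every other row has only row `r` and an end vertex as neighbouring
  -- rows. A matching with rung `r` is not a zigzag, so it joins the two ends, and all other rungs
  -- are forced. This rung is a lonely edge beyond the four at the ends.
  let r : Fin (n + 1) := ⟨n / 2, by omega⟩
  have hmem : s(.inl (r, false), .inl (r, true)) ∈ (ladder (n + 1)).lonelySet := by
    rw [mk_mem_lonelySet]
    refine ⟨flipPM n (n + 1), ⟨isPM_flipPM (by omega), ?_⟩, fun f ⟨hf, hfr⟩ => ?_⟩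
    · simp [flipPM, r, show n / 2 ≠ n + 1 by omega, show n / 2 ≠ n + 2 by omega]
    · have hr : ∀ s, f (.inl (r, s)) = .inl (r, !s) := by
        intro s
        cases s
        · exact hfr
        · exact hf.apply_eq_of_apply_eq hfr
      have hcap : ∀ b, f (.inr b) = .inr !b := by
        have h0 : f (.inr false) = .inr true := by
          have hz : ∀ s, f (.inr false) ≠ .inl (0, s) := by
            intro s h0
            rw [eq_zigzag hf h0] at hfr
            simp only [zigzag] at hfr
            split_ifs at hfr
            · have := inl_eq_ladderDown_iff.1 hfr.symm
              simp at this
            · have := inl_eq_ladderUp_iff.1 hfr.symm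
              simp at this
          obtain h | h | h := ladder_adj_inr_iff.1 (hf (.inr false)).1
          · exact absurd h (hz _)
          · exact absurd h (hz _)
          · exact h
        intro b
        cases b
        · exact h0
        · exact hf.apply_eq_of_apply_eq h0
      funext v
      rcases v with ⟨i, t⟩ | b
      · have h1 : flipPM n (n + 1) (.inl (i, t)) = .inl (i, !t) := by
          have := i.2
          simp [flipPM, show (i : ℕ) ≠ n + 1 by omega, show (i : ℕ) ≠ n + 2 by omega]
        rw [h1]
        by_cases hir : i = r
        · rw [hir, hr]
        · have hir' : (i : ℕ) ≠ n / 2 := fun h => hir (Fin.ext h)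
          have hi := i.2
          have hbad : ∀ w, (∃ s, w = .inl (r, s)) ∨ (∃ b, w = .inr b) →
              f (.inl (i, t)) ≠ w := by
            rintro w (⟨s, rfl⟩ | ⟨b, rfl⟩) h
            · have := hf.apply_eq_of_apply_eq h
              rw [hr] at this
              simp at this
              exact hir this.1.symm
            · have := hf.apply_eq_of_apply_eq h
              rw [hcap] at this
              cases this
          obtain h | h | h := ladder_adj_inl_iff.1 (hf (.inl (i, t))).1
          · exact h
          · refine absurd h (hbad _ ?_)
            rcases hw : ladderUp i t with ⟨j, s⟩ | b
            · have := inl_eq_ladderUp_iff.1 hw.symm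
              have hj := j.2
              exact .inl ⟨s, by rw [show j = r from Fin.ext (by simp only [r]; omega)]⟩
            · exact .inr ⟨b, rfl⟩
          · refine absurd h (hbad _ ?_)
            rcases hw : ladderDown i t with ⟨j, s⟩ | b
            · have := inl_eq_ladderDown_iff.1 hw.symm
              have hj := j.2
              exact .inl ⟨s, by rw [show j = r from Fin.ext (by simp only [r]; omega)]⟩
            · exact .inr ⟨b, rfl⟩
      · exact hcap b
  rw [← heq] at hmem
  obtain ⟨p, hp⟩ := hmem
  simp [capEdge] at hp

end ladder

/-! ### The exceptional graph `prism31` -/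

instance {V : Type*} [DecidableEq V] (G : SimpleGraph V) [DecidableRel G.Adj] (x : V)
    (n : Fin 3 → V) : DecidableRel (G.blow x n).Adj
  | .inl a, .inl b => inferInstanceAs (Decidable (G.Adj a b))
  | .inl a, .inr j => inferInstanceAs (Decidable ((a : V) = n j))
  | .inr j, .inl a => inferInstanceAs (Decidable ((a : V) = n j))
  | .inr i, .inr j => inferInstanceAs (Decidable (i ≠ j))

/-- The edges of `prism31`. -/
def prism31Edges : List (Fin 10 × Fin 10) :=
  [(0, 1), (0, 2), (1, 2), (1, 3), (2, 4), (3, 4), (4, 5), (5, 6), (0, 6), (7, 8), (8, 9), (7, 9),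
    (7, 3), (8, 5), (9, 6)]

/-- A concrete form of the extended prism with extension pattern $(3, 1)$. -/
def prism31 : SimpleGraph (Fin 10) where
  Adj a b := (a, b) ∈ prism31Edges ∨ (b, a) ∈ prism31Edges
  symm := ⟨fun _ _ h => h.symm⟩
  loopless := ⟨by decide⟩

instance : DecidableRel prism31.Adj := fun a b =>
  inferInstanceAs (Decidable ((a, b) ∈ prism31Edges ∨ (b, a) ∈ prism31Edges))

/-- The perfect matchings of `prism31`. -/
def prism31PM : Fin 6 → Fin 10 → Fin 10 :=
  ![![1, 0, 4, 7, 2, 6, 5, 3, 9, 8], ![1, 0, 4, 7, 2, 8, 9, 3, 5, 6],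
    ![2, 3, 0, 1, 5, 4, 9, 8, 7, 6], ![6, 2, 1, 4, 3, 8, 0, 9, 5, 7],
    ![6, 2, 1, 7, 5, 4, 0, 3, 9, 8], ![6, 3, 4, 1, 2, 8, 0, 9, 5, 7]]

theorem isPM_prism31PM : ∀ i, prism31.IsPM (prism31PM i) := by
  unfold IsPM
  decide

/-- For every vertex `x` of `prism31`, a spanning subgraph with all edges at `x`, all other
degrees equal to one, and an edge in exactly one perfect matching that is not at `x`. -/
def prism31Tri : Fin 10 → Fin 10 → Fin 10 :=
  ![![0, 0, 0, 4, 3, 8, 0, 9, 5, 7], ![1, 1, 1, 1, 5, 4, 9, 8, 7, 6],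
    ![2, 2, 2, 7, 2, 6, 5, 3, 9, 8], ![2, 3, 0, 3, 3, 6, 5, 3, 9, 8],
    ![1, 0, 4, 4, 4, 4, 9, 8, 7, 6], ![2, 3, 0, 1, 5, 5, 5, 9, 5, 7],
    ![6, 2, 1, 4, 3, 6, 6, 8, 7, 6], ![1, 0, 4, 7, 2, 6, 5, 7, 7, 7],
    ![6, 2, 1, 4, 3, 8, 0, 8, 8, 8], ![2, 3, 0, 1, 5, 4, 9, 9, 9, 9]]

theorem isTri_prism31Tri : ∀ x, prism31.IsTri x (prism31Tri x) := by
  unfold IsTri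
  decide

/-- The edges of `prism31` in exactly one perfect matching. -/
def prism31Lonely : Finset (Sym2 (Fin 10)) := {s(0, 2), s(3, 4), s(5, 6), s(7, 8)}

/-- Each remaining edge lies in two of the listed matchings; completeness of the list is not needed
for this. -/
theorem lonelySet_prism31_subset : prism31.lonelySet ⊆ prism31Lonely := by
  intro e he
  induction e using Sym2.ind with | _ a b =>
  have hadj := adj_of_mem_lonelySet he
  have key : ∀ a b, prism31.Adj a b → s(a, b) ∈ prism31Lonely ∨
      ∃ i j, prism31PM i a = b ∧ prism31PM j a = b ∧ prism31PM i ≠ prism31PM j := by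
    decide
  obtain h | ⟨i, j, hi, hj, hij⟩ := key a b hadj
  · exact h
  · exact absurd (eq_of_mem_lonelySet he (isPM_prism31PM i) (isPM_prism31PM j) hi hj) hij

/-- Each subgraph `prism31Tri x` contains one of the four candidate lonely edges away from `x`, and
that edge is lost. -/
theorem ncard_lonelySet_blow_prism31_lt (hG : prism31.MatchingRich) {x : Fin 10}
    {n : Fin 3 → Fin 10} (h : prism31.IsNbrLabeling x n) :
    (prism31.blow x n).lonelySet.ncard < 4 := by
  have key : ∀ x, ∃ a, a ≠ x ∧ prism31Tri x a ≠ x ∧ s(a, prism31Tri x a) ∈ prism31Lonely := by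
    decide
  obtain ⟨a, h1, h2, h3⟩ := key x
  have hle := ncard_lonelySet_blow_le h hG {s(a, prism31Tri x a)} (by
    rintro e rfl
    exact ⟨_, isTri_prism31Tri x, a, h1, h2, rfl⟩)
  refine hle.trans_lt ?_
  calc _ ≤ ((prism31Lonely.erase s(a, prism31Tri x a) : Finset _) : Set (Sym2 (Fin 10))).ncard := by
        refine Set.ncard_le_ncard ?_ (Set.toFinite _)
        rw [Finset.coe_erase]
        exact Set.sdiff_subset_sdiff_left lonelySet_prism31_subset
    _ < 4 := by
        rw [Set.ncard_coe_finset, Finset.card_erase_of_mem h3]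
        decide

/-- Fixing the partner along any of the four edges determines the whole matching by propagation
through the neighbour lists. The edges `s(0, 2)` and `s(7, 8)` share their matching. -/
theorem prism31Lonely_subset_lonelySet : ↑prism31Lonely ⊆ prism31.lonelySet := by
  have nb : ∀ v w, prism31.Adj v w → w ∈ (![[1, 2, 6], [0, 2, 3], [0, 1, 4], [1, 4, 7], [2, 3, 5],
      [4, 6, 8], [5, 0, 9], [8, 9, 3], [7, 9, 5], [7, 8, 6]] : Fin 10 → List (Fin 10)) v := by
    decide
  have key : ∀ f, prism31.IsPM f → (f 0 = 2 → f = prism31PM 2) ∧ (f 3 = 4 → f = prism31PM 3) ∧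
      (f 5 = 6 → f = prism31PM 0) ∧ (f 7 = 8 → f = prism31PM 2) := by
    intro f hf
    have hinv : ∀ v w, f v = w → f w = v := fun v w => hf.apply_eq_of_apply_eq
    have h0 := nb 0 _ (hf 0).1
    have h1 := nb 1 _ (hf 1).1
    have h2 := nb 2 _ (hf 2).1
    have h3 := nb 3 _ (hf 3).1
    have h4 := nb 4 _ (hf 4).1
    have h5 := nb 5 _ (hf 5).1
    have h6 := nb 6 _ (hf 6).1
    have h7 := nb 7 _ (hf 7).1
    have h8 := nb 8 _ (hf 8).1
    have h9 := nb 9 _ (hf 9).1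
    simp only [Matrix.cons_val, List.mem_cons, List.not_mem_nil, or_false]
      at h0 h1 h2 h3 h4 h5 h6 h7 h8 h9
    have hfun : ∀ g : Fin 10 → Fin 10, f 0 = g 0 → f 1 = g 1 → f 2 = g 2 → f 3 = g 3 →
        f 4 = g 4 → f 5 = g 5 → f 6 = g 6 → f 7 = g 7 → f 8 = g 8 → f 9 = g 9 → f = g := by
      intro g _ _ _ _ _ _ _ _ _ _
      funext v
      fin_cases v <;> assumption
    refine ⟨fun h => ?_, fun h => ?_, fun h => ?_, fun h => ?_⟩
    · apply hfun <;> simp only [prism31PM, Matrix.cons_val] <;> grind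
    · apply hfun <;> simp only [prism31PM, Matrix.cons_val] <;> grind
    · apply hfun <;> simp only [prism31PM, Matrix.cons_val] <;> grind
    · apply hfun <;> simp only [prism31PM, Matrix.cons_val] <;> grind
  intro e he
  have he' : e = s(0, 2) ∨ e = s(3, 4) ∨ e = s(5, 6) ∨ e = s(7, 8) := by
    simpa [prism31Lonely] using he
  obtain rfl | rfl | rfl | rfl := he'
  · exact mk_mem_lonelySet.2 ⟨_, ⟨isPM_prism31PM 2, rfl⟩, fun f hf => (key f hf.1).1 hf.2⟩
  · exact mk_mem_lonelySet.2 ⟨_, ⟨isPM_prism31PM 3, rfl⟩, fun f hf => (key f hf.1).2.1 hf.2⟩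
  · exact mk_mem_lonelySet.2 ⟨_, ⟨isPM_prism31PM 0, rfl⟩, fun f hf => (key f hf.1).2.2.1 hf.2⟩
  · exact mk_mem_lonelySet.2 ⟨_, ⟨isPM_prism31PM 2, rfl⟩, fun f hf => (key f hf.1).2.2.2 hf.2⟩

theorem encard_lonelySet_prism31 : prism31.lonelySet.encard = 4 := by
  rw [lonelySet_prism31_subset.antisymm prism31Lonely_subset_lonelySet, Set.encard_coe_eq_coe_finsetCard]
  decide

/-- The isomorphism of `nonempty_blow_ladder_iso_prism31` on vertices. -/
def blowLadderPrism31 : {a : (Fin 3 × Bool) ⊕ Bool // a ≠ .inl (2, false)} ⊕ Fin 3 → Fin 10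
  -- The last entry of `![1, 3, 0]` is a dummy, since `(2, false)` is the replaced vertex.
  | .inl ⟨.inl (i, s), _⟩ => if s then ![2, 4, 5] i else ![1, 3, 0] i
  | .inl ⟨.inr b, _⟩ => if b then 6 else 0
  | .inr j => ![7, 8, 9] j

set_option synthInstance.maxSize 1000 in
/-- The extension of the third ladder yields `prism31`. -/
theorem nonempty_blow_ladder_iso_prism31 :
    Nonempty ((ladder 3).blow (.inl (2, false)) ![.inl (1, false), .inl (2, true), .inr true] ≃g
      prism31) := by
  have hF : ∀ a b, blowLadderPrism31 a = blowLadderPrism31 b → a = b := by decide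
  refine ⟨⟨Equiv.ofBijective _ ((Fintype.bijective_iff_injective_and_card _).2
    ⟨fun a b => hF a b, by decide⟩), ?_⟩⟩
  have : ∀ a b, prism31.Adj (blowLadderPrism31 a) (blowLadderPrism31 b) ↔
      ((ladder 3).blow (.inl (2, false)) ![.inl (1, false), .inl (2, true), .inr true]).Adj a b := by
    decide
  intro a b
  exact this a b

-- Replacements that keep four lonely edges, and the inductive classification

universe u

/-- The list of graphs in the classification: the ladders and `prism31`. -/
def IsLadderOrPrism31 {V : Type*} (G : SimpleGraph V) : Prop :=
  (∃ n, Nonempty (G ≃g ladder (n + 1))) ∨ Nonempty (G ≃g prism31)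

section children

variable {n : ℕ}

theorem nonempty_blow_ladder_iso {x : (Fin (n + 1) × Bool) ⊕ Bool}
    {m : Fin 3 → (Fin (n + 1) × Bool) ⊕ Bool} (h : (ladder (n + 1)).IsNbrLabeling x m)
    (φ : ladder (n + 1) ≃g ladder (n + 1)) (hφ : φ x = .inr true) :
    Nonempty ((ladder (n + 1)).blow x m ≃g ladder (n + 2)) := by
  obtain ⟨ψ⟩ := nonempty_blow_iso φ h
    (m := ![.inl (capRow n true, false), .inl (capRow n true, true), .inr (!true)])
    (by rw [hφ]; exact isNbrLabeling_ladder_inr true)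
  rw [hφ] at ψ
  exact ⟨ψ.trans (blowLadderIso n)⟩

theorem exists_ladder_one_iso (x : (Fin 1 × Bool) ⊕ Bool) :
    ∃ φ : ladder 1 ≃g ladder 1, φ x = .inr true := by
  have hadj : ∀ a b, (ladder 1).Adj a b ↔ a ≠ b := by decide
  refine ⟨⟨Equiv.swap x (.inr true), ?_⟩, Equiv.swap_apply_left _ _⟩
  intro a b
  rw [hadj, hadj, (Equiv.injective _).ne_iff]

/-- This ladder is the prism, with one triangle formed by each rung and its end vertex. Vertices
with the same role in both triangles can be exchanged simultaneously. -/
theorem exists_ladder_two_iso (x : (Fin 2 × Bool) ⊕ Bool) :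
    ∃ φ : ladder 2 ≃g ladder 2, φ x = .inr true := by
  have key : ∀ s : Bool, ∃ φ : ladder 2 ≃g ladder 2, φ (.inl (1, s)) = .inr true := by
    intro s
    have hadj : ∀ s a b, (ladder 2).Adj
        (((Equiv.swap (.inl (1, s)) (.inr true)).trans (Equiv.swap (.inl (0, s)) (.inr false))) a)
        (((Equiv.swap (.inl (1, s)) (.inr true)).trans (Equiv.swap (.inl (0, s)) (.inr false))) b)
        ↔ (ladder 2).Adj a b := by decide
    exact ⟨⟨_, fun {a b} => hadj s a b⟩, by cases s <;> rfl⟩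
  rcases x with ⟨i, s⟩ | b
  · fin_cases i
    · obtain ⟨φ, hφ⟩ := key s
      exact ⟨(ladderRev 2).trans φ, hφ⟩
    · exact key s
  · cases b
    · exact ⟨ladderRev 2, rfl⟩
    · exact ⟨Iso.refl, rfl⟩

theorem nonempty_blow_ladder_three_iso {x : (Fin 3 × Bool) ⊕ Bool}
    {m : Fin 3 → (Fin 3 × Bool) ⊕ Bool} (h : (ladder 3).IsNbrLabeling x m)
    (φ : ladder 3 ≃g ladder 3) (hφ : φ x = .inl (2, false)) :
    Nonempty ((ladder 3).blow x m ≃g prism31) := by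
  obtain ⟨ψ⟩ := nonempty_blow_iso φ h (m := ![.inl (1, false), .inl (2, true), .inr true]) (by
    rw [hφ]
    unfold IsNbrLabeling Function.Injective
    decide)
  rw [hφ] at ψ
  exact nonempty_blow_ladder_iso_prism31.map ψ.trans

theorem ladderTri_inr (k : Fin (n + 1)) (s b : Bool) :
    ∃ t, ladderTri n k s (.inr b) = .inl (capRow n b, t) := by
  cases b
  · exact ⟨_, rfl⟩
  · exact ⟨_, rfl⟩

/-- Replacing a vertex of a rung that is not next to `Sum.inr b` with a triangle destroys an edge
at `Sum.inr b` in exactly one perfect matching. -/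
theorem exists_isTri_capEdge {k : Fin (n + 1)} (s : Bool) {b : Bool} (hb : k ≠ capRow n b) :
    ∃ t, ∃ f, (ladder (n + 1)).IsTri (.inl (k, s)) f ∧ ∃ a, a ≠ .inl (k, s) ∧ f a ≠ .inl (k, s) ∧
      capEdge n (b, t) = s(a, f a) := by
  obtain ⟨t, ht⟩ := ladderTri_inr k s b
  refine ⟨t, _, isTri_ladderTri n k s, .inr b, by simp, ?_, ?_⟩
  · rw [ht]
    intro h
    simp at h
    exact hb h.1.symm
  · rw [ht]
    rfl

theorem ncard_range_capEdge_diff {B : Set (Sym2 ((Fin (n + 1) × Bool) ⊕ Bool))}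
    (hB : B ⊆ Set.range (capEdge n)) : (Set.range (capEdge n) \ B).ncard + B.ncard = 4 := by
  rw [Set.ncard_sdiff_add_ncard_of_subset hB, ncard_range_capEdge]

/-- A rung vertex is away from at least one end, and an edge at that end is lost from the four
lonely ones. -/
theorem ncard_lonelySet_blow_ladder_lt (hn : 3 ≤ n) (hr : (ladder (n + 1)).MatchingRich)
    {k : Fin (n + 1)} {s : Bool} {m : Fin 3 → (Fin (n + 1) × Bool) ⊕ Bool}
    (h : (ladder (n + 1)).IsNbrLabeling (.inl (k, s)) m) :
    ((ladder (n + 1)).blow (.inl (k, s)) m).lonelySet.ncard < 4 := by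
  obtain ⟨b, hb⟩ : ∃ b, k ≠ capRow n b := by
    by_cases h0 : k = 0
    · refine ⟨true, fun h1 => ?_⟩
      rw [h0] at h1
      have := congrArg Fin.val h1
      simp [capRow] at this
      omega
    · exact ⟨false, h0⟩
  obtain ⟨t, ht⟩ := exists_isTri_capEdge s hb
  have h1 := ncard_lonelySet_blow_le h hr {capEdge n (b, t)} (by rintro e rfl; exact ht)
  have h2 := ncard_range_capEdge_diff (n := n) (B := {capEdge n (b, t)}) (by simp)
  rw [Set.ncard_singleton] at h2
  rw [lonelySet_ladder hn] at h1
  omega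

/-- There are at most five lonely edges, the four at the ends and the middle rung. A vertex of the
middle rung is next to neither end, so an edge is lost at both. -/
theorem ncard_lonelySet_blow_ladder_three_lt (hr : (ladder 3).MatchingRich)
    {s : Bool} {m : Fin 3 → (Fin 3 × Bool) ⊕ Bool}
    (h : (ladder 3).IsNbrLabeling (.inl (1, s)) m) :
    ((ladder 3).blow (.inl (1, s)) m).lonelySet.ncard < 4 := by
  have key : ∀ b, (1 : Fin (2 + 1)) ≠ capRow 2 b := by decide
  obtain ⟨t, ht⟩ := exists_isTri_capEdge s (key false)
  obtain ⟨t', ht'⟩ := exists_isTri_capEdge s (key true)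
  let B : Set (Sym2 ((Fin (2 + 1) × Bool) ⊕ Bool)) := {capEdge 2 (false, t), capEdge 2 (true, t')}
  have h1 := ncard_lonelySet_blow_le h hr B (by
    rintro e (rfl | rfl)
    · exact ht
    · exact ht')
  have h2 := ncard_range_capEdge_diff (n := 2) (B := B) (by
    rintro e (rfl | rfl)
    · exact ⟨_, rfl⟩
    · exact ⟨_, rfl⟩)
  have h3 : B.ncard = 2 := Set.ncard_pair ((capEdge_injective 2).ne (by simp))
  have h4 : ((ladder 3).lonelySet \ B).ncard ≤ (insert s(.inl (1, false), .inl (1, true))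
      (Set.range (capEdge 2) \ B)).ncard := by
    refine Set.ncard_le_ncard ?_ (Set.toFinite _)
    rintro e ⟨he, heB⟩
    obtain h5 | ⟨-, rfl⟩ := mem_lonelySet_ladder (n := 2) le_rfl he
    · exact .inr ⟨h5, heB⟩
    · exact .inl rfl
  have h5 := Set.ncard_insert_le (s(.inl (1, false), .inl (1, true)) : Sym2 _)
    (Set.range (capEdge 2) \ B)
  omega

theorem isLadderOrPrism31_blow_ladder (hr : (ladder (n + 1)).MatchingRich)
    {x : (Fin (n + 1) × Bool) ⊕ Bool} {m : Fin 3 → (Fin (n + 1) × Bool) ⊕ Bool}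
    (h : (ladder (n + 1)).IsNbrLabeling x m)
    (h4 : 4 ≤ ((ladder (n + 1)).blow x m).lonelySet.ncard) :
    ((ladder (n + 1)).blow x m).IsLadderOrPrism31 := by
  rcases x with ⟨i, s⟩ | b
  · match n with
    | 0 =>
      obtain ⟨φ, hφ⟩ := exists_ladder_one_iso (.inl (i, s))
      exact .inl ⟨_, nonempty_blow_ladder_iso h φ hφ⟩
    | 1 =>
      obtain ⟨φ, hφ⟩ := exists_ladder_two_iso (.inl (i, s))
      exact .inl ⟨_, nonempty_blow_ladder_iso h φ hφ⟩
    | 2 =>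
      right
      match i, s with
      | 0, false => exact nonempty_blow_ladder_three_iso h (ladderRev 3) rfl
      | 0, true => exact nonempty_blow_ladder_three_iso h ((ladderRev 3).trans (ladderFlip 3)) rfl
      | 1, s => exact absurd h4 (ncard_lonelySet_blow_ladder_three_lt hr h).not_ge
      | 2, false => exact nonempty_blow_ladder_three_iso h Iso.refl rfl
      | 2, true => exact nonempty_blow_ladder_three_iso h (ladderFlip 3) rfl
    | n + 3 => exact absurd h4 (ncard_lonelySet_blow_ladder_lt (by omega) hr h).not_ge
  · cases b
    · exact .inl ⟨_, nonempty_blow_ladder_iso h (ladderRev _) rfl⟩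
    · exact .inl ⟨_, nonempty_blow_ladder_iso h Iso.refl rfl⟩

end children

theorem matchingRich_ladder_one : (ladder 1).MatchingRich := by
  have hadj : ∀ a b, (ladder 1).Adj a b ↔ a ≠ b := by decide
  refine ⟨fun a b hab => ?_, fun a => ⟨fun _ => a, fun v => ?_⟩⟩
  · have key : ∀ a b, a ≠ b → zigzag 0 false a = b ∨ zigzag 0 true a = b ∨ flipPM 0 1 a = b := by
      decide
    obtain h | h | h := key a b hab.ne
    · exact ⟨_, isPM_zigzag 0 false, h⟩
    · exact ⟨_, isPM_zigzag 0 true, h⟩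
    · exact ⟨_, isPM_flipPM (by decide), h⟩
  · simp [hadj]

theorem Cubic.four_le_card {V : Type*} [Fintype V] [DecidableEq V] {G : SimpleGraph V}
    (hG : G.Cubic) (v : V) : 4 ≤ Fintype.card V := by
  obtain ⟨n, hn, h⟩ := hG v
  have h1 : v ∉ Finset.univ.image n := by
    simp only [Finset.mem_image, Finset.mem_univ, true_and, not_exists]
    exact fun i hi => ((h (n i)).2 ⟨i, rfl⟩).ne hi.symm
  have h2 := Finset.card_le_univ (insert v (Finset.univ.image n))
  rw [Finset.card_insert_of_notMem h1, Finset.card_image_of_injective _ hn] at h2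
  simpa using h2

theorem Cubic.nonempty_iso_ladder_one {V : Type*} [Fintype V] [DecidableEq V] {G : SimpleGraph V}
    (hG : G.Cubic) (hcard : Fintype.card V = 4) : Nonempty (G ≃g ladder 1) := by
  have hadj : ∀ a b, (ladder 1).Adj a b ↔ a ≠ b := by decide
  have hG' : ∀ a b, G.Adj a b ↔ a ≠ b := by
    refine fun a b => ⟨fun h => h.ne, fun hne => ?_⟩
    obtain ⟨n, hn, h⟩ := hG a
    have h1 : a ∉ Finset.univ.image n := by
      simp only [Finset.mem_image, Finset.mem_univ, true_and, not_exists]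
      exact fun i hi => ((h (n i)).2 ⟨i, rfl⟩).ne hi.symm
    have h2 : insert a (Finset.univ.image n) = Finset.univ := by
      rw [← Finset.card_eq_iff_eq_univ, Finset.card_insert_of_notMem h1,
        Finset.card_image_of_injective _ hn, hcard]
      rfl
    have h3 := Finset.mem_univ b
    rw [← h2, Finset.mem_insert, Finset.mem_image] at h3
    obtain ⟨i, -, rfl⟩ := h3.resolve_left hne.symm
    exact (h _).2 ⟨i, rfl⟩
  let e : V ≃ (Fin 1 × Bool) ⊕ Bool := Fintype.equivOfCardEq (by rw [hcard]; rfl)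
  refine ⟨⟨e, ?_⟩⟩
  intro a b
  rw [hadj, hG', e.injective.ne_iff]

/-- Induction on the order by contracting a triangle. The bound is `4 ≤` because contraction may
increase the number of lonely edges. `MatchingRich` is carried along without that bound, as the
monotonicity needed to pass the bound to the contraction depends on it. -/
theorem isLadderOrPrism31_of_four_le {N : ℕ} : ∀ {V : Type u} [Fintype V] [DecidableEq V]
    {G : SimpleGraph V}, Fintype.card V = N → G.Cubic → G.CutsGeThree → G.lonelySet.Nonempty →
    G.MatchingRich ∧ (4 ≤ G.lonelySet.ncard → G.IsLadderOrPrism31) := by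
  induction N using Nat.strong_induction_on with | _ N ih =>
  intro V _ _ G hN hG h3 hl
  by_cases hcard : 4 < Fintype.card V
  · obtain ⟨t, m, n, hn, hG0, h30, hl0, ⟨ψ⟩, hlt⟩ := exists_iso_blow hG h3 hcard hl
    obtain ⟨hr, hlist⟩ := ih _ (hN ▸ hlt) rfl hG0 h30 hl0
    refine ⟨(hr.blow hn).map_iso ψ, fun h4 => ?_⟩
    rw [← ncard_lonelySet_eq ψ] at h4
    have h4' : 4 ≤ (G.contract t m).lonelySet.ncard := by
      have := ncard_lonelySet_blow_le hn hr ∅ (by simp)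
      rw [Set.sdiff_empty] at this
      exact h4.trans this
    -- This moves the replacement from the contraction to the concrete graph `H`, so that the
    -- explicit results for ladders and `prism31` apply.
    have key : ∀ {W : Type} {H : SimpleGraph W} (φ : G.contract t m ≃g H),
        ∃ k, H.IsNbrLabeling (φ none) k ∧ H.MatchingRich ∧
          4 ≤ (H.blow (φ none) k).lonelySet.ncard ∧ Nonempty (G ≃g H.blow (φ none) k) := by
      intro W H φ
      obtain ⟨χ⟩ := nonempty_blow_iso φ hn (hn.map_iso φ)
      refine ⟨_, hn.map_iso φ, hr.map_iso φ, ?_, ⟨ψ.symm.trans χ⟩⟩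
      rwa [← ncard_lonelySet_eq χ]
    obtain ⟨j, ⟨φ⟩⟩ | ⟨⟨φ⟩⟩ := hlist h4'
    · obtain ⟨k, hk, hrk, h4k, ⟨χ⟩⟩ := key φ
      exact (isLadderOrPrism31_blow_ladder hrk hk h4k).imp
        (fun ⟨i, hi⟩ => ⟨i, hi.map χ.trans⟩) fun hi => hi.map χ.trans
    · obtain ⟨k, hk, hrk, h4k, -⟩ := key φ
      exact absurd h4k (ncard_lonelySet_blow_prism31_lt hrk hk).not_ge
  · obtain ⟨e, -⟩ := hl
    induction e using Sym2.ind with | _ v w =>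
    obtain ⟨φ⟩ := hG.nonempty_iso_ladder_one (by have := hG.four_le_card v; omega)
    exact ⟨matchingRich_ladder_one.map_iso φ.symm, fun _ => .inl ⟨0, ⟨φ⟩⟩⟩

theorem cutsGeThree_ladder_one : (ladder 1).CutsGeThree := by
  have hadj : ∀ a b, (ladder 1).Adj a b ↔ a ≠ b := by decide
  intro X hX hX'
  have h1 : (ladder 1).edgeCount X Xᶜ = X.card * Xᶜ.card := by
    rw [edgeCount_eq_card, ← Finset.card_product, Finset.filter_true_of_mem]
    rintro ⟨a, b⟩ hab
    rw [Finset.mem_product, Finset.mem_compl] at hab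
    exact (hadj a b).2 fun h => hab.2 (h ▸ hab.1)
  have h2 : X.card + Xᶜ.card = 4 := Finset.card_add_card_compl X
  have h3 : 0 < X.card := hX.card_pos
  have h4 : 0 < Xᶜ.card := Finset.card_pos.2 (by
    rwa [Finset.nonempty_iff_ne_empty, Ne, Finset.compl_eq_empty_iff])
  rw [h1]
  have : X.card ≤ 3 := by omega
  interval_cases X.card <;> omega

theorem cutsGeThree_ladder (n : ℕ) : (ladder (n + 1)).CutsGeThree := by
  induction n with
  | zero => exact cutsGeThree_ladder_one
  | succ n ih =>
    exact (ih.blow (cubic_ladder n) (isNbrLabeling_ladder_inr true)).map_iso (blowLadderIso n)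

theorem isNbrLabeling_ladder_three : (ladder 3).IsNbrLabeling (.inl (2, false))
    ![.inl (1, false), .inl (2, true), .inr true] := by
  unfold IsNbrLabeling Function.Injective
  decide

theorem cubic_prism31 : prism31.Cubic :=
  nonempty_blow_ladder_iso_prism31.elim ((cubic_ladder 2).blow isNbrLabeling_ladder_three).map_iso

theorem cutsGeThree_prism31 : prism31.CutsGeThree :=
  nonempty_blow_ladder_iso_prism31.elim
    ((cutsGeThree_ladder 2).blow (cubic_ladder 2) isNbrLabeling_ladder_three).map_iso

end SimpleGraph

/-! ### Extended prisms as ladders and `prism31` -/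

namespace TriangleGraph

/-- Only the two neighbours of `T.x s` in the triangle need to match the labelling `m`; its third
neighbour is then `m s`. -/
theorem exists_extend_iso {T : TriangleGraph} {s : Fin 3} {W : Type} {H : SimpleGraph W}
    (φ : T.graph ≃g H) {y : W} {m : Fin 3 → W} (hy : φ (T.x s) = y) (hm : H.IsNbrLabeling y m)
    (h : ∀ j, j ≠ s → φ (T.x j) = m j) :
    ∃ ψ : (T.extend s).graph ≃g H.blow y m, ∀ j, ψ ((T.extend s).x j) = .inr j := by
  subst hy
  have key : ∀ (a : {a // a ≠ T.x s}) (j : Fin 3), φ a = m j ↔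
      ((j ≠ s ∧ (a : T.V) = T.x j) ∨ (j = s ∧ T.graph.Adj a (T.x s) ∧ ∀ i, (a : T.V) ≠ T.x i)) := by
    intro a j
    by_cases hj : j = s
    · subst hj
      simp only [ne_eq, not_true_eq_false, false_and, true_and, false_or]
      constructor
      · intro ha
        refine ⟨φ.map_adj_iff.1 (((hm.2 _).2 ⟨j, ha⟩).symm), fun i hi => ?_⟩
        by_cases hij : i = j
        · exact a.2 (by rw [hi, hij])
        · rw [hi, h i hij] at ha
          exact hij (hm.1 ha)
      · rintro ⟨h1, h2⟩
        obtain ⟨i, hi⟩ := (hm.2 _).1 (φ.map_adj_iff.2 h1.symm)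
        by_cases hij : i = j
        · rw [hi, hij]
        · rw [← h i hij] at hi
          exact absurd (φ.injective hi) (h2 i)
    · simp [hj, ← h j hj, φ.injective.eq_iff]
  refine ⟨⟨Equiv.sumCongr (φ.toEquiv.subtypeEquiv fun a => by simp) (Equiv.refl _), ?_⟩,
    fun _ => rfl⟩
  rintro (a | i) (b | j)
  · exact φ.map_adj_iff
  · exact key a j
  · exact key b i
  · exact Iff.rfl

open SimpleGraph in
/-- The labelled triangle of `T` is the last one of a ladder. -/
def IsoLadder (T : TriangleGraph) (n : ℕ) : Prop :=
  ∃ φ : T.graph ≃g ladder (n + 1),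
    φ (T.x 0) = .inl (Fin.last n, false) ∧ φ (T.x 1) = .inl (Fin.last n, true) ∧
    φ (T.x 2) = .inr true

open SimpleGraph

theorem isoLadder_prism : prism.IsoLadder 1 := by
  let e : Fin 3 × Fin 2 → (Fin 2 × Bool) ⊕ Bool := fun p =>
    if p.1 = 2 then .inr (p.2 = 1) else .inl (p.2, p.1 = 1)
  have he : ∀ a b, e a = e b → a = b := by decide
  have hadj : ∀ a b : Fin 3 × Fin 2, (ladder 2).Adj (e a) (e b) ↔
      (a.1 ≠ b.1 ∧ a.2 = b.2 ∨ a.2 ≠ b.2 ∧ a.1 = b.1) := by decide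
  have hb : e.Bijective := (Fintype.bijective_iff_injective_and_card _).2
    ⟨fun a b => he a b, by decide⟩
  refine ⟨⟨Equiv.ofBijective e hb, ?_⟩, rfl, rfl, rfl⟩
  intro a b
  exact (hadj a b).trans
    (boxProd_adj (G := (⊤ : SimpleGraph (Fin 3))) (H := (⊤ : SimpleGraph (Fin 2)))).symm

theorem IsoLadder.extend {T : TriangleGraph} {n : ℕ} (h : T.IsoLadder n) :
    (T.extend 2).IsoLadder (n + 1) := by
  obtain ⟨φ, h0, h1, h2⟩ := h
  obtain ⟨ψ, hψ⟩ := exists_extend_iso φ (s := 2) h2 (isNbrLabeling_ladder_inr true) (by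
    intro j hj
    fin_cases j
    · exact h0
    · exact h1
    · exact absurd rfl hj)
  exact ⟨ψ.trans (blowLadderIso n), congrArg (blowLadderIso n) (hψ 0),
    congrArg (blowLadderIso n) (hψ 1), congrArg (blowLadderIso n) (hψ 2)⟩

theorem isoLadder_extendedPrism (k : ℕ) :
    (extendedPrism (List.replicate k 2)).IsoLadder (k + 1) := by
  induction k with
  | zero => exact isoLadder_prism
  | succ k ih =>
    rw [List.replicate_succ', extendedPrism, List.foldl_append]
    exact ih.extend

theorem nonempty_extendedPrism_iso_ladder (k : ℕ) :
    Nonempty ((extendedPrism (List.replicate k 2)).graph ≃g ladder (k + 2)) :=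
  (isoLadder_extendedPrism k).elim fun φ _ => ⟨φ⟩

theorem nonempty_extendedPrism_iso_prism31 :
    Nonempty ((extendedPrism [2, 0]).graph ≃g prism31) := by
  obtain ⟨φ, h0, h1, h2⟩ := isoLadder_extendedPrism 1
  obtain ⟨ψ, -⟩ := exists_extend_iso φ (s := 0) h0 isNbrLabeling_ladder_three (by
    intro j hj
    fin_cases j
    · exact absurd rfl hj
    · exact h1
    · exact h2)
  exact nonempty_blow_ladder_iso_prism31.map ψ.trans

end TriangleGraph

/-! ### Edge cuts versus 3-connectedness in cubic graphs -/

namespace SimpleGraph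

theorem Preconnected.of_adj_closed {V : Type*} {G : SimpleGraph V} (hG : G.Preconnected)
    {P : V → Prop} (h : ∀ a b, G.Adj a b → P a → P b) {u : V} (hu : P u) (v : V) : P v := by
  obtain ⟨w⟩ := hG u v
  induction w with
  | nil => exact hu
  | cons hab _ ih => exact ih (h _ _ hab hu)

section threeConnected

variable {V : Type*} [Fintype V] [DecidableEq V] {G : SimpleGraph V}

/-- In a cubic graph without small edge cuts, two vertices do not separate. -/
theorem CutsGeThree.exists_adj_of_separation (h3 : G.CutsGeThree) (hG : G.Cubic)
    {A B Y : Finset V} (hA : A.Nonempty) (hB : B.Nonempty) (hAB : Disjoint A B)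
    (hAY : Disjoint A Y) (hBY : Disjoint B Y) (huniv : A ∪ B ∪ Y = Finset.univ)
    (hY : Y.card ≤ 2) : ∃ a ∈ A, ∃ b ∈ B, G.Adj a b := by
  by_contra! hno
  have h0 : G.edgeCount A B = 0 := edgeCount_eq_zero_iff.2 hno
  have hcut : ∀ {A B Y : Finset V}, A.Nonempty → B.Nonempty → Disjoint A B → Disjoint A Y →
      Disjoint B Y → A ∪ B ∪ Y = Finset.univ → 3 ≤ G.edgeCount A B + G.edgeCount A Y := by
    intro A B Y hA hB hAB hAY hBY huniv
    have hc : Aᶜ = B ∪ Y := by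
      refine (eq_compl_iff_isCompl.2 ⟨?_, ?_⟩).symm
      · exact (Finset.disjoint_union_right.2 ⟨hAB, hAY⟩).symm
      · rw [codisjoint_iff, Finset.top_eq_univ, ← huniv, Finset.union_assoc, Finset.sup_eq_union, Finset.union_comm]
    have := h3 A hA (by
      rintro rfl
      obtain ⟨b, hb⟩ := hB
      exact Finset.disjoint_left.1 hAB (Finset.mem_univ b) hb)
    rwa [hc, edgeCount_union_right hBY] at this
  have hBA : G.edgeCount B A = 0 := by rw [edgeCount_comm, h0]
  have h1 := hcut hA hB hAB hAY hBY huniv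
  have h2 := hcut hB hA hAB.symm hBY hAY (by rw [Finset.union_comm B A, huniv])
  have h4 := hG.edgeCount_univ Y
  rw [← huniv, edgeCount_union_right (Finset.disjoint_union_left.2 ⟨hAY, hBY⟩),
    edgeCount_union_right hAB, edgeCount_comm Y A, edgeCount_comm Y B] at h4
  obtain ⟨y, z, hyz, rfl⟩ := Finset.card_eq_two.1 (show Y.card = 2 by omega)
  have h5 : G.edgeCount {y, z} {y, z} = 0 := by
    rw [Finset.card_pair hyz] at h4
    omega
  have hyA : y ∉ A := fun h => Finset.disjoint_left.1 hAY h (by simp)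
  have hzA : z ∉ A := fun h => Finset.disjoint_left.1 hAY h (by simp)
  have hyB : y ∉ B := fun h => Finset.disjoint_left.1 hBY h (by simp)
  have hzB : z ∉ B := fun h => Finset.disjoint_left.1 hBY h (by simp)
  have hd : Disjoint ({y} : Finset V) {z} := Finset.disjoint_singleton.2 hyz
  have hpair : ({y, z} : Finset V) = {y} ∪ {z} := rfl
  have h6 := hG.edgeCount_singleton_univ y
  rw [← huniv, edgeCount_union_right (Finset.disjoint_union_left.2 ⟨hAY, hBY⟩),
    edgeCount_union_right hAB] at h6
  -- So far `Y = {y, z}` is independent and sends exactly three edges to each of `A` and `B`. Hence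
  -- `z` has as many neighbours in `A` as `y` has in `B`, and vice versa. Moving `y`, respectively
  -- `z`, to the side of `A` yields a cut of twice such a number, so both numbers are at least two,
  -- although they add up to three.
  have h7 := hcut (A := A ∪ {y}) (B := B) (Y := {z}) (hA.mono Finset.subset_union_left) hB
    (by simp [hAB, hyB]) (by simp [hzA, hyz.symm]) (by simp [hzB])
    (by rw [← huniv, hpair]; ac_rfl)
  have h8 := hcut (A := A ∪ {z}) (B := B) (Y := {y}) (hA.mono Finset.subset_union_left) hB
    (by simp [hAB, hzB]) (by simp [hyA, hyz]) (by simp [hyB])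
    (by rw [← huniv, hpair]; ac_rfl)
  rw [edgeCount_union_left (by simpa using hyA), edgeCount_union_left (by simpa using hyA)] at h7
  rw [edgeCount_union_left (by simpa using hzA), edgeCount_union_left (by simpa using hzA)] at h8
  rw [hpair, edgeCount_union_left hd, edgeCount_union_right hd, edgeCount_union_right hd] at h5
  rw [Finset.card_pair hyz] at h4
  rw [hpair, edgeCount_union_right hd] at h1 h2 h6
  rw [hpair, edgeCount_union_right hd, edgeCount_union_right hd, edgeCount_union_left hd,
    edgeCount_union_right hd, edgeCount_union_right hd] at h4
  have e1 := G.edgeCount_comm A {y}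
  have e2 := G.edgeCount_comm A {z}
  have e3 := G.edgeCount_comm B {y}
  have e4 := G.edgeCount_comm B {z}
  omega

theorem CutsGeThree.connected_induce [Nonempty V] (h3 : G.CutsGeThree) (hG : G.Cubic) {X : Set V}
    (hX : X.encard ≤ 2) : (G.induce Xᶜ).Connected := by
  classical
  have hY : X.toFinset.card ≤ 2 := by
    rw [← Set.coe_toFinset X, Set.encard_coe_eq_coe_finsetCard] at hX
    exact_mod_cast hX
  have hne : Nonempty (Xᶜ : Set V) := by
    have h4 := hG.four_le_card (Classical.arbitrary V)
    obtain ⟨v, -, hv⟩ := Finset.exists_mem_notMem_of_card_lt_card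
      (show X.toFinset.card < (Finset.univ : Finset V).card by rw [Finset.card_univ]; omega)
    exact ⟨v, by simpa using hv⟩
  refine ⟨fun u v => ?_⟩
  by_contra huv
  let A : Finset V := Finset.univ.filter fun w => ∃ h : w ∈ Xᶜ, (G.induce Xᶜ).Reachable u ⟨w, h⟩
  let B : Finset V := Finset.univ.filter fun w => ∃ h : w ∈ Xᶜ, ¬ (G.induce Xᶜ).Reachable u ⟨w, h⟩
  obtain ⟨a, ha, b, hb, hab⟩ := h3.exists_adj_of_separation hG (A := A) (B := B)
    (Y := X.toFinset) ⟨u, by simp only [A, Finset.mem_filter_univ]; exact ⟨u.2, .rfl⟩⟩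
    ⟨v, by simp only [B, Finset.mem_filter_univ]; exact ⟨v.2, huv⟩⟩
    (by
      rw [Finset.disjoint_left]
      simp only [A, B, Finset.mem_filter_univ]
      rintro w ⟨h, h1⟩ ⟨_, h2⟩
      exact h2 h1)
    (by
      rw [Finset.disjoint_left]
      simp only [A, Finset.mem_filter_univ, Set.mem_toFinset]
      rintro w ⟨h, -⟩
      exact h)
    (by
      rw [Finset.disjoint_left]
      simp only [B, Finset.mem_filter_univ, Set.mem_toFinset]
      rintro w ⟨h, -⟩
      exact h)
    (by
      rw [Finset.eq_univ_iff_forall]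
      intro w
      simp only [A, B, Finset.mem_union, Finset.mem_filter_univ, Set.mem_toFinset]
      by_cases hw : w ∈ X
      · exact .inr hw
      · by_cases hr : (G.induce Xᶜ).Reachable u ⟨w, hw⟩
        · exact .inl (.inl ⟨hw, hr⟩)
        · exact .inl (.inr ⟨hw, hr⟩)) hY
  simp only [A, B, Finset.mem_filter_univ] at ha hb
  obtain ⟨ha, hra⟩ := ha
  obtain ⟨hb, hrb⟩ := hb
  exact hrb (hra.trans (Adj.reachable (induce_adj.2 hab)))

/-- If at most two edges bound `X`, at most two vertices of `X` meet them. Deleting these would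
separate the rest of `X` from the complement, so they are all of `X`. But one or two vertices of a
simple cubic graph are bounded by at least three edges. -/
theorem CutsGeThree.of_connected_induce (hG : G.Cubic)
    (h : ∀ X : Set V, X.encard ≤ 2 → (G.induce Xᶜ).Connected) : G.CutsGeThree := by
  classical
  intro X hX hX'
  by_contra! hlt
  let Y := X.filter fun a => 0 < G.edgeCount {a} Xᶜ
  have hYX : Y ⊆ X := Finset.filter_subset _ _
  have hY : Y.card ≤ 2 := by
    have h1 : Y.card ≤ ∑ a ∈ Y, G.edgeCount {a} Xᶜ := by
      rw [Finset.card_eq_sum_ones]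
      exact Finset.sum_le_sum fun a ha => (Finset.mem_filter.1 ha).2
    rw [← edgeCount_eq_sum_left] at h1
    have := G.edgeCount_mono hYX (Finset.Subset.refl Xᶜ)
    omega
  have hXY : X = Y := by
    refine (Finset.Subset.antisymm hYX fun u hu => ?_).symm
    by_contra huY
    obtain ⟨v, hv⟩ : ∃ v, v ∉ X := by
      by_contra! hall
      exact hX' (Finset.eq_univ_iff_forall.2 hall)
    have hcon := (h (Y : Set V) (by
      rw [Set.encard_coe_eq_coe_finsetCard]
      exact_mod_cast hY)).preconnected
    refine hv (hcon.of_adj_closed (P := fun w => (w : V) ∈ X) ?_ (u := ⟨u, by simpa using huY⟩) hu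
      ⟨v, fun hvY => hv (hYX hvY)⟩)
    rintro ⟨a, ha⟩ ⟨b, hb⟩ hab haX
    by_contra hbX
    refine ha (Finset.mem_filter.2 ⟨haX, edgeCount_pos_iff.2 ⟨a, by simp, b, ?_, hab⟩⟩)
    exact Finset.mem_compl.2 hbX
  have h1 := hG.edgeCount_univ X
  rw [← Finset.union_compl X, edgeCount_union_right disjoint_compl_right] at h1
  have h2 : G.edgeCount X X ≤ X.offDiag.card := by
    rw [edgeCount_eq_card]
    refine Finset.card_le_card fun p hp => ?_
    rw [Finset.mem_filter, Finset.mem_product] at hp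
    exact Finset.mem_offDiag.2 ⟨hp.1.1, hp.1.2, hp.2.ne⟩
  rw [Finset.offDiag_card] at h2
  have h5 : X.card ≤ 2 := hXY ▸ hY
  have h6 := hX.card_pos
  interval_cases X.card <;> omega

end threeConnected

end SimpleGraph

/-! ### From multigraphs to simple graphs, and the main theorem -/

namespace Graph

variable {α β : Type*} {G : Graph α β}

theorem exists_injective_link (G : Graph α β) (v : G.vertexSet) :
    ∃ g : G.toSimpleGraph.neighborSet v → β, g.Injective ∧ (∀ w, G.IsLink (g w) v w) := by
  have h : ∀ w : G.toSimpleGraph.neighborSet v, ∃ e, G.IsLink e v w := fun w => w.2.2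
  choose g hg using h
  refine ⟨g, fun w w' hww => Subtype.ext (Subtype.ext ((hg w).right_unique ?_)), hg⟩
  rw [hww]
  exact hg w'

theorem encard_neighborSet [G.Simple] (v : G.vertexSet) :
    (G.toSimpleGraph.neighborSet v).encard = (G.incidenceSet v).encard := by
  obtain ⟨g, hg, hl⟩ := G.exists_injective_link v
  have : G.incidenceSet v = Set.range g := by
    refine Set.Subset.antisymm (fun e he => ?_) ?_
    · obtain ⟨w, hw⟩ := he
      refine ⟨⟨⟨w, hw.right_mem⟩, fun h => hw.ne (congrArg Subtype.val h), e, hw⟩, ?_⟩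
      exact (hl _).eq hw
    · rintro _ ⟨w, rfl⟩
      exact ⟨w, hl w⟩
  rw [this, ← Set.image_univ, hg.encard_image, Set.encard_univ]
  rfl

theorem isCubic_of_cubic_toSimpleGraph [G.Simple] (h : G.toSimpleGraph.Cubic) : G.IsCubic := by
  intro v hv
  obtain ⟨n, hn, hadj⟩ := h ⟨v, hv⟩
  have h1 : G.toSimpleGraph.neighborSet ⟨v, hv⟩ = Set.range n := by
    ext w
    rw [SimpleGraph.mem_neighborSet, hadj]
    exact exists_congr fun _ => eq_comm
  have h2 : G.loopSet v = ∅ := Set.eq_empty_iff_forall_notMem.2 fun e he => G.not_isLoopAt e v he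
  have h3 := encard_neighborSet (G := G) ⟨v, hv⟩
  rw [h1, ← Set.image_univ, hn.encard_image, Set.encard_univ] at h3
  rw [h2, ← h3]
  simp

/-- Otherwise deleting the neighbours would isolate `v`, and the graph would have at most three
vertices. -/
theorem IsThreeConnected.three_le_encard_neighborSet (h : G.IsThreeConnected) (v : G.vertexSet) :
    3 ≤ (G.toSimpleGraph.neighborSet v).encard := by
  by_contra! hlt
  have hle : (G.toSimpleGraph.neighborSet v).encard ≤ 2 := Order.le_of_lt_add_one hlt
  have hsub : (Set.univ : Set G.vertexSet) ⊆ insert v (G.toSimpleGraph.neighborSet v) := by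
    intro w _
    by_contra hw
    rw [Set.mem_insert_iff, not_or] at hw
    refine hw.1 ((h.2 _ hle).preconnected.of_adj_closed (P := fun u => (u : G.vertexSet) = v) ?_
      (u := ⟨v, by simp⟩) rfl ⟨w, hw.2⟩)
    rintro ⟨a, ha⟩ ⟨b, hb⟩ hab (rfl : a = v)
    exact absurd hab hb
  have h1 := Set.encard_le_encard hsub
  rw [Set.encard_univ] at h1
  have h2 := h1.trans (Set.encard_insert_le _ _)
  have h3 : (4 : ℕ∞) ≤ 2 + 1 := h.1.trans (h2.trans (add_le_add_left hle 1))
  exact absurd h3 (by decide)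

/-- One edge to each of at least three neighbours already uses up the degree, so no loop and no
parallel edge is left at `v`. -/
theorem IsCubic.subset_range_link (hG : G.IsCubic) (h : G.IsThreeConnected) (v : G.vertexSet)
    {g : G.toSimpleGraph.neighborSet v → β} (hg : g.Injective) (hl : ∀ w, G.IsLink (g w) v w) :
    G.loopSet v = ∅ ∧ G.incidenceSet v ⊆ Set.range g := by
  have h1 := h.three_le_encard_neighborSet v
  have h2 : (Set.range g).encard = (G.toSimpleGraph.neighborSet v).encard := by
    rw [← Set.image_univ, hg.encard_image, Set.encard_univ]
    rfl
  have h3 : Set.range g ⊆ G.incidenceSet v := by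
    rintro _ ⟨w, rfl⟩
    exact ⟨w, hl w⟩
  have h4 := Set.encard_le_encard h3
  have h5 := hG v v.2
  have h6 : (G.incidenceSet v).encard ≤ 3 := h5 ▸ le_self_add
  have h7 : (G.incidenceSet v).encard = 3 := h6.antisymm (h1.trans (h2 ▸ h4))
  refine ⟨?_, ?_⟩
  · rw [h7] at h5
    rw [← Set.encard_eq_zero]
    exact ENat.add_right_injective_of_ne_top (by decide) (h5.trans (add_zero 3).symm)
  · refine (Set.Finite.eq_of_subset_of_encard_le ?_ h3 (by rwa [h7, h2])).ge
    exact (Set.finite_of_encard_eq_coe h7).subset h3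

theorem IsCubic.simple (hG : G.IsCubic) (h : G.IsThreeConnected) : G.Simple where
  not_isLoopAt e v he := by
    obtain ⟨g, hg, hl⟩ := G.exists_injective_link ⟨v, he.vertex_mem⟩
    have := (hG.subset_range_link h _ hg hl).1
    exact (this ▸ he : e ∈ (∅ : Set β))
  eq_of_isLink e f x y he hf := by
    obtain ⟨g, hg, hl⟩ := G.exists_injective_link ⟨x, he.left_mem⟩
    have hsub := (hG.subset_range_link h _ hg hl).2
    obtain ⟨w, hw⟩ := hsub ⟨y, he⟩
    obtain ⟨w', hw'⟩ := hsub ⟨y, hf⟩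
    rw [← hw] at he
    rw [← hw'] at hf
    rw [← hw, ← hw']
    exact congrArg g (Subtype.ext (Subtype.ext (((hl w).right_unique he).trans
      (hf.right_unique (hl w')))))

theorem IsCubic.cubic_toSimpleGraph (hG : G.IsCubic) (h : G.IsThreeConnected) :
    G.toSimpleGraph.Cubic := by
  intro v
  have := hG.simple h
  have h1 := hG v v.2
  have h2 : G.loopSet v = ∅ := Set.eq_empty_iff_forall_notMem.2 fun e he => G.not_isLoopAt e v he
  rw [h2, Set.encard_empty, add_zero, ← encard_neighborSet, Set.encard_eq_three] at h1
  obtain ⟨x, y, z, hxy, hxz, hyz, hN⟩ := h1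
  refine ⟨![x, y, z], ?_, fun w => ?_⟩
  · intro i j hij
    fin_cases i <;> fin_cases j <;> simp_all
  · rw [← SimpleGraph.mem_neighborSet, hN]
    simp [Fin.exists_fin_succ]

/-- The edges between the vertices `v` and `f v`. -/
def matchingEdges (G : Graph α β) (f : G.vertexSet → G.vertexSet) : Set β :=
  {e | ∃ v : G.vertexSet, G.IsLink e v (f v)}

theorem mem_matchingEdges_iff {f : G.vertexSet → G.vertexSet} (hf : G.toSimpleGraph.IsPM f) {e : β}
    {u v : G.vertexSet} (he : G.IsLink e u v) : e ∈ G.matchingEdges f ↔ f u = v := by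
  constructor
  · rintro ⟨w, hw⟩
    obtain ⟨h1, h2⟩ | ⟨h1, h2⟩ := he.eq_and_eq_or_eq_and_eq hw
    · rw [Subtype.ext h1, Subtype.ext h2]
    · rw [Subtype.ext h1, Subtype.ext h2, hf.apply_apply]
  · rintro rfl
    exact ⟨u, he⟩

theorem isPerfectMatching_matchingEdges [G.Simple] {f : G.vertexSet → G.vertexSet}
    (hf : G.toSimpleGraph.IsPM f) : G.IsPerfectMatching (G.matchingEdges f) where
  subset_edgeSet := fun e ⟨_, hv⟩ => hv.edge_mem
  not_isLoopAt _ _ _ := G.not_isLoopAt _ _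
  existsUnique_inc v hv := by
    obtain ⟨e, he⟩ := (hf ⟨v, hv⟩).1.2
    refine ⟨e, ⟨⟨_, he⟩, _, he⟩, ?_⟩
    rintro e' ⟨he', w, hw⟩
    have : f ⟨v, hv⟩ = ⟨w, hw.right_mem⟩ := (mem_matchingEdges_iff hf hw).1 he'
    rw [this] at he
    exact hw.eq he

theorem IsPerfectMatching.exists_isPM [G.Simple] {M : Set β} (hM : G.IsPerfectMatching M) :
    ∃ f, G.toSimpleGraph.IsPM f ∧ G.matchingEdges f = M := by
  have h : ∀ v : G.vertexSet, ∃ w : G.vertexSet, ∃ e ∈ M, G.IsLink e v w := by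
    intro v
    obtain ⟨e, ⟨heM, w, hw⟩, -⟩ := hM.existsUnique_inc v v.2
    exact ⟨⟨w, hw.right_mem⟩, e, heM, hw⟩
  choose f e heM hf using h
  have key : ∀ {e' : β} {u v : G.vertexSet}, e' ∈ M → G.IsLink e' u v → e' = e u ∧ v = f u := by
    intro e' u v he' hl
    have h1 : e' = e u := (hM.existsUnique_inc u u.2).unique ⟨he', _, hl⟩ ⟨heM u, _, hf u⟩
    exact ⟨h1, Subtype.ext ((h1 ▸ hl).right_unique (hf u))⟩
  refine ⟨f, fun v => ⟨⟨fun h => ?_, _, hf v⟩, ((key (heM v) (hf v).symm).2).symm⟩, ?_⟩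
  · have := hf v
    rw [← h] at this
    exact hM.not_isLoopAt _ (heM v) _ this
  · refine Set.Subset.antisymm ?_ fun e' he' => ?_
    · rintro e' ⟨v, hv⟩
      rw [hv.eq (hf v)]
      exact heM v
    · obtain ⟨u, v, huv⟩ := exists_isLink_of_mem_edgeSet (hM.subset_edgeSet he')
      have := (key (u := ⟨u, huv.left_mem⟩) (v := ⟨v, huv.right_mem⟩) he' huv).2
      refine ⟨⟨u, huv.left_mem⟩, ?_⟩
      rw [← this]
      exact huv

theorem matchingEdges_injOn [G.Simple] {f g : G.vertexSet → G.vertexSet}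
    (hf : G.toSimpleGraph.IsPM f) (hg : G.toSimpleGraph.IsPM g)
    (h : G.matchingEdges f = G.matchingEdges g) : f = g := by
  funext v
  obtain ⟨e, he⟩ := (hf v).1.2
  exact ((mem_matchingEdges_iff hg he).1 (h ▸ ⟨v, he⟩)).symm

/-- In a simple graph, `matchingEdges` is a bijection from partner involutions to perfect matchings
as edge sets, and it respects containment of the edge. -/
theorem mem_lonelyEdges_iff [G.Simple] {e : β} {u v : G.vertexSet} (he : G.IsLink e u v) :
    e ∈ G.lonelyEdges ↔ s(u, v) ∈ G.toSimpleGraph.lonelySet := by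
  rw [SimpleGraph.mk_mem_lonelySet]
  constructor
  · rintro ⟨-, M, ⟨hM, heM⟩, hu⟩
    obtain ⟨f, hf, rfl⟩ := hM.exists_isPM
    refine ⟨f, ⟨hf, (mem_matchingEdges_iff hf he).1 heM⟩, fun g ⟨hg, hgu⟩ => ?_⟩
    exact matchingEdges_injOn hg hf
      (hu _ ⟨isPerfectMatching_matchingEdges hg, (mem_matchingEdges_iff hg he).2 hgu⟩)
  · rintro ⟨f, ⟨hf, hfu⟩, hu⟩
    refine ⟨he.edge_mem, _, ⟨isPerfectMatching_matchingEdges hf,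
      (mem_matchingEdges_iff hf he).2 hfu⟩, fun M ⟨hM, heM⟩ => ?_⟩
    obtain ⟨g, hg, rfl⟩ := hM.exists_isPM
    rw [hu g ⟨hg, (mem_matchingEdges_iff hg he).1 heM⟩]

theorem encard_lonelyEdges [G.Simple] :
    G.lonelyEdges.encard = G.toSimpleGraph.lonelySet.encard := by
  have h : ∀ e : G.lonelyEdges, ∃ u v : G.vertexSet, G.IsLink e u v := by
    rintro ⟨e, he, -⟩
    obtain ⟨u, v, huv⟩ := exists_isLink_of_mem_edgeSet he
    exact ⟨⟨u, huv.left_mem⟩, ⟨v, huv.right_mem⟩, huv⟩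
  choose u v huv using h
  let F : G.lonelyEdges → G.toSimpleGraph.lonelySet := fun e =>
    ⟨s(u e, v e), (mem_lonelyEdges_iff (huv e)).1 e.2⟩
  refine Set.encard_congr (Equiv.ofBijective F ⟨fun e e' hee => ?_, ?_⟩)
  · have h1 : s(u e, v e) = s(u e', v e') := congrArg Subtype.val hee
    refine Subtype.ext ((huv e).eq ?_)
    obtain ⟨h1, h2⟩ | ⟨h1, h2⟩ := Sym2.eq_iff.1 h1
    · rw [h1, h2]
      exact huv e'
    · rw [h1, h2]
      exact (huv e').symm
  · rintro ⟨s, hs⟩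
    induction s using Sym2.ind with | _ a b =>
    obtain ⟨f, ⟨hf, hfa⟩, -⟩ := SimpleGraph.mk_mem_lonelySet.1 hs
    obtain ⟨e, he⟩ := (hf a).1.2
    rw [hfa] at he
    refine ⟨⟨e, (mem_lonelyEdges_iff he).2 hs⟩, Subtype.ext ?_⟩
    have := huv ⟨e, (mem_lonelyEdges_iff he).2 hs⟩
    obtain ⟨h1, h2⟩ | ⟨h1, h2⟩ := this.eq_and_eq_or_eq_and_eq he
    · exact Sym2.eq_iff.2 (.inl ⟨Subtype.ext h1, Subtype.ext h2⟩)
    · exact Sym2.eq_iff.2 (.inr ⟨Subtype.ext h1, Subtype.ext h2⟩)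

theorem memU_of_iso [G.Simple] {W : Type*} [Fintype W] [DecidableEq W] [Nonempty W]
    {H : SimpleGraph W} (φ : G.toSimpleGraph ≃g H) (hc : H.Cubic) (h3 : H.CutsGeThree) {k : ℕ}
    (hl : H.lonelySet.encard = k) : G.MemU k := by
  classical
  have : Fintype G.vertexSet := Fintype.ofEquiv W φ.symm.toEquiv
  have : Nonempty G.vertexSet := φ.symm.toEquiv.nonempty_congr.1 inferInstance
  have hG := hc.map_iso φ.symm
  refine ⟨Set.toFinite _, isCubic_of_cubic_toSimpleGraph hG,
    ⟨?_, fun X hX => (h3.map_iso φ.symm).connected_induce hG hX⟩, ?_⟩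
  · rw [Set.encard_eq_coe_toFinset_card, Set.toFinset_card]
    exact_mod_cast hG.four_le_card (Classical.arbitrary _)
  · rw [encard_lonelyEdges, SimpleGraph.encard_lonelySet_eq φ, hl]

theorem MemU.isLadderOrPrism31 (h : G.MemU 4) : G.Simple ∧
    ((∃ k, 2 ≤ k ∧ Nonempty (G.toSimpleGraph ≃g SimpleGraph.ladder (k + 2))) ∨
      Nonempty (G.toSimpleGraph ≃g SimpleGraph.prism31)) := by
  classical
  have hs := h.cubic.simple h.threeConnected
  refine ⟨hs, ?_⟩
  have : Fintype G.vertexSet := h.finite.fintype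
  have hc := h.cubic.cubic_toSimpleGraph h.threeConnected
  have h4 := MemU.encard_lonelyEdges h
  rw [Graph.encard_lonelyEdges] at h4
  have h4' : G.toSimpleGraph.lonelySet.ncard = 4 := by
    rw [Set.ncard_def, h4]
    rfl
  have hne : G.toSimpleGraph.lonelySet.Nonempty := Set.nonempty_of_ncard_ne_zero (by omega)
  refine ((SimpleGraph.isLadderOrPrism31_of_four_le rfl hc
    (SimpleGraph.CutsGeThree.of_connected_induce hc h.threeConnected.2) hne).2 h4'.ge).imp_left ?_
  rintro ⟨n, ⟨φ⟩⟩
  rw [SimpleGraph.ncard_lonelySet_eq φ] at h4'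
  have hn : 3 ≤ n := by
    by_contra! hn
    exact SimpleGraph.ncard_lonelySet_ladder_ne (by omega) h4'
  obtain ⟨k, rfl⟩ : ∃ k, n = k + 1 := ⟨n - 1, by omega⟩
  exact ⟨k, by omega, ⟨φ⟩⟩

end Graph

theorem mainTheorem1 {α β : Type*} (G : Graph α β) :
    G.MemU 4 ↔
      G.IsExtendedPrism [2, 0] ∨ ∃ k : ℕ, 2 ≤ k ∧ G.IsExtendedPrism (List.replicate k 2) := by
  constructor
  · intro h
    obtain ⟨hs, ⟨k, hk, ⟨φ⟩⟩ | ⟨⟨φ⟩⟩⟩ := h.isLadderOrPrism31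
    · exact .inr ⟨k, hk, hs,
        (TriangleGraph.nonempty_extendedPrism_iso_ladder k).map fun ψ => φ.trans ψ.symm⟩
    · exact .inl ⟨hs, TriangleGraph.nonempty_extendedPrism_iso_prism31.map fun ψ => φ.trans ψ.symm⟩
  · rintro (⟨hs, ⟨φ⟩⟩ | ⟨k, hk, hs, ⟨φ⟩⟩)
    · obtain ⟨ψ⟩ := TriangleGraph.nonempty_extendedPrism_iso_prism31
      exact Graph.memU_of_iso (φ.trans ψ) SimpleGraph.cubic_prism31
        SimpleGraph.cutsGeThree_prism31 SimpleGraph.encard_lonelySet_prism31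
    · obtain ⟨ψ⟩ := TriangleGraph.nonempty_extendedPrism_iso_ladder k
      refine Graph.memU_of_iso (φ.trans ψ) (SimpleGraph.cubic_ladder (k + 1))
        (SimpleGraph.cutsGeThree_ladder (k + 1)) ?_
      rw [SimpleGraph.lonelySet_ladder (by omega), ← Set.Finite.cast_ncard_eq (Set.toFinite _),
        SimpleGraph.ncard_range_capEdge]
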